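/- **Setting.** Fix $0<\varepsilon<\tfrac12$. Let the base circle be $\mathbb R/2\mathbb Z$ (the interval $[-1,1]$ with its ends joined) and let $T^2=(\mathbb R/2\mathbb Z)\times S^1$ with coordinates $(x,\theta)$. Let $\chi_1,\chi_2$ be smooth even functions on the base circle with $\chi_1=1,\ \chi_2=0$ on $|x|\le\varepsilon$ and $\chi_1=0,\ \chi_2=1$ on $2\varepsilon\le|x|\le1$, and such that $\chi_1+\chi_2$ is not identically $1$ on the bridge $[\varepsilon,2\varepsilon]$. For $f\in C^\infty([\varepsilon,2\varepsilon])$, extended by $f(-x)=f(x)$, put $$a_f(x)=\sqrt{1-x^2}\,\chi_1(x)+\tfrac12\sqrt{1-\varepsilon^2}\,\chi_2(x)+f(x)\bigl(1-\chi_1(x)-\chi_2(x)\bigr),\qquad |x|\le 1.$$ Call $f$ admissible if $a_f>0$ everywhere; then $g_f=dx^2+a_f(x)^2d\theta^2$ is a Riemannian metric on $T^2$, with Laplacian $\Delta_f$. Give $C^\infty([\varepsilon,2\varepsilon])$ the $C^\infty$ topology (uniform convergence of all derivatives). Let $\mathcal M_{irr}$ be the set of admissible $f$ such that for every eigenvalue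 $\lambda$ the real eigenspace $\{u\in C^\infty(T^2;\mathbb R): -\Delta_f u=\lambda u\}$ is an irreducible real representation of $S^1$ (acting by rotation of $\theta$). **Lemma 7.8.** 1. The set of admissible $f$ is open in $C^\infty([\varepsilon,2\varepsilon])$, and $\mathcal M_{irr}$ is residual in it, i.e. contains a countable intersection of open dense subsets of it. 2. For every $f_0\in C^\infty([\varepsilon,2\varepsilon])$ and $\delta>0$, $\mathcal M_{irr}$ is residual in the set of admissible $f$ in the closed ball $B_\delta(f_0)$, where the ball is taken either for the Fréchet distance $d(f,h)=\sum_{k\ge0}2^{-k}\frac{d_k(f,h)}{1+d_k(f,h)}$, or for one of the $C^k$ distances $d_k(f,h)=\sum_{j\le k}\sup_{[\varepsilon,2\varepsilon]}|f^{(j)}-h^{(j)}|$, $k\ge0$. 3. Let $a$ be any smooth positive function on the base circle, let $n,m\in\mathbb Z$ with $|n|\ne|m|$, and let $\Phi,\Psi$ be smooth complex eigenfunctions of the Laplacian of $dx^2+a(x)^2d\theta^2$, with the same eigenvalue, $\Phi\not\equiv 0$, of the form $\Phi(x,\theta)=e^{in\theta}\Phi(x,0)$ and $\Psi(x,\theta)=e^{im\theta}\Psi(x,0)$.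 If $|\Phi|=|\Psi|$ on $T^2$, then $a$ is constant, so that the metric is flat. -/

import Mathlib

open scoped ContDiff Matrix

noncomputable section

namespace TorusOfRevolution

/-! ### The space of smooth functions on a compact interval -/

/-- `C^∞([a, b])`: real functions on `[a, b]`, smooth up to the end points. (Smoothness on the set
`[a, b]` does not depend on the values outside, which are set to `0`.) -/
structure SmoothIcc (a b : ℝ) where
  toFun : Set.Icc a b → ℝ
  smooth : ContDiffOn ℝ ∞ (Function.extend ((↑) : Set.Icc a b → ℝ) toFun 0) (Set.Icc a b)

namespace SmoothIcc

variable {a b : ℝ}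

/-- The function `f ∈ C^∞([a, b])` on the real line, with value `0` outside `[a, b]`. -/
def ext (f : SmoothIcc a b) : ℝ → ℝ :=
  Function.extend ((↑) : Set.Icc a b → ℝ) f.toFun 0

/-- The `k`-th derivative of `f` on `[a, b]` (one-sided at the end points). -/
def deriv (k : ℕ) (f : SmoothIcc a b) : Set.Icc a b → ℝ :=
  fun x => iteratedDerivWithin k f.ext (Set.Icc a b) x

/-- The (Whitney) `C^∞` topology: uniform convergence on `[a, b]` of the derivatives of every
order. -/
instance : TopologicalSpace (SmoothIcc a b) :=
  TopologicalSpace.induced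
    (fun f => fun k : ℕ => UniformFun.ofFun (deriv k f) : SmoothIcc a b → ℕ → UniformFun _ ℝ)
    inferInstance

/-- The `C^k` distance `∑_{j ≤ k} sup |f^{(j)} - g^{(j)}|`. -/
def distC (k : ℕ) (f g : SmoothIcc a b) : ℝ :=
  ∑ j ∈ Finset.range (k + 1), ⨆ x : Set.Icc a b, |deriv j f x - deriv j g x|

/-- The standard Fréchet distance on `C^∞([a, b])`, built from the `C^k` distances. -/
def distFrechet (f g : SmoothIcc a b) : ℝ :=
  ∑' k : ℕ, (1 / 2 : ℝ) ^ k * (distC k f g / (1 + distC k f g))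

end SmoothIcc

/-- `S ∩ Y` is residual in the subspace `Y`, i.e. it contains a countable intersection of relatively
open dense subsets of `Y`. -/
def IsResidualIn {X : Type*} [TopologicalSpace X] (S Y : Set X) : Prop :=
  ((↑) ⁻¹' S : Set Y) ∈ residual Y

/-! ### The Laplacian of a Riemannian metric in coordinates -/

section Laplacian

variable {F : Type*} [NormedAddCommGroup F] [NormedSpace ℝ F]

/-- The coordinate derivative `∂_i u`. -/
def pderiv (i : Fin 2) (u : (Fin 2 → ℝ) → F) : (Fin 2 → ℝ) → F :=
  fun p => fderiv ℝ u p (Pi.single i 1)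

/-- The Christoffel symbol `Γ^k_{ij} = ½ ∑_l g^{kl} (∂_i g_{jl} + ∂_j g_{il} - ∂_l g_{ij})`. -/
def christoffel (g : (Fin 2 → ℝ) → Matrix (Fin 2) (Fin 2) ℝ) (k i j : Fin 2) (p : Fin 2 → ℝ) : ℝ :=
  1 / 2 * ∑ l, (g p)⁻¹ k l *
    (pderiv i (fun q => g q j l) p + pderiv j (fun q => g q i l) p - pderiv l (fun q => g q i j) p)

/-- The Laplace-Beltrami operator `Δ u = ∑ g^{ij} (∂_i ∂_j u - ∑_k Γ^k_{ij} ∂_k u)`, the trace of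
the Hessian. -/
def laplaceBeltrami (g : (Fin 2 → ℝ) → Matrix (Fin 2) (Fin 2) ℝ) (u : (Fin 2 → ℝ) → F)
    (p : Fin 2 → ℝ) : F :=
  ∑ i, ∑ j, (g p)⁻¹ i j •
    (pderiv i (pderiv j u) p - ∑ k, christoffel g k i j p • pderiv k u p)

/-- The metric `dx² + a(x)² dθ²` in the coordinates `p = (x, θ)`. -/
def revolutionMetric (a : ℝ → ℝ) (p : Fin 2 → ℝ) : Matrix (Fin 2) (Fin 2) ℝ :=
  !![1, 0; 0, a (p 0) ^ 2]

/-- The torus `(ℝ / 2ℤ) × S¹`: the base circle (`[-1, 1]` with its ends joined) times the fibre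
circle. -/
abbrev Torus : Type := AddCircle (2 : ℝ) × Circle

/-- A function on the torus, read in the coordinates `(x, θ) ↦ (x mod 2, e^{iθ})` on the universal
cover. -/
def lift (u : Torus → F) (p : Fin 2 → ℝ) : F :=
  u ((p 0 : AddCircle (2 : ℝ)), Circle.exp (p 1))

theorem contDiff_pderiv {u : (Fin 2 → ℝ) → F} (hu : ContDiff ℝ ∞ u) (i : Fin 2) :
    ContDiff ℝ ∞ (pderiv i u) :=
  (hu.fderiv_right (by simp)).clm_apply contDiff_const

theorem pderiv_add {u v : (Fin 2 → ℝ) → F} (hu : ContDiff ℝ ∞ u) (hv : ContDiff ℝ ∞ v)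
    (i : Fin 2) : pderiv i (u + v) = pderiv i u + pderiv i v := by
  funext p
  simp only [pderiv, Pi.add_apply]
  rw [fderiv_add (hu.differentiable (by simp) p) (hv.differentiable (by simp) p)]
  rfl

theorem pderiv_smul {u : (Fin 2 → ℝ) → F} (c : ℝ) (i : Fin 2) :
    pderiv i (c • u) = c • pderiv i u := by
  funext p
  simp only [pderiv, Pi.smul_apply]
  rw [fderiv_const_smul_field]
  rfl

theorem laplaceBeltrami_add (g : (Fin 2 → ℝ) → Matrix (Fin 2) (Fin 2) ℝ)
    {u v : (Fin 2 → ℝ) → F} (hu : ContDiff ℝ ∞ u) (hv : ContDiff ℝ ∞ v) (p : Fin 2 → ℝ) :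
    laplaceBeltrami g (u + v) p = laplaceBeltrami g u p + laplaceBeltrami g v p := by
  simp only [laplaceBeltrami, pderiv_add hu hv,
    pderiv_add (contDiff_pderiv hu _) (contDiff_pderiv hv _), Pi.add_apply, Fin.sum_univ_two]
  module

theorem laplaceBeltrami_smul (g : (Fin 2 → ℝ) → Matrix (Fin 2) (Fin 2) ℝ)
    (u : (Fin 2 → ℝ) → F) (c : ℝ) (p : Fin 2 → ℝ) :
    laplaceBeltrami g (c • u) p = c • laplaceBeltrami g u p := by
  simp only [laplaceBeltrami, pderiv_smul, Pi.smul_apply, Fin.sum_univ_two]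
  module

theorem pderiv_comp_add (u : (Fin 2 → ℝ) → F) (c : Fin 2 → ℝ) (i : Fin 2) :
    pderiv i (fun q => u (q + c)) = fun p => pderiv i u (p + c) := by
  funext p
  simp only [pderiv]
  rw [fderiv_comp_add_right]

theorem revolutionMetric_add (a : ℝ → ℝ) (p c : Fin 2 → ℝ) (hc : c 0 = 0) :
    revolutionMetric a (p + c) = revolutionMetric a p := by
  simp [revolutionMetric, hc]

theorem laplaceBeltrami_comp_add (a : ℝ → ℝ) (u : (Fin 2 → ℝ) → F) (c : Fin 2 → ℝ)
    (hc : c 0 = 0) (p : Fin 2 → ℝ) :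
    laplaceBeltrami (revolutionMetric a) (fun q => u (q + c)) p =
      laplaceBeltrami (revolutionMetric a) u (p + c) := by
  have key : ∀ i j l : Fin 2, pderiv l (fun q => revolutionMetric a q i j) (p + c) =
      pderiv l (fun q => revolutionMetric a q i j) p := by
    intro i j l
    have h := congrFun (pderiv_comp_add (fun q => revolutionMetric a q i j) c l) p
    simp only [revolutionMetric_add a _ c hc] at h
    exact h.symm
  have hG : ∀ k i j : Fin 2, christoffel (revolutionMetric a) k i j (p + c) =
      christoffel (revolutionMetric a) k i j p := by
    intro k i j
    simp only [christoffel, revolutionMetric_add a p c hc, key]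
  simp only [laplaceBeltrami, pderiv_comp_add, revolutionMetric_add a p c hc, hG]

variable (F) in
/-- The eigenspace `{u ∈ C^∞(T²; F) : -Δ u = lam u}` of the Laplacian of the metric
`dx² + a(x)² dθ²` on the torus. -/
def eigenspace (a : ℝ → ℝ) (lam : ℝ) : Submodule ℝ (Torus → F) where
  carrier := {u | ContDiff ℝ ∞ (lift u) ∧
    ∀ p, -laplaceBeltrami (revolutionMetric a) (lift u) p = lam • lift u p}
  zero_mem' := by
    have h0 : lift (0 : Torus → F) = (0 : ℝ) • lift (0 : Torus → F) := by
      funext p; simp [lift]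
    refine ⟨contDiff_const (c := (0 : F)), fun p => ?_⟩
    rw [h0, laplaceBeltrami_smul]
    simp
  add_mem' := by
    rintro u v ⟨hu, hu'⟩ ⟨hv, hv'⟩
    have h : lift (u + v) = lift u + lift v := rfl
    refine ⟨h ▸ hu.add hv, fun p => ?_⟩
    rw [h, laplaceBeltrami_add _ hu hv, neg_add, hu', hv', Pi.add_apply, smul_add]
  smul_mem' := by
    rintro c u ⟨hu, hu'⟩
    have h : lift (c • u) = c • lift u := rfl
    refine ⟨h ▸ hu.const_smul c, fun p => ?_⟩
    rw [h, laplaceBeltrami_smul, ← smul_neg, hu', Pi.smul_apply, smul_comm]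

end Laplacian

/-! ### The action of the circle -/

/-- The action of `S¹` on real functions on the torus by rotation of the fibre circle. -/
def rotation : Representation ℝ Circle (Torus → ℝ) where
  toFun z :=
    { toFun := fun u s => u (s.1, z⁻¹ * s.2)
      map_add' := fun _ _ => rfl
      map_smul' := fun _ _ => rfl }
  map_one' := by ext u s; simp
  map_mul' z w := by ext u s; simp [mul_assoc]

/-- The real eigenspace, as a subrepresentation of the action of `S¹`. -/
def eigenrep (a : ℝ → ℝ) (lam : ℝ) : Subrepresentation rotation where
  toSubmodule := eigenspace ℝ a lam
  apply_mem_toSubmodule := by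
    rintro z u ⟨hu, hu'⟩
    set c : Fin 2 → ℝ := Pi.single 1 (Complex.arg ((z⁻¹ : Circle) : ℂ)) with hc
    have h : lift (rotation z u) = fun p => lift u (p + c) := by
      funext p
      have hz : Circle.exp (c 1) = z⁻¹ := by
        rw [hc, Pi.single_eq_same, Circle.exp_arg]
      have h0 : c 0 = 0 := by simp [hc]
      simp only [lift, rotation, Pi.add_apply, Circle.exp_add, hz, h0, add_zero]
      rw [mul_comm (Circle.exp (p 1))]
      rfl
    refine ⟨?_, fun p => ?_⟩
    · rw [h]
      exact hu.comp (contDiff_id.add contDiff_const)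
    · rw [h, laplaceBeltrami_comp_add a (lift u) c (by simp [hc])]
      exact hu' (p + c)

/-! ### Profiles with a spherical, a bridge and a flat region -/

/-- The pair of cut-off functions on the circle `ℝ / 2ℤ`: smooth and even, `χ₁ = 1`, `χ₂ = 0` on the
spherical part `|x| ≤ ε` and `χ₁ = 0`, `χ₂ = 1` on the flat part `2ε ≤ |x| ≤ 1`; on the bridge
`ε ≤ |x| ≤ 2ε` they do not add up to `1` identically. -/
structure IsCutoffPair (ε : ℝ) (χ₁ χ₂ : ℝ → ℝ) : Prop where
  smooth₁ : ContDiff ℝ ∞ χ₁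
  smooth₂ : ContDiff ℝ ∞ χ₂
  periodic₁ : Function.Periodic χ₁ 2
  periodic₂ : Function.Periodic χ₂ 2
  even₁ : ∀ x, χ₁ (-x) = χ₁ x
  even₂ : ∀ x, χ₂ (-x) = χ₂ x
  sphere₁ : ∀ x, |x| ≤ ε → χ₁ x = 1
  sphere₂ : ∀ x, |x| ≤ ε → χ₂ x = 0
  flat₁ : ∀ x, 2 * ε ≤ |x| → |x| ≤ 1 → χ₁ x = 0
  flat₂ : ∀ x, 2 * ε ≤ |x| → |x| ≤ 1 → χ₂ x = 1
  bridge : ∃ x ∈ Set.Icc ε (2 * ε), χ₁ x + χ₂ x ≠ 1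

/-- The coordinate in `[-1, 1)` of the point `x mod 2` of the base circle. -/
def baseCoord (x : ℝ) : ℝ := toIcoMod (zero_lt_two : (0 : ℝ) < 2) (-1) x

/-- The profile `a_f = √(1 - x²) χ₁ + ½ √(1 - ε²) χ₂ + f (1 - χ₁ - χ₂)` for `x ∈ [-1, 1)`, with `f`
extended to an even function, continued with period `2`. (The values of `f` off the bridge do not
matter, since the factor `1 - χ₁ - χ₂` is zero there.) -/
def profile (ε : ℝ) (χ₁ χ₂ : ℝ → ℝ) (f : SmoothIcc ε (2 * ε)) (x : ℝ) : ℝ :=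
  Real.sqrt (1 - baseCoord x ^ 2) * χ₁ (baseCoord x)
    + 1 / 2 * Real.sqrt (1 - ε ^ 2) * χ₂ (baseCoord x)
    + f.ext |baseCoord x| * (1 - χ₁ (baseCoord x) - χ₂ (baseCoord x))

/-- The bridge functions `f` for which `a_f > 0`, i.e. for which `dx² + a_f(x)² dθ²` is a torus of
revolution. -/
def admissible (ε : ℝ) (χ₁ χ₂ : ℝ → ℝ) : Set (SmoothIcc ε (2 * ε)) :=
  {f | ∀ x, 0 < profile ε χ₁ χ₂ f x}

/-- The admissible `f` for which every (nonzero) real eigenspace of the Laplacian `Δ_f` is an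
irreducible representation of `S¹`. -/
def irreducibleSet (ε : ℝ) (χ₁ χ₂ : ℝ → ℝ) : Set (SmoothIcc ε (2 * ε)) :=
  {f | f ∈ admissible ε χ₁ χ₂ ∧ ∀ lam : ℝ, eigenspace ℝ (profile ε χ₁ χ₂ f) lam ≠ ⊥ →
    (eigenrep (profile ε χ₁ χ₂ f) lam).toRepresentation.IsIrreducible}

/-- `Φ` is `S¹`-equivariant of weight `n`: `Φ(x, θ) = e^{inθ} Φ(x, 0)`. -/
def IsEquivariant (n : ℤ) (Φ : Torus → ℂ) : Prop :=
  ∀ (s : Torus) (z : Circle), Φ (s.1, z * s.2) = (z : ℂ) ^ n * Φ s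

end TorusOfRevolution

end

open scoped ContDiff Matrix

noncomputable section

namespace TorusOfRevolution

open Set MeasureTheory Filter Topology unitInterval

/-! Separation of variables turns the eigenvalue equation into the systems `u' = p / a`, `p' = (n² /
a - λ a) u`. Since the profile is even, each weight `n ≥ 0` splits into a Neumann and a Dirichlet
problem on `[0, 1]`; a type is a weight with a parity, and `endVal` vanishes exactly at the
eigenvalues of that type. If `λ` is an eigenvalue of at most one type, its eigenfunctions are all of
the form `w(x) Re (γ e^{inθ})` with the same `w` and `n` (`exists_normal_form`), and any nonzero one
yields the others by rotation and scaling. So it suffices that for two distinct types and a compact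
set of `λ` the bridge functions without a common eigenvalue there (`goodOn`) form an open set that
is dense among the admissible ones; countably many such sets exhaust all cases.

Openness is continuity of `endVal` in profile and `λ`. Density is by contradiction. If common
eigenvalues persist on an open set, local uniqueness of the eigenvalue of one type gives a common
eigenvalue `ℓ` that is continuous on a smaller open set. Green's formula gives its first variation,
with density `q = u'² - (n² / a² + ℓ) u²`. Computing it from both eigenfunctions `u`, `v`, of
weights `n`, `m`, gives `c q_u = d q_v` on the bridge, where `c` and `d` are the squared norms of
`v` and `u`. For `w = c u² - d v²` two differentiations yield that `a w` is a nonzero constant and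
that `4 (c n² u² - d m² v²) = w (a'² - a a'')`.

If `n = m`, then `a'² - a a'' = 4 n²` for all profiles in the open set, which a small perturbation
violates. If `n ≠ m`, the profile on any small interval determines `u²` up to a factor, and hence
`ℓ`. Changing the profile on a disjoint interval then leaves `ℓ` fixed, so both densities vanish
there, and `a'² = 4 n² + 4 ℓ a² = 4 m² + 4 ℓ a²`, a contradiction (`false_of_mem`).

For closed balls, moving towards the centre leads into the interior, so density passes to the ball.
The flatness statement follows by differentiating the equality of the moduli along `θ = 0`
(`deriv_eq_zero_of_norm_eq`). -/

/-! ### Linear planar systems `u' = α p`, `p' = β u` on the unit interval -/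

/-- A continuous function on `[0, 1]`, extended to the line by its boundary values. -/
def iext (f : C(I, ℝ)) : ℝ → ℝ := IccExtend zero_le_one f

theorem continuous_iext (f : C(I, ℝ)) : Continuous (iext f) := f.continuous.Icc_extend'

theorem iext_coe (f : C(I, ℝ)) (t : I) : iext f t = f t := IccExtend_val _ _ _

theorem iext_of_mem (f : C(I, ℝ)) {t : ℝ} (ht : t ∈ Icc (0 : ℝ) 1) : iext f t = f ⟨t, ht⟩ :=
  IccExtend_of_mem _ _ ht

theorem abs_iext_le (f : C(I, ℝ)) (t : ℝ) : |iext f t| ≤ ‖f‖ :=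
  f.norm_coe_le_norm _

/-- The primitive vanishing at `0`, as an operator on `C([0, 1])`. -/
def primitive : C(I, ℝ) →L[ℝ] C(I, ℝ) :=
  LinearMap.mkContinuous
    { toFun := fun f => ⟨fun t => ∫ s in (0 : ℝ)..t, iext f s,
        (intervalIntegral.continuous_primitive
          (fun a b => (continuous_iext f).intervalIntegrable a b) 0).comp continuous_subtype_val⟩
      map_add' := fun f g => by
        ext t
        exact intervalIntegral.integral_add ((continuous_iext f).intervalIntegrable _ _)
          ((continuous_iext g).intervalIntegrable _ _)
      map_smul' := fun c f => by
        ext t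
        exact intervalIntegral.integral_const_mul c (iext f) } 1 (by
    intro f
    rw [one_mul, ContinuousMap.norm_le _ (norm_nonneg _)]
    intro t
    refine (intervalIntegral.norm_integral_le_of_norm_le_const
      (fun s _ => abs_iext_le f s)).trans ?_
    rw [sub_zero, abs_of_nonneg t.2.1]
    exact mul_le_of_le_one_right (norm_nonneg _) t.2.2)

theorem primitive_apply (f : C(I, ℝ)) (t : I) : primitive f t = ∫ s in (0 : ℝ)..t, iext f s := rfl

/-- The Volterra operator `(u, p) ↦ (∫ α p, ∫ β u)`. -/
def volterra (c : C(I, ℝ) × C(I, ℝ)) : (C(I, ℝ) × C(I, ℝ)) →L[ℝ] C(I, ℝ) × C(I, ℝ) :=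
  ((primitive.comp (ContinuousLinearMap.mul ℝ C(I, ℝ) c.1)).comp
      (ContinuousLinearMap.snd ℝ C(I, ℝ) C(I, ℝ))).prod
    ((primitive.comp (ContinuousLinearMap.mul ℝ C(I, ℝ) c.2)).comp
      (ContinuousLinearMap.fst ℝ C(I, ℝ) C(I, ℝ)))

theorem volterra_apply (c y : C(I, ℝ) × C(I, ℝ)) :
    volterra c y = (primitive (c.1 * y.2), primitive (c.2 * y.1)) := rfl

theorem continuous_volterra : Continuous volterra := by
  unfold volterra
  refine (ContinuousLinearMap.prodₗᵢ (𝕜 := ℝ) (E := C(I, ℝ) × C(I, ℝ)) (F := C(I, ℝ))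
    (G := C(I, ℝ)) ℝ).continuous.comp (Continuous.prodMk ?_ ?_)
  · exact (continuous_const.clm_comp
      ((ContinuousLinearMap.mul ℝ C(I, ℝ)).continuous.comp continuous_fst)).clm_comp
      continuous_const
  · exact (continuous_const.clm_comp
      ((ContinuousLinearMap.mul ℝ C(I, ℝ)).continuous.comp continuous_snd)).clm_comp
      continuous_const

theorem abs_primitive_mul_le {M K : ℝ} {α f : C(I, ℝ)} (hM : ‖α‖ ≤ M) (n : ℕ)
    (hf : ∀ t : I, |f t| ≤ K * (t : ℝ) ^ n) (t : I) :
    |primitive (α * f) t| ≤ M * K / (n + 1) * (t : ℝ) ^ (n + 1) := by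
  have h : ‖∫ s in (0 : ℝ)..t, iext (α * f) s‖ ≤ ∫ s in (0 : ℝ)..t, M * K * s ^ n := by
    refine intervalIntegral.norm_integral_le_of_norm_le t.2.1 ?_
      (Continuous.intervalIntegrable (by fun_prop) _ _)
    refine Eventually.of_forall fun s hs => ?_
    have hs' : s ∈ Icc (0 : ℝ) 1 := ⟨hs.1.le, hs.2.trans t.2.2⟩
    rw [iext_of_mem _ hs', ContinuousMap.mul_apply, norm_mul, mul_assoc]
    exact mul_le_mul ((α.norm_coe_le_norm _).trans hM) (hf ⟨s, hs'⟩) (norm_nonneg _)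
      ((norm_nonneg _).trans hM)
  rw [intervalIntegral.integral_const_mul, integral_pow] at h
  rw [primitive_apply]
  refine h.trans (le_of_eq ?_)
  simp
  ring

/-- Each application integrates `t ^ n` once more, and the factors `1 / (n + 1)` build up the
factorial that makes high powers contractions. -/
theorem abs_volterra_pow_le {M : ℝ} {c : C(I, ℝ) × C(I, ℝ)} (h₁ : ‖c.1‖ ≤ M) (h₂ : ‖c.2‖ ≤ M)
    (y : C(I, ℝ) × C(I, ℝ)) (n : ℕ) (t : I) :
    |((volterra c ^ n) y).1 t| ≤ M ^ n / n.factorial * ‖y‖ * (t : ℝ) ^ n ∧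
      |((volterra c ^ n) y).2 t| ≤ M ^ n / n.factorial * ‖y‖ * (t : ℝ) ^ n := by
  induction n generalizing t with
  | zero =>
    simp only [pow_zero, Nat.factorial_zero, Nat.cast_one, div_one, one_mul, mul_one]
    exact ⟨(y.1.norm_coe_le_norm t).trans (norm_fst_le y),
      (y.2.norm_coe_le_norm t).trans (norm_snd_le y)⟩
  | succ n ih =>
    have hfac : M * (M ^ n / n.factorial * ‖y‖) / (n + 1) =
        M ^ (n + 1) / (n + 1).factorial * ‖y‖ := by
      rw [Nat.factorial_succ]
      push_cast
      field_simp
      ring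
    rw [pow_succ', mul_apply_eq_comp, volterra_apply, ← hfac]
    exact ⟨abs_primitive_mul_le h₁ n (fun t => (ih t).2) t,
      abs_primitive_mul_le h₂ n (fun t => (ih t).1) t⟩

/-- The operator itself may be large, but some power `V ^ n` has norm below `1`, so `1 - V ^ n` is
invertible, and `1 - V` is a commuting factor of it. -/
theorem isUnit_one_sub_volterra (c : C(I, ℝ) × C(I, ℝ)) : IsUnit (1 - volterra c) := by
  have hlim := FloorSemiring.tendsto_pow_div_factorial_atTop ‖c‖
  obtain ⟨n, hn⟩ := (hlim.eventually_lt_const (zero_lt_one' ℝ)).exists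
  have hnorm : ‖volterra c ^ n‖ < 1 := by
    refine lt_of_le_of_lt (ContinuousLinearMap.opNorm_le_bound _ (by positivity) fun y => ?_) hn
    have hb := abs_volterra_pow_le (norm_fst_le c) (norm_snd_le c) y n
    have hK : 0 ≤ ‖c‖ ^ n / n.factorial * ‖y‖ := by positivity
    have hp : ∀ t : I, ‖c‖ ^ n / n.factorial * ‖y‖ * (t : ℝ) ^ n ≤
        ‖c‖ ^ n / n.factorial * ‖y‖ := fun t =>
      mul_le_of_le_one_right hK (pow_le_one₀ t.2.1 t.2.2)
    rw [Prod.norm_def]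
    exact max_le ((ContinuousMap.norm_le _ hK).2 fun t => (hb t).1.trans (hp t))
      ((ContinuousMap.norm_le _ hK).2 fun t => (hb t).2.trans (hp t))
  have hu : IsUnit (1 - volterra c ^ n) := 
    isUnit_one_sub_of_norm_lt_one (R := C(I, ℝ) × C(I, ℝ) →L[ℝ] C(I, ℝ) × C(I, ℝ)) hnorm
  rw [← mul_neg_geom_sum] at hu
  refine ((Commute.isUnit_mul_iff ?_).1 hu).1
  exact (Commute.sum_right _ _ _ fun i _ =>
    ((Commute.one_left _).sub_left (Commute.refl _)).pow_right i)

/-- The solution of `u' = α p`, `p' = β u` with the initial value `y₀`. -/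
def planarSol (y₀ : ℝ × ℝ) (c : C(I, ℝ) × C(I, ℝ)) : C(I, ℝ) × C(I, ℝ) :=
  Ring.inverse (1 - volterra c) (ContinuousMap.const I y₀.1, ContinuousMap.const I y₀.2)

/-- Inversion is continuous at units of a Banach algebra. All continuous dependence of solutions on
profile and eigenvalue comes from here. -/
theorem continuous_planarSol (y₀ : ℝ × ℝ) : Continuous (planarSol y₀) := by
  refine Continuous.clm_apply (continuous_iff_continuousAt.2 fun c => ?_) continuous_const
  obtain ⟨w, hw⟩ := isUnit_one_sub_volterra c
  have h := NormedRing.inverse_continuousAt (R := C(I, ℝ) × C(I, ℝ) →L[ℝ] C(I, ℝ) × C(I, ℝ)) w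
  rw [hw] at h
  exact ContinuousAt.comp (f := fun c => 1 - volterra c) h
    (continuous_const.sub continuous_volterra).continuousAt

theorem eq_planarSol {y₀ : ℝ × ℝ} {c y : C(I, ℝ) × C(I, ℝ)}
    (h₁ : y.1 = ContinuousMap.const I y₀.1 + primitive (c.1 * y.2))
    (h₂ : y.2 = ContinuousMap.const I y₀.2 + primitive (c.2 * y.1)) : y = planarSol y₀ c := by
  have h : (1 - volterra c) y = (ContinuousMap.const I y₀.1, ContinuousMap.const I y₀.2) := by
    refine Prod.ext ?_ ?_
    · change y.1 - primitive (c.1 * y.2) = _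
      nth_rw 1 [h₁]
      simp
    · change y.2 - primitive (c.2 * y.1) = _
      nth_rw 1 [h₂]
      simp
  rw [planarSol, ← h, ← mul_apply_eq_comp,
    Ring.inverse_mul_cancel _ (isUnit_one_sub_volterra c)]
  rfl

theorem planarSol_spec (y₀ : ℝ × ℝ) (c : C(I, ℝ) × C(I, ℝ)) :
    (planarSol y₀ c).1 = ContinuousMap.const I y₀.1 + primitive (c.1 * (planarSol y₀ c).2) ∧
      (planarSol y₀ c).2 = ContinuousMap.const I y₀.2 + primitive (c.2 * (planarSol y₀ c).1) := by
  have h : (1 - volterra c) (planarSol y₀ c) =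
      (ContinuousMap.const I y₀.1, ContinuousMap.const I y₀.2) := by
    rw [planarSol, ← mul_apply_eq_comp,
      Ring.mul_inverse_cancel _ (isUnit_one_sub_volterra c)]
    rfl
  have e₁ := congrArg Prod.fst h
  have e₂ := congrArg Prod.snd h
  exact ⟨sub_eq_iff_eq_add.1 e₁, sub_eq_iff_eq_add.1 e₂⟩

theorem planarSol_smul_add (r s : ℝ) (y z : ℝ × ℝ) (c : C(I, ℝ) × C(I, ℝ)) :
    planarSol (r • y + s • z) c = r • planarSol y c + s • planarSol z c := by
  simp only [planarSol, ← map_smul, ← map_add]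
  rfl

theorem planarSol_zero (y₀ : ℝ × ℝ) (c : C(I, ℝ) × C(I, ℝ)) :
    (planarSol y₀ c).1 0 = y₀.1 ∧ (planarSol y₀ c).2 0 = y₀.2 := by
  obtain ⟨h₁, h₂⟩ := planarSol_spec y₀ c
  rw [h₁, h₂]
  simp [primitive_apply]

theorem hasDerivAt_of_eq_primitive {y f : C(I, ℝ)} {y₀ : ℝ}
    (h : y = ContinuousMap.const I y₀ + primitive f) {t : ℝ} (ht : t ∈ Ioo (0 : ℝ) 1) :
    HasDerivAt (iext y) (iext f t) t := by
  have h1 : HasDerivAt (fun x : ℝ => y₀ + ∫ s in (0 : ℝ)..x, iext f s) (iext f t) t :=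
    ((continuous_iext f).integral_hasStrictDerivAt 0 t).hasDerivAt.const_add y₀
  refine h1.congr_of_eventuallyEq ?_
  filter_upwards [Ioo_mem_nhds ht.1 ht.2] with x hx
  rw [iext_of_mem y (Ioo_subset_Icc_self hx), h]
  rfl

theorem iext_mul (f g : C(I, ℝ)) (t : ℝ) : iext (f * g) t = iext f t * iext g t := rfl

theorem hasDerivAt_planarSol_fst (y₀ : ℝ × ℝ) (c : C(I, ℝ) × C(I, ℝ)) {t : ℝ}
    (ht : t ∈ Ioo (0 : ℝ) 1) :
    HasDerivAt (iext (planarSol y₀ c).1) (iext c.1 t * iext (planarSol y₀ c).2 t) t :=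
  hasDerivAt_of_eq_primitive (planarSol_spec y₀ c).1 ht

theorem hasDerivAt_planarSol_snd (y₀ : ℝ × ℝ) (c : C(I, ℝ) × C(I, ℝ)) {t : ℝ}
    (ht : t ∈ Ioo (0 : ℝ) 1) :
    HasDerivAt (iext (planarSol y₀ c).2) (iext c.2 t * iext (planarSol y₀ c).1 t) t :=
  hasDerivAt_of_eq_primitive (planarSol_spec y₀ c).2 ht

/-- Uniqueness: solutions on the line restrict to `planarSol`. -/
theorem eq_planarSol_of_hasDerivAt {c : C(I, ℝ) × C(I, ℝ)} {u p : ℝ → ℝ} (hu' : Continuous u)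
    (hp' : Continuous p) (hu : ∀ t ∈ Icc (0 : ℝ) 1, HasDerivAt u (iext c.1 t * p t) t)
    (hp : ∀ t ∈ Icc (0 : ℝ) 1, HasDerivAt p (iext c.2 t * u t) t) :
    ∀ t : I, u t = (planarSol (u 0, p 0) c).1 t ∧ p t = (planarSol (u 0, p 0) c).2 t := by
  intro t
  let y : C(I, ℝ) × C(I, ℝ) := (⟨fun t => u t, hu'.comp continuous_subtype_val⟩,
    ⟨fun t => p t, hp'.comp continuous_subtype_val⟩)
  have key : ∀ (f g : ℝ → ℝ) (b : C(I, ℝ)) (g' : C(I, ℝ)), Continuous g →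
      (∀ t : I, g' t = g t) → (∀ t ∈ Icc (0 : ℝ) 1, HasDerivAt f (iext b t * g t) t) → ∀ t : I,
      f t = f 0 + primitive (b * g') t := by
    intro f g b g' hg hg' hf t
    have h := intervalIntegral.integral_eq_sub_of_hasDerivAt (a := 0) (b := (t : ℝ))
      (fun s hs => hf s (by
        rw [uIcc_of_le t.2.1] at hs
        exact ⟨hs.1, hs.2.trans t.2.2⟩)) (((continuous_iext b).mul hg).intervalIntegrable _ _)
    have h2 : primitive (b * g') t = ∫ s in (0 : ℝ)..t, iext b s * g s := by
      rw [primitive_apply]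
      refine intervalIntegral.integral_congr fun s hs => ?_
      rw [uIcc_of_le t.2.1] at hs
      have hs' : s ∈ Icc (0 : ℝ) 1 := ⟨hs.1, hs.2.trans t.2.2⟩
      simp only [iext_mul]
      rw [iext_of_mem g' hs', hg']
    rw [h2, h]
    ring
  have hy : y = planarSol (u 0, p 0) c :=
    eq_planarSol (ContinuousMap.ext (key u p c.1 y.2 hp' (fun _ => rfl) hu))
      (ContinuousMap.ext (key p u c.2 y.1 hu' (fun _ => rfl) hp))
  exact ⟨congrArg (fun z => z.1 t) hy, congrArg (fun z => z.2 t) hy⟩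

/-- Derivatives of `iext` are available only in the open interval, because of the constant
extension; continuity carries the conclusion to the end points. -/
theorem constant_of_hasDerivAt_zero {f : C(I, ℝ)} {F : ℝ → ℝ} (hF : ∀ t : I, f t = F t)
    (hF' : ∀ t ∈ Ioo (0 : ℝ) 1, HasDerivAt F 0 t) (t : I) : f t = f 0 := by
  have hcont : ContinuousOn F (Icc 0 1) :=
    (continuous_iext f).continuousOn.congr fun s hs => by
      rw [iext_of_mem f hs, hF]
  have hi : ∀ s ∈ Ioo (0 : ℝ) 1, ∀ r ∈ Ioo (0 : ℝ) 1, F s = F r := by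
    intro s hs r hr
    exact isOpen_Ioo.is_const_of_deriv_eq_zero isPreconnected_Ioo
      (fun x hx => (hF' x hx).differentiableAt.differentiableWithinAt)
      (fun x hx => (hF' x hx).deriv) hs hr
  have hm : (1 / 2 : ℝ) ∈ Ioo (0 : ℝ) 1 := by constructor <;> norm_num
  have hcl : ∀ s ∈ Icc (0 : ℝ) 1, F s = F (1 / 2) := by
    have hsub : closure (Ioo (0 : ℝ) 1) = Icc 0 1 := closure_Ioo zero_ne_one
    intro s hs
    have := (EqOn.of_subset_closure (s := Ioo (0 : ℝ) 1) (t := Icc 0 1) (f := F)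
      (g := fun _ => F (1 / 2)) (fun x hx => hi x hx _ hm) hcont continuousOn_const
      Ioo_subset_Icc_self hsub.ge) hs
    exact this
  rw [hF, hF, hcl t t.2, hcl _ (0 : I).2]

/-- The Wronskian of the two fundamental solutions is `1`. -/
theorem wronskian_planarSol (c : C(I, ℝ) × C(I, ℝ)) (t : I) :
    (planarSol (1, 0) c).1 t * (planarSol (0, 1) c).2 t
      - (planarSol (1, 0) c).2 t * (planarSol (0, 1) c).1 t = 1 := by
  have h := constant_of_hasDerivAt_zero
    (f := (planarSol (1, 0) c).1 * (planarSol (0, 1) c).2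
      - (planarSol (1, 0) c).2 * (planarSol (0, 1) c).1)
    (F := fun t => iext (planarSol (1, 0) c).1 t * iext (planarSol (0, 1) c).2 t
      - iext (planarSol (1, 0) c).2 t * iext (planarSol (0, 1) c).1 t)
    (fun t => by simp [iext_coe])
    (fun t ht => by
      have := ((hasDerivAt_planarSol_fst (1, 0) c ht).mul
        (hasDerivAt_planarSol_snd (0, 1) c ht)).sub
        ((hasDerivAt_planarSol_snd (1, 0) c ht).mul (hasDerivAt_planarSol_fst (0, 1) c ht))
      refine this.congr_deriv ?_
      ring) t
  simpa [planarSol_zero] using h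

/-! ### The reduced eigenvalue problems -/

/-- The integral over `[0, 1]`. -/
def integ : C(I, ℝ) →L[ℝ] ℝ := (ContinuousMap.evalCLM ℝ (1 : I)).comp primitive

theorem integ_apply (f : C(I, ℝ)) : integ f = ∫ s in (0 : ℝ)..1, iext f s := rfl

theorem integ_eq_sub {F f : C(I, ℝ)}
    (h : ∀ t ∈ Ioo (0 : ℝ) 1, HasDerivAt (iext F) (iext f t) t) : integ f = F 1 - F 0 := by
  rw [integ_apply, intervalIntegral.integral_eq_sub_of_hasDerivAt_of_le zero_le_one
    (continuous_iext F).continuousOn h ((continuous_iext f).intervalIntegrable _ _)]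
  exact congrArg₂ _ (iext_coe F 1) (iext_coe F 0)

theorem integ_pos {f : C(I, ℝ)} (h : ∀ t, 0 ≤ f t) {t : I} (ht : 0 < f t) : 0 < integ f := by
  rw [integ_apply]
  exact intervalIntegral.integral_pos zero_lt_one (continuous_iext f).continuousOn
    (fun x _ => h _) ⟨t, t.2, by rwa [iext_coe]⟩

/-- The coefficients of the system `u' = p / a`, `p' = (n² / a - λ a) u`, which is the equation
`-Δ (u(x) e^{inθ}) = λ u(x) e^{inθ}` for the metric `dx² + a(x)² dθ²`. -/
def coeffs (a : C(I, ℝ)) (n : ℕ) (lam : ℝ) : C(I, ℝ) × C(I, ℝ) :=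
  (Ring.inverse a, ((n : ℝ) ^ 2) • Ring.inverse a - lam • a)

/-- Initial values: Neumann (`true`) or Dirichlet (`false`). -/
def initVal (b : Bool) : ℝ × ℝ := if b then (1, 0) else (0, 1)

/-- The solution of weight `i.1` that is even (`i.2 = true`) or odd (`i.2 = false`) at `0`. -/
def slSol (i : ℕ × Bool) (a : C(I, ℝ)) (lam : ℝ) : C(I, ℝ) × C(I, ℝ) :=
  planarSol (initVal i.2) (coeffs a i.1 lam)

/-- The boundary value at `1` which vanishes exactly if `lam` is an eigenvalue. -/
def endVal (i : ℕ × Bool) (a : C(I, ℝ)) (lam : ℝ) : ℝ :=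
  if i.2 then (slSol i a lam).2 1 else (slSol i a lam).1 1

section

variable {i j : ℕ × Bool} {a a' : C(I, ℝ)} {lam lam' : ℝ}

theorem isUnit_of_pos (ha : ∀ t, 0 < a t) : IsUnit a :=
  (ContinuousMap.isUnit_iff_forall_ne_zero a).2 fun t => (ha t).ne'

theorem inverse_apply (ha : ∀ t, 0 < a t) (t : I) : Ring.inverse a t = (a t)⁻¹ := by
  have h := congrArg (fun f : C(I, ℝ) => f t) (Ring.mul_inverse_cancel a (isUnit_of_pos ha))
  exact eq_inv_of_mul_eq_one_right h

theorem iext_inverse (ha : ∀ t, 0 < a t) (t : ℝ) : iext (Ring.inverse a) t = (iext a t)⁻¹ :=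
  inverse_apply ha _

theorem iext_pos (ha : ∀ t, 0 < a t) (t : ℝ) : 0 < iext a t := ha _

theorem continuousAt_inverse (ha : ∀ t, 0 < a t) : ContinuousAt Ring.inverse a := by
  obtain ⟨w, rfl⟩ := isUnit_of_pos ha
  exact NormedRing.inverse_continuousAt (R := C(I, ℝ)) w

theorem continuousAt_coeffs (n : ℕ) (ha : ∀ t, 0 < a t) (lam : ℝ) :
    ContinuousAt (fun z : C(I, ℝ) × ℝ => coeffs z.1 n z.2) (a, lam) := by
  have h : ContinuousAt (fun z : C(I, ℝ) × ℝ => Ring.inverse z.1) (a, lam) :=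
    ContinuousAt.comp (f := fun z : C(I, ℝ) × ℝ => z.1) (continuousAt_inverse ha)
      continuousAt_fst
  have h₁ : ContinuousAt (fun z : C(I, ℝ) × ℝ => ((n : ℝ) ^ 2) • Ring.inverse z.1) (a, lam) :=
    h.const_smul ((n : ℝ) ^ 2)
  have h₂ : ContinuousAt (fun z : C(I, ℝ) × ℝ => z.2 • z.1) (a, lam) :=
    (continuous_snd.smul continuous_fst).continuousAt
  exact h.prodMk (h₁.sub h₂)

theorem continuousAt_slSol (i : ℕ × Bool) (ha : ∀ t, 0 < a t) (lam : ℝ) :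
    ContinuousAt (fun z : C(I, ℝ) × ℝ => slSol i z.1 z.2) (a, lam) :=
  ContinuousAt.comp (g := planarSol (initVal i.2)) (continuous_planarSol _).continuousAt
    (continuousAt_coeffs i.1 ha lam)

theorem continuousAt_endVal (i : ℕ × Bool) (ha : ∀ t, 0 < a t) (lam : ℝ) :
    ContinuousAt (fun z : C(I, ℝ) × ℝ => endVal i z.1 z.2) (a, lam) := by
  have h := continuousAt_slSol i ha lam
  have e : Continuous fun f : C(I, ℝ) => f 1 := continuous_eval_const (1 : I)
  obtain ⟨n, b⟩ := i
  cases b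
  · exact ContinuousAt.comp (g := fun y : C(I, ℝ) × C(I, ℝ) => y.1 1)
      (e.comp continuous_fst).continuousAt h
  · exact ContinuousAt.comp (g := fun y : C(I, ℝ) × C(I, ℝ) => y.2 1)
      (e.comp continuous_snd).continuousAt h

theorem hasDerivAt_slSol_fst (i : ℕ × Bool) (ha : ∀ t, 0 < a t) (lam : ℝ) {t : ℝ}
    (ht : t ∈ Ioo (0 : ℝ) 1) :
    HasDerivAt (iext (slSol i a lam).1) (iext (slSol i a lam).2 t / iext a t) t := by
  refine (hasDerivAt_planarSol_fst _ _ ht).congr_deriv ?_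
  rw [coeffs, iext_inverse ha, div_eq_inv_mul]
  rfl

theorem hasDerivAt_slSol_snd (i : ℕ × Bool) (ha : ∀ t, 0 < a t) (lam : ℝ) {t : ℝ}
    (ht : t ∈ Ioo (0 : ℝ) 1) :
    HasDerivAt (iext (slSol i a lam).2)
      (((i.1 : ℝ) ^ 2 / iext a t - lam * iext a t) * iext (slSol i a lam).1 t) t := by
  refine (hasDerivAt_planarSol_snd _ _ ht).congr_deriv ?_
  have : iext (coeffs a i.1 lam).2 t =
      (i.1 : ℝ) ^ 2 * iext (Ring.inverse a) t - lam * iext a t := rfl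
  rw [this, iext_inverse ha, ← div_eq_mul_inv]
  rfl

theorem slSol_ne_zero (i : ℕ × Bool) (a : C(I, ℝ)) (lam : ℝ) (t : I) :
    ¬((slSol i a lam).1 t = 0 ∧ (slSol i a lam).2 t = 0) := by
  rintro ⟨h₁, h₂⟩
  have h := wronskian_planarSol (coeffs a i.1 lam) t
  obtain ⟨n, b⟩ := i
  cases b <;> simp only [slSol, initVal, if_true, Bool.false_eq_true, if_false] at h₁ h₂ <;>
    simp [h₁, h₂] at h

/-- If `u` vanishes near a point, so does `p = a u'`, and both components cannot vanish at once
because the Wronskian is `1`. -/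
theorem not_eventually_slSol_eq_zero (i : ℕ × Bool) (ha : ∀ t, 0 < a t) (lam : ℝ) {t : ℝ}
    (ht : t ∈ Ioo (0 : ℝ) 1) : ¬∀ᶠ x in 𝓝 t, iext (slSol i a lam).1 x = 0 := by
  intro h
  have h₀ : HasDerivAt (iext (slSol i a lam).1) 0 t :=
    (hasDerivAt_const t (0 : ℝ)).congr_of_eventuallyEq h
  have h₁ := h₀.unique (hasDerivAt_slSol_fst i ha lam ht)
  have h₂ : iext (slSol i a lam).2 t = 0 := by
    have := (iext_pos ha t).ne'
    exact (div_eq_zero_iff.1 h₁.symm).resolve_right this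
  have h₃ := h.self_of_nhds
  rw [iext_of_mem _ (Ioo_subset_Icc_self ht)] at h₂ h₃
  exact slSol_ne_zero i a lam _ ⟨h₃, h₂⟩

/-- Green's formula for two eigenfunctions of the same weight and parity. -/
theorem green_formula (ha : ∀ t, 0 < a t) (ha' : ∀ t, 0 < a' t) (h : endVal i a lam = 0)
    (h' : endVal i a' lam' = 0) :
    (lam' - lam) * integ (a' * ((slSol i a lam).1 * (slSol i a' lam').1)) =
      integ ((a' - a) * (Ring.inverse a * Ring.inverse a' *
        ((slSol i a lam).2 * (slSol i a' lam').2
          - ((i.1 : ℝ) ^ 2) • ((slSol i a lam).1 * (slSol i a' lam').1))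
        - lam • ((slSol i a lam).1 * (slSol i a' lam').1))) := by
  set y := slSol i a lam with hy
  set y' := slSol i a' lam' with hy'
  have hi := Ring.mul_inverse_cancel a (isUnit_of_pos ha)
  have hi' := Ring.mul_inverse_cancel a' (isUnit_of_pos ha')
  set α := Ring.inverse a with hα
  set α' := Ring.inverse a' with hα'
  have hG : integ ((lam' - lam) • (a' * (y.1 * y'.1)) - (a' - a) * (α * α' *
      (y.2 * y'.2 - ((i.1 : ℝ) ^ 2) • (y.1 * y'.1)) - lam • (y.1 * y'.1))) =
      -- The integrand is the derivative of the mixed Wronskian of the two solutions. The identity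
      -- is exact in `a' - a`, so no differentiability of the eigenvalue in the profile is assumed.
      (y.2 * y'.1 - y'.2 * y.1) 1 - (y.2 * y'.1 - y'.2 * y.1) 0 := by
    refine integ_eq_sub fun t ht => ?_
    have d := ((hasDerivAt_slSol_snd i ha lam ht).mul (hasDerivAt_slSol_fst i ha' lam' ht)).sub
      ((hasDerivAt_slSol_snd i ha' lam' ht).mul (hasDerivAt_slSol_fst i ha lam ht))
    refine d.congr_deriv ?_
    have e : iext ((lam' - lam) • (a' * (y.1 * y'.1)) - (a' - a) * (α * α' *
      (y.2 * y'.2 - ((i.1 : ℝ) ^ 2) • (y.1 * y'.1)) - lam • (y.1 * y'.1))) t =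
      (lam' - lam) * (iext a' t * (iext y.1 t * iext y'.1 t)) - (iext a' t - iext a t) *
      (iext α t * iext α' t * (iext y.2 t * iext y'.2 t
        - (i.1 : ℝ) ^ 2 * (iext y.1 t * iext y'.1 t)) - lam * (iext y.1 t * iext y'.1 t)) := rfl
    rw [e, hα, hα', iext_inverse ha, iext_inverse ha', ← hy, ← hy']
    have := (iext_pos ha t).ne'
    have := (iext_pos ha' t).ne'
    field_simp
    ring
  have hz := planarSol_zero (initVal i.2) (coeffs a i.1 lam)
  have hz' := planarSol_zero (initVal i.2) (coeffs a' i.1 lam')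
  -- At `0` both solutions satisfy the same Dirichlet or Neumann condition by their initial values,
  -- at `1` by the vanishing of `endVal`.
  have hzero : (y.2 * y'.1 - y'.2 * y.1) 1 - (y.2 * y'.1 - y'.2 * y.1) 0 = 0 := by
    change (y.2 1 * y'.1 1 - y'.2 1 * y.1 1) - (y.2 0 * y'.1 0 - y'.2 0 * y.1 0) = 0
    obtain ⟨n, b⟩ := i
    cases b
    · change y.1 0 = 0 ∧ _ at hz
      change y'.1 0 = 0 ∧ _ at hz'
      change y.1 1 = 0 at h
      change y'.1 1 = 0 at h'
      rw [hz.1, hz'.1, h, h']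
      ring
    · change _ ∧ y.2 0 = 0 at hz
      change _ ∧ y'.2 0 = 0 at hz'
      change y.2 1 = 0 at h
      change y'.2 1 = 0 at h'
      rw [hz.2, hz'.2, h, h']
      ring
  rw [hzero, map_sub, map_smul, sub_eq_zero] at hG
  exact hG

theorem integ_sq_pos (i : ℕ × Bool) (ha : ∀ t, 0 < a t) (lam : ℝ) :
    0 < integ (a * ((slSol i a lam).1 * (slSol i a lam).1)) := by
  obtain ⟨t, ht⟩ : ∃ t : I, (slSol i a lam).1 t ≠ 0 := by
    by_contra! h
    exact not_eventually_slSol_eq_zero i ha lam (t := 1 / 2) (by constructor <;> norm_num)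
      (Eventually.of_forall fun x => h _)
  exact integ_pos (fun t => mul_nonneg (ha t).le (mul_self_nonneg _))
    (mul_pos (ha t) (mul_self_pos.2 ht))

/-- For equal profiles Green's formula is the orthogonality of eigenfunctions to distinct
eigenvalues, so solutions that are not orthogonal share theirs. -/
theorem eq_of_integ_mul_ne_zero (ha : ∀ t, 0 < a t) (h : endVal i a lam = 0)
    (h' : endVal i a lam' = 0)
    (hne : integ (a * ((slSol i a lam).1 * (slSol i a lam').1)) ≠ 0) : lam' = lam := by
  have := green_formula ha ha h h'
  rw [sub_self, zero_mul, map_zero] at this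
  exact sub_eq_zero.1 ((mul_eq_zero.1 this).resolve_right hne)

/-- At eigenvalue `0` the energy `∫ (p² + n² u²) / a` equals a boundary term that vanishes, so `p =
0` and `n u = 0`; the initial values leave only the constants. Hence a common eigenvalue of distinct
types is nonzero. -/
theorem eq_of_endVal_zero (ha : ∀ t, 0 < a t) (h : endVal i a 0 = 0) : i = (0, true) := by
  set y := slSol i a 0 with hy
  have hz := planarSol_zero (initVal i.2) (coeffs a i.1 0)
  have hG : integ (Ring.inverse a * (y.2 * y.2 + ((i.1 : ℝ) ^ 2) • (y.1 * y.1))) =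
      (y.1 * y.2) 1 - (y.1 * y.2) 0 := by
    refine integ_eq_sub fun t ht => ?_
    refine ((hasDerivAt_slSol_fst i ha 0 ht).mul (hasDerivAt_slSol_snd i ha 0 ht)).congr_deriv ?_
    have e : iext (Ring.inverse a * (y.2 * y.2 + ((i.1 : ℝ) ^ 2) • (y.1 * y.1))) t =
      iext (Ring.inverse a) t * (iext y.2 t * iext y.2 t
        + (i.1 : ℝ) ^ 2 * (iext y.1 t * iext y.1 t)) := rfl
    rw [e, iext_inverse ha, ← hy]
    have := (iext_pos ha t).ne'
    field_simp
    ring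
  have hzero : (y.1 * y.2) 1 - (y.1 * y.2) 0 = 0 := by
    change y.1 1 * y.2 1 - y.1 0 * y.2 0 = 0
    obtain ⟨n, b⟩ := i
    cases b
    · change y.1 0 = 0 ∧ _ at hz
      change y.1 1 = 0 at h
      rw [hz.1, h]
      ring
    · change _ ∧ y.2 0 = 0 at hz
      change y.2 1 = 0 at h
      rw [hz.2, h]
      ring
  rw [hzero] at hG
  have hval : ∀ t : I, y.2 t * y.2 t + (i.1 : ℝ) ^ 2 * (y.1 t * y.1 t) = 0 := by
    intro t
    have hnn : ∀ t : I, 0 ≤ y.2 t * y.2 t + (i.1 : ℝ) ^ 2 * (y.1 t * y.1 t) := fun t =>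
      add_nonneg (mul_self_nonneg _) (mul_nonneg (sq_nonneg _) (mul_self_nonneg _))
    by_contra hne
    have hinv : ∀ t : I, 0 < Ring.inverse a t := fun t => by
      rw [inverse_apply ha]
      exact inv_pos.2 (ha t)
    refine (integ_pos (f := Ring.inverse a * (y.2 * y.2 + ((i.1 : ℝ) ^ 2) • (y.1 * y.1)))
      (fun t => mul_nonneg (hinv t).le (hnn t)) (t := t) ?_).ne' hG
    exact mul_pos (hinv t) (lt_of_le_of_ne (hnn t) (Ne.symm hne))
  have h0 := hval 0
  obtain ⟨n, b⟩ := i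
  cases b
  · change y.1 0 = 0 ∧ y.2 0 = 1 at hz
    rw [hz.1, hz.2] at h0
    norm_num at h0
  · change y.1 0 = 1 ∧ y.2 0 = 0 at hz
    rw [hz.1, hz.2] at h0
    simp at h0
    simp [h0]

theorem lam_ne_zero (hij : i ≠ j) (ha : ∀ t, 0 < a t) (hi : endVal i a lam = 0)
    (hj : endVal j a lam = 0) : lam ≠ 0 := by
  rintro rfl
  exact hij ((eq_of_endVal_zero ha hi).trans (eq_of_endVal_zero ha hj).symm)

/-- The two solutions of the same weight are linearly independent. -/
theorem wronskian_ne_zero (hij : i ≠ j) (h : i.1 = j.1) (a : C(I, ℝ)) (lam : ℝ) (t : I) :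
    (slSol i a lam).1 t * (slSol j a lam).2 t - (slSol i a lam).2 t * (slSol j a lam).1 t ≠ 0 := by
  have hw := wronskian_planarSol (coeffs a i.1 lam) t
  obtain ⟨n, b⟩ := i
  obtain ⟨m, d⟩ := j
  obtain rfl : n = m := h
  cases b <;> cases d <;> simp only [ne_eq, not_true_eq_false] at hij <;>
    simp only [slSol, initVal, if_true, Bool.false_eq_true, if_false] at hw ⊢ <;> intro h0 <;>
    linarith

theorem tendsto_slSol {β : Type*} {l : Filter β} {A : β → C(I, ℝ)} {ℓ : β → ℝ} (i : ℕ × Bool)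
    (ha : ∀ t, 0 < a t) (hA : Tendsto A l (𝓝 a)) (hℓ : Tendsto ℓ l (𝓝 lam)) :
    Tendsto (fun s => slSol i (A s) (ℓ s)) l (𝓝 (slSol i a lam)) :=
  Tendsto.comp (f := fun s => (A s, ℓ s)) (g := fun z : C(I, ℝ) × ℝ => slSol i z.1 z.2)
    (continuousAt_slSol i ha lam) (hA.prodMk_nhds hℓ)

/-- Every solution of the system is a combination of the two basic ones. -/
theorem planarSol_coeffs (y₀ : ℝ × ℝ) (a : C(I, ℝ)) (n : ℕ) (lam : ℝ) :
    planarSol y₀ (coeffs a n lam) =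
      y₀.1 • slSol (n, true) a lam + y₀.2 • slSol (n, false) a lam := by
  have h := planarSol_smul_add y₀.1 y₀.2 (1, 0) (0, 1) (coeffs a n lam)
  have e : y₀.1 • ((1, 0) : ℝ × ℝ) + y₀.2 • ((0, 1) : ℝ × ℝ) = y₀ := by ext <;> simp
  rw [e] at h
  exact h

end

attribute [irreducible] slSol

/-! ### Local identities for the first variation of an eigenvalue -/

/-- `u' = p / a` and `p' = (ν / a - lam a) u` on `W`. -/
structure IsEigenpairOn (W : Set ℝ) (a u p : ℝ → ℝ) (ν lam : ℝ) : Prop where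
  fst : ∀ t ∈ W, HasDerivAt u (p t / a t) t
  snd : ∀ t ∈ W, HasDerivAt p ((ν / a t - lam * a t) * u t) t

/-- The density `u'² - (ν / a² + lam) u²` of the first variation of an eigenvalue. -/
def variationDensity (a u p : ℝ → ℝ) (ν lam : ℝ) (t : ℝ) : ℝ :=
  (p t ^ 2 - ν * u t ^ 2) / a t ^ 2 - lam * u t ^ 2

section

variable {W : Set ℝ} {a a₁ a₂ u p v r : ℝ → ℝ} {ν μ lam lam' c d : ℝ}

theorem IsEigenpairOn.mono {W' : Set ℝ} (h : IsEigenpairOn W a u p ν lam) (hW : W' ⊆ W) :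
    IsEigenpairOn W' a u p ν lam :=
  ⟨fun t ht => h.fst t (hW ht), fun t ht => h.snd t (hW ht)⟩

/-- The terms in `ν` cancel outside the density itself, so a proportionality between densities of
different weights can be differentiated without producing the weights. -/
theorem IsEigenpairOn.hasDerivAt_variationDensity (h : IsEigenpairOn W a u p ν lam) {t a' : ℝ}
    (ht : t ∈ W) (ha : 0 < a t) (ha' : HasDerivAt a a' t) :
    HasDerivAt (variationDensity a u p ν lam)
      (-(4 * lam * (u t * p t) / a t)
        - 2 * (a' / a t) * (variationDensity a u p ν lam t + lam * u t ^ 2)) t := by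
  have d := ((((h.snd t ht).pow 2).sub (((h.fst t ht).pow 2).const_mul ν)).div (ha'.pow 2)
    (pow_ne_zero 2 ha.ne')).sub (((h.fst t ht).pow 2).const_mul lam)
  refine d.congr_deriv ?_
  have := ha.ne'
  simp only [variationDensity]
  simp
  field_simp
  ring

/-- On differentiating `hq`, the terms containing the densities cancel by `hq` itself, and what
remains carries a factor `lam`. -/
theorem variation_first_order (hW : IsOpen W) (ha : ∀ t ∈ W, 0 < a t)
    (ha₁ : ∀ t ∈ W, HasDerivAt a (a₁ t) t) (hu : IsEigenpairOn W a u p ν lam)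
    (hv : IsEigenpairOn W a v r μ lam) (hlam : lam ≠ 0)
    (hq : ∀ t ∈ W, c * variationDensity a u p ν lam t = d * variationDensity a v r μ lam t)
    {t : ℝ} (ht : t ∈ W) :
    2 * (c * (u t * p t) - d * (v t * r t)) + a₁ t * (c * u t ^ 2 - d * v t ^ 2) = 0 := by
  have h₁ := ((hu.hasDerivAt_variationDensity ht (ha t ht) (ha₁ t ht)).const_mul c).sub
    ((hv.hasDerivAt_variationDensity ht (ha t ht) (ha₁ t ht)).const_mul d)
  have h₂ : HasDerivAt ((fun s => c * variationDensity a u p ν lam s)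
      - fun s => d * variationDensity a v r μ lam s) 0 t := by
    refine (hasDerivAt_const t (0 : ℝ)).congr_of_eventuallyEq ?_
    filter_upwards [hW.mem_nhds ht] with s hs
    simp [hq s hs]
  have h₃ := h₁.unique h₂
  have h₄ := hq t ht
  have h₅ : lam * (2 * (c * (u t * p t) - d * (v t * r t))
      + a₁ t * (c * u t ^ 2 - d * v t ^ 2)) = 0 := by
    have hpos := (ha t ht).ne'
    field_simp at h₃
    linear_combination (-1 / 2) * h₃ - a₁ t * h₄
  exact (mul_eq_zero.1 h₅).resolve_left hlam

/-- The derivative of the first-order relation contains `p²`, `r²` and mixed products; `hq` removes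
the squares and the first-order relation the products. Only `u²`, `v²` and the profile are left. -/
theorem variation_second_order (hW : IsOpen W) (ha : ∀ t ∈ W, 0 < a t)
    (ha₁ : ∀ t ∈ W, HasDerivAt a (a₁ t) t) (ha₂ : ∀ t ∈ W, HasDerivAt a₁ (a₂ t) t)
    (hu : IsEigenpairOn W a u p ν lam) (hv : IsEigenpairOn W a v r μ lam) (hlam : lam ≠ 0)
    (hq : ∀ t ∈ W, c * variationDensity a u p ν lam t = d * variationDensity a v r μ lam t)
    {t : ℝ} (ht : t ∈ W) :
    4 * (c * (ν * u t ^ 2) - d * (μ * v t ^ 2)) =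
      (c * u t ^ 2 - d * v t ^ 2) * (a₁ t ^ 2 - a t * a₂ t) := by
  have h₁ := (((((hu.fst t ht).mul (hu.snd t ht)).const_mul c).sub
    (((hv.fst t ht).mul (hv.snd t ht)).const_mul d)).const_mul 2).add ((ha₂ t ht).mul
    ((((hu.fst t ht).pow 2).const_mul c).sub (((hv.fst t ht).pow 2).const_mul d)))
  have h₂ := (hasDerivAt_const t (0 : ℝ)).congr_of_eventuallyEq (f₁ := fun s =>
    2 * (c * (u s * p s) - d * (v s * r s)) + a₁ s * (c * u s ^ 2 - d * v s ^ 2)) (by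
      filter_upwards [hW.mem_nhds ht] with s hs
      exact variation_first_order hW ha ha₁ hu hv hlam hq hs)
  have h₃ := h₁.unique h₂
  have h₄ := hq t ht
  have h₅ := variation_first_order hW ha ha₁ hu hv hlam hq ht
  have hpos := (ha t ht).ne'
  simp only [variationDensity] at h₄
  simp only [Pi.sub_apply, Pi.pow_apply, Nat.cast_ofNat, Nat.add_one_sub_one, pow_one] at h₃
  field_simp at h₃ h₄
  linear_combination h₃ - 2 * h₄ - a₁ t * h₅

/-- The first-order relation says precisely that this product has derivative zero. -/
theorem variation_constant (hW : IsOpen W) (hW' : IsPreconnected W) (ha : ∀ t ∈ W, 0 < a t)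
    (ha₁ : ∀ t ∈ W, HasDerivAt a (a₁ t) t)
    (hu : IsEigenpairOn W a u p ν lam) (hv : IsEigenpairOn W a v r μ lam) (hlam : lam ≠ 0)
    (hq : ∀ t ∈ W, c * variationDensity a u p ν lam t = d * variationDensity a v r μ lam t) :
    ∃ C, ∀ t ∈ W, a t * (c * u t ^ 2 - d * v t ^ 2) = C := by
  have hd : ∀ t ∈ W, HasDerivAt (fun t => a t * (c * u t ^ 2 - d * v t ^ 2)) 0 t := by
    intro t ht
    refine ((ha₁ t ht).mul ((((hu.fst t ht).pow 2).const_mul c).sub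
      (((hv.fst t ht).pow 2).const_mul d))).congr_deriv ?_
    have h := variation_first_order hW ha ha₁ hu hv hlam hq ht
    have hpos := (ha t ht).ne'
    simp only [Pi.sub_apply, Pi.pow_apply, Nat.cast_ofNat, Nat.add_one_sub_one, pow_one]
    field_simp
    linear_combination h
  exact hW.exists_is_const_of_deriv_eq_zero hW'
    (fun x hx => (hd x hx).differentiableAt.differentiableWithinAt) fun x hx => (hd x hx).deriv

/-- Two eigenfunctions of the same weight whose squares are locally proportional have the same
eigenvalue. -/
theorem IsEigenpairOn.eigenvalue_eq (hW : IsOpen W) (ha : ∀ t ∈ W, 0 < a t)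
    (hu : IsEigenpairOn W a u p ν lam) (hv : IsEigenpairOn W a v r ν lam')
    (h : ∀ t ∈ W, v t ^ 2 = c * u t ^ 2) {t : ℝ} (ht : t ∈ W) (hne : v t ≠ 0) : lam' = lam := by
  have h₁ : ∀ t ∈ W, v t * r t = c * (u t * p t) := by
    intro t ht
    have e₁ := (hv.fst t ht).pow 2
    have e₂ := (((hu.fst t ht).pow 2).const_mul c).congr_of_eventuallyEq (f₁ := v ^ 2)
      (by filter_upwards [hW.mem_nhds ht] with s hs using h s hs)
    have e₃ := e₁.unique e₂
    have hpos := (ha t ht).ne'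
    simp at e₃
    field_simp at e₃
    linear_combination e₃
  have e₁ := (hv.fst t ht).mul (hv.snd t ht)
  have e₂ := (((hu.fst t ht).mul (hu.snd t ht)).const_mul c).congr_of_eventuallyEq (f₁ := v * r)
      (by filter_upwards [hW.mem_nhds ht] with s hs using h₁ s hs)
  have e₃ := e₁.unique e₂
  have hpos := (ha t ht).ne'
  have hv2 := h t ht
  have hvr := h₁ t ht
  -- The relations for `v²` and `v r` give this one since `v t ≠ 0`; in the derivative of `v r = c u
  -- p` it leaves only the difference of the eigenvalues.
  have hr2 : r t ^ 2 = c * p t ^ 2 := by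
    have hne2 : v t ^ 2 ≠ 0 := pow_ne_zero 2 hne
    apply mul_left_cancel₀ hne2
    linear_combination (v t * r t + c * (u t * p t)) * hvr - c * p t ^ 2 * hv2
  field_simp at e₃
  have : (lam' - lam) * (a t ^ 2 * v t ^ 2) = 0 := by
    linear_combination hr2 + (ν - lam * a t ^ 2) * hv2 - e₃
  exact sub_eq_zero.1 ((mul_eq_zero.1 this).resolve_right
    (mul_ne_zero (pow_ne_zero 2 hpos) (pow_ne_zero 2 hne)))

/-- Where the first variation of an eigenvalue vanishes, `a` satisfies a first-order equation. -/
theorem IsEigenpairOn.sq_deriv_eq (hW : IsOpen W) (ha : ∀ t ∈ W, 0 < a t)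
    (ha₁ : ∀ t ∈ W, HasDerivAt a (a₁ t) t) (hu : IsEigenpairOn W a u p ν lam) (hlam : lam ≠ 0)
    (hq : ∀ t ∈ W, variationDensity a u p ν lam t = 0) {t : ℝ} (ht : t ∈ W) (hne : u t ≠ 0) :
    a₁ t ^ 2 = 4 * ν + 4 * lam * a t ^ 2 := by
  -- With `d = 0` the second eigenfunction is a dummy, and the relation reads `u (2 p + a' u) = 0`.
  have h := variation_first_order (c := 1) (d := 0) hW ha ha₁ hu hu hlam (by simpa using hq) ht
  have hpos := (ha t ht).ne'
  have h₁ : u t * (2 * p t + a₁ t * u t) = 0 := by linear_combination h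
  have h₂ := (mul_eq_zero.1 h₁).resolve_left hne
  have h₃ := hq t ht
  simp only [variationDensity] at h₃
  field_simp at h₃
  apply mul_left_cancel₀ (pow_ne_zero 2 hne)
  linear_combination 4 * h₃ + (a₁ t * u t - 2 * p t) * h₂

end

/-! ### The space of smooth functions on an interval -/

namespace SmoothIcc

variable {a b : ℝ}

/-- The restriction to `[a, b]` of a function which is smooth there. -/
def ofFun (g : ℝ → ℝ) (hg : ContDiffOn ℝ ∞ g (Icc a b)) : SmoothIcc a b where
  toFun x := g x
  smooth := hg.congr fun x hx =>
    Subtype.val_injective.extend_apply (fun x : Icc a b => g x) 0 ⟨x, hx⟩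

theorem ext_ofFun (g : ℝ → ℝ) (hg : ContDiffOn ℝ ∞ g (Icc a b)) {x : ℝ} (hx : x ∈ Icc a b) :
    (ofFun g hg).ext x = g x :=
  Subtype.val_injective.extend_apply (fun x : Icc a b => g x) 0 ⟨x, hx⟩

theorem ext_of_notMem (f : SmoothIcc a b) {x : ℝ} (hx : x ∉ Icc a b) : f.ext x = 0 :=
  Function.extend_apply' _ _ _ fun ⟨y, hy⟩ => hx (hy ▸ y.2)

/-- The linear combination `c f + d g`. -/
def combo (c : ℝ) (f : SmoothIcc a b) (d : ℝ) (g : SmoothIcc a b) : SmoothIcc a b :=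
  ofFun (fun x => c * f.ext x + d * g.ext x)
    ((contDiffOn_const.mul f.smooth).add (contDiffOn_const.mul g.smooth))

theorem ext_combo (c : ℝ) (f : SmoothIcc a b) (d : ℝ) (g : SmoothIcc a b) (x : ℝ) :
    (combo c f d g).ext x = c * f.ext x + d * g.ext x := by
  by_cases hx : x ∈ Icc a b
  · exact ext_ofFun _ _ hx
  · simp [ext_of_notMem _ hx]

variable [hab : Fact (a < b)]

omit hab in
theorem continuous_deriv (hab : a < b) (k : ℕ) (f : SmoothIcc a b) : Continuous (deriv k f) :=
  continuousOn_iff_continuous_domRestrict.1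
    (f.smooth.continuousOn_iteratedDerivWithin (by exact_mod_cast le_top) (uniqueDiffOn_Icc hab))

/-- The `k`-th derivative as a continuous function. -/
def derivC (k : ℕ) (f : SmoothIcc a b) : C(Icc a b, ℝ) :=
  ⟨deriv k f, continuous_deriv hab.out k f⟩

/-- On continuous functions uniform convergence is norm convergence, so the topology can be handled
through the sup norms of the derivatives. -/
theorem isInducing_derivC :
    IsInducing (fun (f : SmoothIcc a b) (k : ℕ) => derivC k f) := by
  have h₁ : IsInducing (fun (f : SmoothIcc a b) (k : ℕ) => UniformFun.ofFun (deriv k f)) := ⟨rfl⟩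
  have h₂ : IsInducing (fun g : C(Icc a b, ℝ) => UniformFun.ofFun (g : Icc a b → ℝ)) := by
    refine isInducing_iff_nhds.2 fun f => le_antisymm ?_ ?_
    · rw [← tendsto_iff_comap]
      exact UniformFun.tendsto_iff_tendstoUniformly.2
        (ContinuousMap.tendsto_iff_tendstoUniformly.1 tendsto_id)
    · exact ContinuousMap.tendsto_iff_tendstoUniformly.2
        (UniformFun.tendsto_iff_tendstoUniformly.1 tendsto_comap)
  have h₃ : IsInducing (fun (g : ℕ → C(Icc a b, ℝ)) (k : ℕ) =>
    UniformFun.ofFun (g k : Icc a b → ℝ)) := IsInducing.piMap fun _ => h₂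
  exact (h₃.of_comp_iff).1 h₁

theorem continuous_derivC (k : ℕ) : Continuous (derivC k : SmoothIcc a b → C(Icc a b, ℝ)) :=
  (continuous_apply k).comp isInducing_derivC.continuous

theorem derivC_zero_apply (f : SmoothIcc a b) (x : Icc a b) : derivC 0 f x = f.ext x :=
  congrFun (iteratedDerivWithin_zero (f := f.ext) (s := Icc a b)) x

theorem derivC_combo (k : ℕ) (c : ℝ) (f : SmoothIcc a b) (d : ℝ) (g : SmoothIcc a b) :
    derivC k (combo c f d g) = c • derivC k f + d • derivC k g := by
  ext x
  have hu := uniqueDiffOn_Icc hab.out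
  have hf : ContDiffWithinAt ℝ k f.ext (Icc a b) x :=
    (f.smooth x x.2).of_le (by exact_mod_cast le_top)
  have hg : ContDiffWithinAt ℝ k g.ext (Icc a b) x :=
    (g.smooth x x.2).of_le (by exact_mod_cast le_top)
  change iteratedDerivWithin k (combo c f d g).ext (Icc a b) x =
    c • iteratedDerivWithin k f.ext (Icc a b) x + d • iteratedDerivWithin k g.ext (Icc a b) x
  have h : (combo c f d g).ext = c • f.ext + d • g.ext := funext fun x => ext_combo c f d g x
  rw [h, iteratedDerivWithin_add (f := c • f.ext) (g := d • g.ext) x.2 hu (hf.const_smul c)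
    (hg.const_smul d), iteratedDerivWithin_const_smul_field, iteratedDerivWithin_const_smul_field]

theorem continuous_combo (f g : SmoothIcc a b) :
    Continuous (fun z : ℝ × ℝ => combo z.1 f z.2 g) := by
  refine isInducing_derivC.continuous_iff.2 (continuous_pi fun k => ?_)
  simp only [Function.comp_def, derivC_combo]
  fun_prop

omit hab in
theorem combo_one_zero (f g : SmoothIcc a b) : combo 1 f 0 g = f := by
  obtain ⟨F, hF⟩ := f
  simp only [combo, ofFun, mk.injEq]
  funext x
  simp [SmoothIcc.ext]

theorem distC_eq (k : ℕ) (f g : SmoothIcc a b) :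
    distC k f g = ∑ j ∈ Finset.range (k + 1), ‖derivC j f - derivC j g‖ := by
  refine Finset.sum_congr rfl fun j _ => ?_
  rw [ContinuousMap.norm_eq_iSup_norm]
  rfl

theorem distC_nonneg (k : ℕ) (f g : SmoothIcc a b) : 0 ≤ distC k f g := by
  rw [distC_eq]
  positivity

theorem continuous_distC (k : ℕ) (g : SmoothIcc a b) : Continuous fun f => distC k f g := by
  simp only [distC_eq]
  exact continuous_finsetSum _ fun j _ => ((continuous_derivC j).sub continuous_const).norm

/-- The difference to `g` is `(1 - t) (f - g)`, and every seminorm scales accordingly. -/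
theorem distC_combo (k : ℕ) (f g : SmoothIcc a b) {t : ℝ} (ht : t ≤ 1) :
    distC k (combo (1 - t) f t g) g = (1 - t) * distC k f g := by
  rw [distC_eq, distC_eq, Finset.mul_sum]
  refine Finset.sum_congr rfl fun j _ => ?_
  have h : derivC j (combo (1 - t) f t g) - derivC j g =
      (1 - t) • (derivC j f - derivC j g) := by
    rw [derivC_combo]
    module
  rw [h, norm_smul, Real.norm_of_nonneg (by linarith)]

/-- The terms of the series defining the Fréchet distance. -/
def frechetTerm (f g : SmoothIcc a b) (k : ℕ) : ℝ :=
  (1 / 2 : ℝ) ^ k * (distC k f g / (1 + distC k f g))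

theorem frechetTerm_mem (f g : SmoothIcc a b) (k : ℕ) :
    0 ≤ frechetTerm f g k ∧ frechetTerm f g k ≤ (1 / 2 : ℝ) ^ k := by
  have h := distC_nonneg k f g
  refine ⟨by unfold frechetTerm; positivity, mul_le_of_le_one_right (by positivity) ?_⟩
  rw [div_le_one (by linarith)]
  linarith

theorem summable_frechetTerm (f g : SmoothIcc a b) : Summable (frechetTerm f g) :=
  summable_geometric_two.of_nonneg_of_le (fun k => (frechetTerm_mem f g k).1)
    (fun k => (frechetTerm_mem f g k).2)

theorem continuous_distFrechet (g : SmoothIcc a b) : Continuous fun f => distFrechet f g := by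
  refine continuous_tsum (fun k => ?_) summable_geometric_two
    (fun k f => (Real.norm_of_nonneg (frechetTerm_mem f g k).1).trans_le
      (frechetTerm_mem f g k).2)
  have h := continuous_distC k g
  exact continuous_const.mul (h.div (continuous_const.add h) fun f => by
    have := distC_nonneg k f g
    positivity)

/-- The map `y ↦ y / (1 + y)` is strictly increasing, so scaling all `distC k f g` by `1 - t` lowers
every nonzero term of the series. If there is none, the distance is `0 < δ`. -/
theorem distFrechet_combo_lt {f g : SmoothIcc a b} {δ t : ℝ} (hδ : 0 < δ)
    (h : distFrechet f g ≤ δ) (ht : 0 < t) (ht' : t ≤ 1) :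
    distFrechet (combo (1 - t) f t g) g < δ := by
  have hterm : ∀ k, 0 ≤ frechetTerm f g k - frechetTerm (combo (1 - t) f t g) g k ∧
      (distC k f g ≠ 0 →
        frechetTerm (combo (1 - t) f t g) g k < frechetTerm f g k) := by
    intro k
    have hd := distC_nonneg k f g
    have hd' : 0 ≤ (1 - t) * distC k f g := mul_nonneg (by linarith) hd
    have e : frechetTerm f g k - frechetTerm (combo (1 - t) f t g) g k =
        (1 / 2 : ℝ) ^ k * (t * distC k f g /
          ((1 + distC k f g) * (1 + (1 - t) * distC k f g))) := by
      unfold frechetTerm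
      rw [distC_combo k f g ht']
      have h₁ : 1 + distC k f g ≠ 0 := by positivity
      have h₂ : 1 + (1 - t) * distC k f g ≠ 0 := by positivity
      rw [← mul_sub, div_sub_div _ _ h₁ h₂]
      congr 2
      ring
    refine ⟨by rw [e]; positivity, fun hne => sub_pos.1 ?_⟩
    rw [e]
    have := lt_of_le_of_ne hd (Ne.symm hne)
    positivity
  by_cases h0 : ∀ k, distC k f g = 0
  · have : distFrechet (combo (1 - t) f t g) g = 0 := by
      simp [distFrechet, distC_combo _ f g ht', h0]
    rwa [this]
  · push Not at h0
    obtain ⟨k, hk⟩ := h0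
    exact (Summable.tsum_lt_tsum (fun k => sub_nonneg.1 (hterm k).1) ((hterm k).2 hk)
      (summable_frechetTerm _ _) (summable_frechetTerm _ _)).trans_le h

/-- If small moves towards `g` lead from `Y` into its interior, then `Y` lies in the closure of its
interior. -/
theorem subset_closure_interior_inter {A B : Set (SmoothIcc a b)} (g : SmoothIcc a b)
    (hA : IsOpen A) (hB : ∀ f ∈ B, ∀ t : ℝ, 0 < t → t ≤ 1 →
      combo (1 - t) f t g ∈ interior B) :
    A ∩ B ⊆ closure (interior (A ∩ B)) := by
  rintro f ⟨hfA, hfB⟩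
  have hlim : Tendsto (fun t : ℝ => combo (1 - t) f t g) (𝓝[>] 0) (𝓝 f) := by
    have h : Continuous fun t : ℝ => combo (1 - t) f t g :=
      (continuous_combo f g).comp (f := fun t : ℝ => (1 - t, t)) (by fun_prop)
    have h' := h.tendsto 0
    simp only [sub_zero, combo_one_zero] at h'
    exact h'.mono_left nhdsWithin_le_nhds
  refine mem_closure_of_tendsto hlim ?_
  filter_upwards [hlim.eventually (hA.mem_nhds hfA), Ioc_mem_nhdsGT (zero_lt_one' ℝ)]
    with t ht ht'
  rw [interior_inter, hA.interior_eq]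
  exact ⟨ht, hB f hfB t ht'.1 ht'.2⟩

/-- The distances are continuous, so strict sublevel sets lie in the interior of the ball, and the
segment to the centre enters them at once. -/
theorem ball_subset_closure_interior {A : Set (SmoothIcc a b)} (hA : IsOpen A)
    (g : SmoothIcc a b) {δ : ℝ} (hδ : 0 < δ) :
    A ∩ {f | distFrechet f g ≤ δ} ⊆ closure (interior (A ∩ {f | distFrechet f g ≤ δ})) ∧
    ∀ k, A ∩ {f | distC k f g ≤ δ} ⊆ closure (interior (A ∩ {f | distC k f g ≤ δ})) := by
  refine ⟨subset_closure_interior_inter g hA fun f hf t ht ht' => ?_, fun k =>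
    subset_closure_interior_inter g hA fun f hf t ht ht' => ?_⟩
  · exact interior_maximal (fun f (hf : distFrechet f g < δ) => hf.le)
      (isOpen_lt (continuous_distFrechet g) continuous_const)
      (distFrechet_combo_lt hδ hf ht ht')
  · refine interior_maximal (fun f (hf : distC k f g < δ) => hf.le)
      (isOpen_lt (continuous_distC k g) continuous_const) ?_
    change distC k (combo (1 - t) f t g) g < δ
    rw [distC_combo k f g ht']
    change distC k f g ≤ δ at hf
    have := distC_nonneg k f g
    rcases this.eq_or_lt with h | h
    · rwa [← h, mul_zero]
    · nlinarith

end SmoothIcc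

/-- A dense `Gδ` subset of an open set `A` is residual in every subset of `A` that lies in the
closure of its interior. -/
theorem isResidualIn_of_iInter {X ι : Type*} [TopologicalSpace X] [Countable ι] {S A Y : Set X}
    {G : ι → Set X} (hG : ∀ i, IsOpen (G i)) (hGA : ∀ i, A ⊆ closure (G i))
    (hS : A ∩ ⋂ i, G i ⊆ S) (hYA : Y ⊆ A) (hY : Y ⊆ closure (interior Y)) :
    IsResidualIn S Y := by
  have h : ∀ i, ((↑) ⁻¹' G i : Set Y) ∈ residual Y := by
    refine fun i => residual_of_dense_open ((hG i).preimage continuous_subtype_val) ?_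
    intro y
    rw [closure_subtype, mem_closure_iff]
    intro o ho hyo
    -- Density of `G i` applies to open sets of the whole space, so the neighbourhood is first moved
    -- into the interior of `Y`.
    obtain ⟨z, hzo, hz⟩ := mem_closure_iff.1 (hY y.2) o ho hyo
    obtain ⟨w, ⟨hwo, hw⟩, hwG⟩ := mem_closure_iff.1 (hGA i (hYA (interior_subset hz))) _
      (ho.inter isOpen_interior) ⟨hzo, hz⟩
    exact ⟨w, hwo, ⟨w, interior_subset hw⟩, hwG, rfl⟩
  refine Filter.mem_of_superset (countable_iInter_mem.2 h) fun y hy => hS ⟨hYA y.2, ?_⟩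
  exact mem_iInter.2 fun i => mem_iInter.1 hy i

/-! ### Profiles -/

/-- This is for the ends of the bridge, where `f.ext` may jump: a bounded factor times `o(y - x)` is
still `o(y - x)`. -/
theorem hasDerivAt_mul_zero_of_bounded {g w : ℝ → ℝ} {M x : ℝ} (hg : ∀ x, |g x| ≤ M)
    (hw : HasDerivAt w 0 x) (hx : w x = 0) : HasDerivAt (fun y => g y * w y) 0 x := by
  rw [hasDerivAt_iff_isLittleO] at hw ⊢
  simp only [hx, sub_zero, smul_zero, mul_zero] at hw ⊢
  have h : g =O[𝓝 x] fun _ => (1 : ℝ) :=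
    Asymptotics.IsBigO.of_bound M (Eventually.of_forall fun y => by simpa using hg y)
  simpa using h.mul_isLittleO hw

theorem hasDerivAt_zero_of_eqOn_Icc {w : ℝ → ℝ} {c d x : ℝ} (hw : DifferentiableAt ℝ w x)
    (hcd : c < d) (hx : x ∈ Icc c d) (h : ∀ y ∈ Icc c d, w y = 0) : HasDerivAt w 0 x := by
  have h₁ : HasDerivWithinAt w 0 (Icc c d) x :=
    (hasDerivWithinAt_const x _ (0 : ℝ)).congr h (h x hx)
  have h₂ := hw.hasDerivAt
  rwa [(uniqueDiffOn_Icc hcd x hx).eq_deriv _ h₂.hasDerivWithinAt h₁] at h₂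

theorem SmoothIcc.exists_abs_ext_le {a b : ℝ} (f : SmoothIcc a b) : ∃ M, ∀ x, |f.ext x| ≤ M := by
  obtain ⟨M, hM⟩ := isCompact_Icc.exists_bound_of_continuousOn f.smooth.continuousOn
  refine ⟨max M 0, fun x => ?_⟩
  by_cases hx : x ∈ Icc a b
  · exact (hM x hx).trans (le_max_left _ _)
  · simp [f.ext_of_notMem hx]

section

variable {ε : ℝ} {χ₁ χ₂ : ℝ → ℝ}

/-- The weight `1 - χ₁ - χ₂` of the bridge function. -/
def bridgeWeight (χ₁ χ₂ : ℝ → ℝ) (x : ℝ) : ℝ := 1 - χ₁ x - χ₂ x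

/-- The formula for the profile on the fundamental domain `[-1, 1]`. -/
def profileAux (ε : ℝ) (χ₁ χ₂ : ℝ → ℝ) (f : SmoothIcc ε (2 * ε)) (y : ℝ) : ℝ :=
  Real.sqrt (1 - y ^ 2) * χ₁ y + 1 / 2 * Real.sqrt (1 - ε ^ 2) * χ₂ y
    + f.ext |y| * bridgeWeight χ₁ χ₂ y

theorem baseCoord_mem (x : ℝ) : baseCoord x ∈ Ico (-1 : ℝ) 1 := by
  have h := toIcoMod_mem_Ico (zero_lt_two : (0 : ℝ) < 2) (-1) x
  norm_num at h
  exact h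

theorem baseCoord_of_mem {x : ℝ} (hx : x ∈ Ico (-1 : ℝ) 1) : baseCoord x = x := by
  refine (toIcoMod_eq_self _).2 ?_
  norm_num
  exact hx

theorem exists_eq_baseCoord_add (x : ℝ) : ∃ k : ℤ, x = baseCoord x + k * 2 := by
  refine ⟨toIcoDiv (zero_lt_two : (0 : ℝ) < 2) (-1) x, ?_⟩
  have h := toIcoMod_add_toIcoDiv_zsmul (zero_lt_two : (0 : ℝ) < 2) (-1) x
  rw [zsmul_eq_mul] at h
  exact h.symm

theorem profile_periodic (f : SmoothIcc ε (2 * ε)) :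
    Function.Periodic (profile ε χ₁ χ₂ f) 2 := by
  intro x
  have h : baseCoord (x + 2) = baseCoord x := toIcoMod_add_right _ _ _
  simp only [profile, h]

namespace IsCutoffPair

theorem contDiff_bridgeWeight (hχ : IsCutoffPair ε χ₁ χ₂) :
    ContDiff ℝ ∞ (bridgeWeight χ₁ χ₂) :=
  (contDiff_const.sub hχ.smooth₁).sub hχ.smooth₂

theorem bridgeWeight_of_le (hχ : IsCutoffPair ε χ₁ χ₂) {x : ℝ} (hx : |x| ≤ ε) :
    bridgeWeight χ₁ χ₂ x = 0 := by
  simp [bridgeWeight, hχ.sphere₁ x hx, hχ.sphere₂ x hx]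

theorem bridgeWeight_of_ge (hχ : IsCutoffPair ε χ₁ χ₂) {x : ℝ} (hx : 2 * ε ≤ |x|)
    (hx' : |x| ≤ 1) : bridgeWeight χ₁ χ₂ x = 0 := by
  simp [bridgeWeight, hχ.flat₁ x hx hx', hχ.flat₂ x hx hx']

theorem profileAux_neg (hχ : IsCutoffPair ε χ₁ χ₂) (f : SmoothIcc ε (2 * ε)) (x : ℝ) :
    profileAux ε χ₁ χ₂ f (-x) = profileAux ε χ₁ χ₂ f x := by
  simp [profileAux, bridgeWeight, hχ.even₁, hχ.even₂]

theorem profile_eq (hχ : IsCutoffPair ε χ₁ χ₂) (f : SmoothIcc ε (2 * ε)) {x : ℝ}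
    (hx : x ∈ Icc (-1 : ℝ) 1) : profile ε χ₁ χ₂ f x = profileAux ε χ₁ χ₂ f x := by
  rcases hx.2.eq_or_lt with rfl | h
  · have h := profile_periodic (χ₁ := χ₁) (χ₂ := χ₂) f (-1)
    norm_num at h
    rw [h, ← hχ.profileAux_neg]
    change profileAux ε χ₁ χ₂ f (baseCoord (-1)) = _
    rw [baseCoord_of_mem (by norm_num)]
  · change profileAux ε χ₁ χ₂ f (baseCoord x) = _
    rw [baseCoord_of_mem ⟨hx.1, h⟩]

theorem profile_neg (hχ : IsCutoffPair ε χ₁ χ₂) (f : SmoothIcc ε (2 * ε)) (x : ℝ) :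
    profile ε χ₁ χ₂ f (-x) = profile ε χ₁ χ₂ f x := by
  obtain ⟨k, hk⟩ := exists_eq_baseCoord_add x
  have hm := baseCoord_mem x
  have h : -x = -baseCoord x + (-k : ℤ) * 2 := by
    push_cast
    linarith
  rw [h, (profile_periodic f).int_mul (-k) _,
    hχ.profile_eq f ⟨by linarith [hm.2], by linarith [hm.1]⟩,
    hχ.profileAux_neg]
  rfl

theorem hasDerivAt_bridgeWeight (hχ : IsCutoffPair ε χ₁ χ₂) (hε : 0 < ε) (hε' : ε < 1 / 2)
    {x : ℝ} (hx : x ∈ Icc (-1 : ℝ) 1) (h : ¬(ε < |x| ∧ |x| < 2 * ε)) :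
    HasDerivAt (bridgeWeight χ₁ χ₂) 0 x := by
  have hd : DifferentiableAt ℝ (bridgeWeight χ₁ χ₂) x :=
    hχ.contDiff_bridgeWeight.differentiable (by simp) x
  by_cases h₁ : |x| ≤ ε
  · exact hasDerivAt_zero_of_eqOn_Icc hd (c := -ε) (d := ε) (by linarith) (abs_le.1 h₁)
      fun y hy => hχ.bridgeWeight_of_le (abs_le.2 hy)
  · have h₂ : 2 * ε ≤ |x| := by
      by_contra h₂
      exact h ⟨not_le.1 h₁, not_le.1 h₂⟩
    rcases le_abs.1 h₂ with h₃ | h₃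
    · exact hasDerivAt_zero_of_eqOn_Icc hd (c := 2 * ε) (d := 1) (by linarith) ⟨h₃, hx.2⟩
        fun y hy => hχ.bridgeWeight_of_ge (le_abs.2 (Or.inl hy.1))
          (abs_le.2 ⟨by linarith [hy.1], hy.2⟩)
    · exact hasDerivAt_zero_of_eqOn_Icc hd (c := -1) (d := -(2 * ε)) (by linarith)
        ⟨hx.1, by linarith⟩
        fun y hy => hχ.bridgeWeight_of_ge (le_abs.2 (Or.inr (by linarith [hy.2])))
          (abs_le.2 ⟨hy.1, by linarith [hy.2]⟩)

theorem differentiableAt_profileAux (hχ : IsCutoffPair ε χ₁ χ₂) (hε : 0 < ε) (hε' : ε < 1 / 2)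
    (f : SmoothIcc ε (2 * ε)) {x : ℝ} (hx : x ∈ Ioo (-1 : ℝ) 1) :
    DifferentiableAt ℝ (profileAux ε χ₁ χ₂ f) x := by
  have hpos : 1 - x ^ 2 ≠ 0 := by
    have h₁ := hx.1
    have h₂ := hx.2
    nlinarith
  have h₁ : DifferentiableAt ℝ χ₁ x := hχ.smooth₁.differentiable (by simp) x
  have h₂ : DifferentiableAt ℝ χ₂ x := hχ.smooth₂.differentiable (by simp) x
  have h₃ : DifferentiableAt ℝ (bridgeWeight χ₁ χ₂) x :=
    hχ.contDiff_bridgeWeight.differentiable (by simp) x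
  have h₀ : DifferentiableAt ℝ (fun y : ℝ => Real.sqrt (1 - y ^ 2)) x :=
    DifferentiableAt.sqrt (f := fun y : ℝ => 1 - y ^ 2) (by fun_prop) hpos
  refine ((h₀.mul h₁).add (h₂.const_mul _)).add ?_
  by_cases h : ε < |x| ∧ |x| < 2 * ε
  · have hf : DifferentiableAt ℝ f.ext |x| :=
      (f.smooth.contDiffAt (Icc_mem_nhds h.1 h.2)).differentiableAt (by simp)
    have hx0 : x ≠ 0 := abs_pos.1 (hε.trans h.1)
    exact (DifferentiableAt.comp x hf (differentiableAt_abs hx0)).mul h₃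
  · obtain ⟨M, hM⟩ := f.exists_abs_ext_le
    refine (hasDerivAt_mul_zero_of_bounded (g := fun y => f.ext |y|) (fun y => hM _)
      (hχ.hasDerivAt_bridgeWeight hε hε' (Ioo_subset_Icc_self hx) h) ?_).differentiableAt
    by_cases h₁ : |x| ≤ ε
    · exact hχ.bridgeWeight_of_le h₁
    · refine hχ.bridgeWeight_of_ge ?_ (abs_le.2 ⟨hx.1.le, hx.2.le⟩)
      by_contra h₂
      exact h ⟨not_le.1 h₁, not_le.1 h₂⟩

theorem differentiable_profile (hχ : IsCutoffPair ε χ₁ χ₂) (hε : 0 < ε) (hε' : ε < 1 / 2)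
    (f : SmoothIcc ε (2 * ε)) : Differentiable ℝ (profile ε χ₁ χ₂ f) := by
  have key : ∀ y ∈ Ico (-1 : ℝ) 1, DifferentiableAt ℝ (profile ε χ₁ χ₂ f) y := by
    intro y hy
    rcases hy.1.eq_or_lt with rfl | hlt
    · have hev : profile ε χ₁ χ₂ f =ᶠ[𝓝 (-1)] fun _ => 1 / 2 * Real.sqrt (1 - ε ^ 2) := by
        have hflat : ∀ z, 2 * ε ≤ |z| → |z| ≤ 1 →
            profileAux ε χ₁ χ₂ f z = 1 / 2 * Real.sqrt (1 - ε ^ 2) := fun z h₁ h₂ => by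
          rw [profileAux, hχ.flat₁ z h₁ h₂, hχ.flat₂ z h₁ h₂, hχ.bridgeWeight_of_ge h₁ h₂]
          ring
        filter_upwards [Ioo_mem_nhds (show (-1 : ℝ) - (1 - 2 * ε) < -1 by linarith)
          (show (-1 : ℝ) < -1 + (1 - 2 * ε) by linarith)] with z hz
        have h₁ := hz.1
        have h₂ := hz.2
        rcases le_total (-1) z with h | h
        · rw [hχ.profile_eq f ⟨h, by linarith⟩]
          exact hflat z (le_abs.2 (Or.inr (by linarith))) (abs_le.2 ⟨h, by linarith⟩)
        · rw [← profile_periodic f z, hχ.profile_eq f ⟨by linarith, by linarith⟩]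
          exact hflat _ (le_abs.2 (Or.inl (by linarith))) (abs_le.2 ⟨by linarith, by linarith⟩)
      exact (differentiableAt_const _).congr_of_eventuallyEq hev
    · refine (hχ.differentiableAt_profileAux hε hε' f ⟨hlt, hy.2⟩).congr_of_eventuallyEq ?_
      filter_upwards [Ioo_mem_nhds hlt hy.2] with z hz
      exact hχ.profile_eq f (Ioo_subset_Icc_self hz)
  intro x
  obtain ⟨k, hk⟩ := exists_eq_baseCoord_add x
  have h := key _ (baseCoord_mem x)
  have e : profile ε χ₁ χ₂ f = fun z => profile ε χ₁ χ₂ f (z + (-k : ℤ) * 2) :=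
    funext fun z => ((profile_periodic f).int_mul (-k) z).symm
  rw [e]
  refine DifferentiableAt.comp (g := profile ε χ₁ χ₂ f) x ?_ (by fun_prop)
  have : x + (-k : ℤ) * 2 = baseCoord x := by
    push_cast
    linarith
  rwa [this]

end IsCutoffPair

/-! ### Dependence of the profile on the bridge function -/

/-- The data of a family of tori with a spherical, a bridge and a flat region. -/
structure TorusFamily where
  (ε : ℝ) (χ₁ χ₂ : ℝ → ℝ)
  pos : 0 < ε
  lt : ε < 1 / 2
  cutoff : IsCutoffPair ε χ₁ χ₂

namespace TorusFamily

variable (T : TorusFamily)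

/-- The space of bridge functions. -/
abbrev Bridge : Type := SmoothIcc T.ε (2 * T.ε)

instance : Fact (T.ε < 2 * T.ε) := ⟨by linarith [T.pos]⟩

/-- The profile `a_f`. -/
abbrev prof (f : T.Bridge) : ℝ → ℝ := profile T.ε T.χ₁ T.χ₂ f

/-- The weight of the bridge function in the profile. -/
abbrev weight : ℝ → ℝ := bridgeWeight T.χ₁ T.χ₂

/-- The set of admissible bridge functions. -/
abbrev adm : Set T.Bridge := admissible T.ε T.χ₁ T.χ₂

/-- The profile on `[0, 1]`. -/
def profC (f : T.Bridge) : C(I, ℝ) :=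
  ⟨fun t => T.prof f t,
    (T.cutoff.differentiable_profile T.pos T.lt f).continuous.comp continuous_subtype_val⟩

theorem contDiff_weight : ContDiff ℝ ∞ T.weight := T.cutoff.contDiff_bridgeWeight

/-- The weight on `[0, 1]`. -/
def weightC : C(I, ℝ) := ⟨fun t => T.weight t,
  T.contDiff_weight.continuous.comp continuous_subtype_val⟩

variable {T}

theorem profC_apply (f : T.Bridge) (t : I) :
    T.profC f t = profileAux T.ε T.χ₁ T.χ₂ f t :=
  T.cutoff.profile_eq f ⟨by linarith [t.2.1], t.2.2⟩

theorem iext_profC (f : T.Bridge) {t : ℝ} (ht : t ∈ Icc (0 : ℝ) 1) :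
    iext (T.profC f) t = T.prof f t :=
  iext_of_mem _ ht

theorem profC_sub_apply (f g : T.Bridge) (t : I) :
    T.profC f t - T.profC g t = (f.ext t - g.ext t) * T.weight t := by
  rw [profC_apply, profC_apply, profileAux, profileAux, abs_of_nonneg t.2.1]
  ring

theorem continuous_profC : Continuous T.profC := by
  refine continuous_iff_continuousAt.2 fun g => ?_
  rw [ContinuousAt, tendsto_iff_norm_sub_tendsto_zero]
  have hlim : Tendsto (fun f : T.Bridge =>
      ‖SmoothIcc.derivC 0 f - SmoothIcc.derivC 0 g‖ * ‖T.weightC‖) (𝓝 g) (𝓝 0) := by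
    have h : Continuous fun f : T.Bridge =>
        ‖SmoothIcc.derivC 0 f - SmoothIcc.derivC 0 g‖ * ‖T.weightC‖ :=
      (((SmoothIcc.continuous_derivC 0).sub continuous_const).norm).mul continuous_const
    simpa using h.tendsto g
  refine squeeze_zero (fun _ => norm_nonneg _) (fun f => ?_) hlim
  rw [ContinuousMap.norm_le _ (by positivity)]
  intro t
  rw [ContinuousMap.sub_apply, profC_sub_apply, norm_mul]
  refine mul_le_mul ?_ (T.weightC.norm_coe_le_norm t) (norm_nonneg _) (norm_nonneg _)
  by_cases ht : (t : ℝ) ∈ Icc T.ε (2 * T.ε)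
  · have := (SmoothIcc.derivC 0 f - SmoothIcc.derivC 0 g).norm_coe_le_norm ⟨t, ht⟩
    rwa [ContinuousMap.sub_apply, SmoothIcc.derivC_zero_apply,
      SmoothIcc.derivC_zero_apply] at this
  · rw [SmoothIcc.ext_of_notMem _ ht, SmoothIcc.ext_of_notMem _ ht]
    simp

/-- The profile is even and periodic, so positivity need only be tested on half a period. -/
theorem mem_adm_iff {f : T.Bridge} : f ∈ T.adm ↔ ∀ t, 0 < T.profC f t := by
  refine ⟨fun h t => h _, fun h x => ?_⟩
  obtain ⟨k, hk⟩ := exists_eq_baseCoord_add x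
  have hm := baseCoord_mem x
  have e : profile T.ε T.χ₁ T.χ₂ f x = profile T.ε T.χ₁ T.χ₂ f |baseCoord x| := by
    nth_rw 1 [hk]
    rw [(profile_periodic f).int_mul k]
    rcases abs_choice (baseCoord x) with h' | h' <;> rw [h']
    rw [T.cutoff.profile_neg]
  rw [e]
  exact h ⟨|baseCoord x|, abs_nonneg _, abs_le.2 ⟨hm.1, hm.2.le⟩⟩

theorem isOpen_adm : IsOpen T.adm := by
  have h : T.adm = T.profC ⁻¹' {g : C(I, ℝ) | MapsTo g univ (Ioi 0)} := by
    ext f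
    rw [mem_adm_iff]
    exact ⟨fun h t _ => h t, fun h t => h (mem_univ t)⟩
  rw [h]
  exact (ContinuousMap.isOpen_setOfPred_mapsTo isCompact_univ isOpen_Ioi).preimage
    continuous_profC

theorem contDiffAt_prof (f : T.Bridge) {x : ℝ} (hx : x ∈ Ioo T.ε (2 * T.ε)) :
    ContDiffAt ℝ ∞ (T.prof f) x := by
  have h0 := T.pos
  have h1 := T.lt
  have hpos : 1 - x ^ 2 ≠ 0 := by nlinarith [hx.1, hx.2]
  have hf : ContDiffAt ℝ ∞ f.ext x := f.smooth.contDiffAt (Icc_mem_nhds hx.1 hx.2)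
  have h₀ : ContDiffAt ℝ ∞ (fun y : ℝ => Real.sqrt (1 - y ^ 2)) x :=
    ContDiffAt.sqrt (f := fun y : ℝ => 1 - y ^ 2) (by fun_prop) hpos
  have h : ContDiffAt ℝ ∞ (fun y => Real.sqrt (1 - y ^ 2) * T.χ₁ y
      + 1 / 2 * Real.sqrt (1 - T.ε ^ 2) * T.χ₂ y + f.ext y * T.weight y) x :=
    ((h₀.mul T.cutoff.smooth₁.contDiffAt).add
      (contDiffAt_const.mul T.cutoff.smooth₂.contDiffAt)).add
      (hf.mul T.contDiff_weight.contDiffAt)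
  refine h.congr_of_eventuallyEq ?_
  filter_upwards [Ioo_mem_nhds hx.1 hx.2] with y hy
  change profile T.ε T.χ₁ T.χ₂ f y = _
  rw [T.cutoff.profile_eq f ⟨by linarith [hy.1], by linarith [hy.2]⟩, profileAux,
    abs_of_pos (h0.trans hy.1)]

end TorusFamily

end

/-! ### Common eigenvalues are not generic -/

/-- Either `O` misses `G i`, and `i` is the index sought, or `O ∩ G i` is a nonempty open set on
which `i` is never the missed index and the finite set has become smaller. -/
theorem exists_isOpen_disjoint_of_finset {X ι : Type*} [TopologicalSpace X] {G : ι → Set X}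
    (hG : ∀ i, IsOpen (G i)) (s : Finset ι) {O : Set X} (hO : IsOpen O) (hne : O.Nonempty)
    (h : ∀ x ∈ O, ∃ i ∈ s, x ∉ G i) :
    ∃ i ∈ s, ∃ O' ⊆ O, IsOpen O' ∧ O'.Nonempty ∧ ∀ x ∈ O', x ∉ G i := by
  classical
  induction s using Finset.induction_on generalizing O with
  | empty =>
    obtain ⟨x, hx⟩ := hne
    obtain ⟨i, hi, -⟩ := h x hx
    exact absurd hi (Finset.notMem_empty i)
  | insert i s his ih =>
    by_cases hd : (O ∩ G i).Nonempty
    · obtain ⟨k, hk, O', hO', h'⟩ := ih (hO.inter (hG i)) hd fun x hx => by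
        obtain ⟨k, hk, hxk⟩ := h x hx.1
        rcases Finset.mem_insert.1 hk with rfl | hk
        · exact absurd hx.2 hxk
        · exact ⟨k, hk, hxk⟩
      exact ⟨k, Finset.mem_insert_of_mem hk, O', hO'.trans inter_subset_left, h'⟩
    · exact ⟨i, Finset.mem_insert_self i s, O, Subset.rfl, hO, hne,
        fun x hx hxi => hd ⟨x, hx, hxi⟩⟩

theorem eq_zero_of_tendsto_punctured {φ : ℝ → ℝ} {L : ℝ} (h : Tendsto φ (𝓝[≠] 0) (𝓝 L))
    (h₀ : ∀ᶠ s in 𝓝[≠] (0 : ℝ), φ s = 0) : L = 0 :=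
  tendsto_nhds_unique h (tendsto_const_nhds.congr' (h₀.mono fun _ hs => hs.symm))

section

variable {i j : ℕ × Bool} {a : C(I, ℝ)} {lam : ℝ}

/-- The density `u'² - (n² / a² + lam) u²`, as a function on `[0, 1]`. -/
def densityC (i : ℕ × Bool) (a : C(I, ℝ)) (lam : ℝ) : C(I, ℝ) :=
  Ring.inverse a * Ring.inverse a * ((slSol i a lam).2 * (slSol i a lam).2
    - ((i.1 : ℝ) ^ 2) • ((slSol i a lam).1 * (slSol i a lam).1))
    - lam • ((slSol i a lam).1 * (slSol i a lam).1)

/-- The squared norm `∫ a u²` of the eigenfunction. -/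
def normSqC (i : ℕ × Bool) (a : C(I, ℝ)) (lam : ℝ) : ℝ :=
  integ (a * ((slSol i a lam).1 * (slSol i a lam).1))

theorem iext_densityC (i : ℕ × Bool) (ha : ∀ t, 0 < a t) (lam t : ℝ) :
    iext (densityC i a lam) t = variationDensity (iext a) (iext (slSol i a lam).1)
      (iext (slSol i a lam).2) ((i.1 : ℝ) ^ 2) lam t := by
  have e : iext (densityC i a lam) t = iext (Ring.inverse a) t * iext (Ring.inverse a) t *
      (iext (slSol i a lam).2 t * iext (slSol i a lam).2 t
        - (i.1 : ℝ) ^ 2 * (iext (slSol i a lam).1 t * iext (slSol i a lam).1 t))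
      - lam * (iext (slSol i a lam).1 t * iext (slSol i a lam).1 t) := rfl
  rw [e, iext_inverse ha, variationDensity]
  have := (iext_pos ha t).ne'
  field_simp

theorem tendsto_integ {β : Type*} {l : Filter β} {A : β → C(I, ℝ)} (hA : Tendsto A l (𝓝 a)) :
    Tendsto (fun s => integ (A s)) l (𝓝 (integ a)) :=
  Tendsto.comp (g := integ) (integ.continuous.tendsto a) hA

theorem tendsto_variationForm {β : Type*} {l : Filter β} {α' : β → C(I, ℝ)}
    {y' : β → C(I, ℝ) × C(I, ℝ)} {α₀ : C(I, ℝ)} {y₀ : C(I, ℝ) × C(I, ℝ)} (k α U P : C(I, ℝ))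
    (ν lam : ℝ) (hα : Tendsto α' l (𝓝 α₀)) (hy : Tendsto y' l (𝓝 y₀)) :
    Tendsto (fun s => k * (α * α' s * (P * (y' s).2 - ν • (U * (y' s).1))
        - lam • (U * (y' s).1))) l
      (𝓝 (k * (α * α₀ * (P * y₀.2 - ν • (U * y₀.1)) - lam • (U * y₀.1)))) := by
  have h₁ := hy.fst_nhds.const_mul U
  have h₂ := hy.snd_nhds.const_mul P
  exact (((hα.const_mul α).mul (h₂.sub (h₁.const_smul ν))).sub (h₁.const_smul lam)).const_mul k

/-- First variation of an eigenvalue along the segment `a + s k`, in terms of quantities that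
converge as `s → 0`. -/
theorem exists_first_variation (i : ℕ × Bool) {k : C(I, ℝ)} {ℓ : ℝ → ℝ} (ha : ∀ t, 0 < a t)
    (hℓ : ContinuousAt ℓ 0) (hi : ∀ᶠ s in 𝓝 (0 : ℝ), endVal i (a + s • k) (ℓ s) = 0)
    (hpos : ∀ᶠ s in 𝓝 (0 : ℝ), ∀ t, 0 < (a + s • k) t) :
    ∃ N Q : ℝ → ℝ, Tendsto N (𝓝[≠] 0) (𝓝 (normSqC i a (ℓ 0))) ∧
      Tendsto Q (𝓝[≠] 0) (𝓝 (integ (k * densityC i a (ℓ 0)))) ∧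
      ∀ᶠ s in 𝓝[≠] (0 : ℝ), (ℓ s - ℓ 0) * N s = s * Q s := by
  have hlim : Tendsto (fun s : ℝ => a + s • k) (𝓝[≠] 0) (𝓝 a) := by
    have h : Continuous fun s : ℝ => a + s • k := by fun_prop
    have h' := h.tendsto 0
    rw [zero_smul, add_zero] at h'
    exact h'.mono_left nhdsWithin_le_nhds
  have hlim' : Tendsto ℓ (𝓝[≠] 0) (𝓝 (ℓ 0)) := hℓ.mono_left nhdsWithin_le_nhds
  have hinv : Tendsto (fun s : ℝ => Ring.inverse (a + s • k)) (𝓝[≠] 0) (𝓝 (Ring.inverse a)) :=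
    (continuousAt_inverse ha).tendsto.comp hlim
  have hy : Tendsto (fun s : ℝ => slSol i (a + s • k) (ℓ s)) (𝓝[≠] 0)
      (𝓝 (slSol i a (ℓ 0))) :=
    tendsto_slSol i ha hlim hlim'
  have hy₁ := hy.fst_nhds
  refine ⟨fun s => integ ((a + s • k) * ((slSol i a (ℓ 0)).1 * (slSol i (a + s • k) (ℓ s)).1)),
    fun s => integ (k * (Ring.inverse a * Ring.inverse (a + s • k) *
      ((slSol i a (ℓ 0)).2 * (slSol i (a + s • k) (ℓ s)).2
        - ((i.1 : ℝ) ^ 2) • ((slSol i a (ℓ 0)).1 * (slSol i (a + s • k) (ℓ s)).1))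
      - ℓ 0 • ((slSol i a (ℓ 0)).1 * (slSol i (a + s • k) (ℓ s)).1))), ?_, ?_, ?_⟩
  · exact tendsto_integ (hlim.mul (hy₁.const_mul (slSol i a (ℓ 0)).1))
  · exact tendsto_integ (tendsto_variationForm k (Ring.inverse a) (slSol i a (ℓ 0)).1
      (slSol i a (ℓ 0)).2 ((i.1 : ℝ) ^ 2) (ℓ 0) hinv hy)
  · have h0 : endVal i a (ℓ 0) = 0 := by
      have := hi.self_of_nhds
      rwa [zero_smul, add_zero] at this
    filter_upwards [hi.filter_mono nhdsWithin_le_nhds, hpos.filter_mono nhdsWithin_le_nhds]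
      with s hs hs'
    have h := green_formula ha hs' h0 hs
    rw [add_sub_cancel_left, smul_mul_assoc, map_smul] at h
    exact h

end

namespace TorusFamily

variable {T : TorusFamily} {i j : ℕ × Bool}

/-- The variation of the profile in the direction of the bridge function `h`. -/
def dirC (h : T.Bridge) : C(I, ℝ) :=
  -- `combo 0 h 0 h` is the zero bridge function; subtracting its profile removes the part of the
  -- profile that does not depend on `h`.
  T.profC h - T.profC (SmoothIcc.combo 0 h 0 h)

theorem dirC_apply (h : T.Bridge) (t : I) : dirC h t = h.ext t * T.weight t := by
  rw [dirC, ContinuousMap.sub_apply, profC_sub_apply, SmoothIcc.ext_combo]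
  ring

theorem profC_combo (f h : T.Bridge) (s : ℝ) :
    T.profC (SmoothIcc.combo 1 f s h) = T.profC f + s • dirC h := by
  ext t
  rw [ContinuousMap.add_apply, ContinuousMap.smul_apply, dirC_apply, ← sub_eq_iff_eq_add',
    profC_sub_apply, SmoothIcc.ext_combo, smul_eq_mul]
  ring

/-- The admissible bridge functions without common eigenvalue of types `i` and `j` in `K`. -/
def goodOn (T : TorusFamily) (i j : ℕ × Bool) (K : Set ℝ) : Set T.Bridge :=
  {f | f ∈ T.adm ∧ ∀ lam ∈ K, ¬(endVal i (T.profC f) lam = 0 ∧ endVal j (T.profC f) lam = 0)}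

theorem continuousAt_endVal_profC (i : ℕ × Bool) {f : T.Bridge} (hf : f ∈ T.adm) (lam : ℝ) :
    ContinuousAt (fun z : T.Bridge × ℝ => endVal i (T.profC z.1) z.2) (f, lam) :=
  ContinuousAt.comp (f := fun z : T.Bridge × ℝ => (T.profC z.1, z.2)) (x := (f, lam))
    (g := fun z : C(I, ℝ) × ℝ => endVal i z.1 z.2) (continuousAt_endVal i (mem_adm_iff.1 hf) lam)
    ((continuous_profC.comp continuous_fst).prodMk continuous_snd).continuousAt

theorem isOpen_goodOn (i j : ℕ × Bool) {K : Set ℝ} (hK : IsCompact K) :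
    IsOpen (goodOn T i j K) := by
  refine isOpen_iff_eventually.2 fun f hf =>
    Filter.Eventually.and (isOpen_adm.eventually_mem hf.1) ?_
  refine hK.eventually_forall_of_forall_eventually fun lam hlam => ?_
  have hi := continuousAt_endVal_profC i hf.1 lam
  have hj := continuousAt_endVal_profC j hf.1 lam
  rcases not_and_or.1 (hf.2 lam hlam) with h | h
  · exact (hi.eventually_ne h).mono fun z hz h' => hz h'.1
  · exact (hj.eventually_ne h).mono fun z hz h' => hz h'.2

/-- At `x = y = lam` the integral is a squared norm, hence positive, and it is continuous. With
`eq_of_integ_mul_ne_zero` the ball contains at most one eigenvalue of type `i`, for all `g` near `f`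
at once. -/
theorem eventually_integ_mul_ne_zero (i : ℕ × Bool) {f : T.Bridge} (hf : f ∈ T.adm) (lam : ℝ) :
    ∃ r > 0, ∀ᶠ g in 𝓝 f, ∀ x ∈ Metric.closedBall lam r, ∀ y ∈ Metric.closedBall lam r,
      integ (T.profC g * ((slSol i (T.profC g) x).1 * (slSol i (T.profC g) y).1)) ≠ 0 := by
  have ha := mem_adm_iff.1 hf
  have h₀ : Tendsto (fun z : T.Bridge × ℝ × ℝ => T.profC z.1) (𝓝 (f, lam, lam))
      (𝓝 (T.profC f)) := (continuous_profC.comp continuous_fst).tendsto (f, lam, lam)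
  have h₁ : Tendsto (fun z : T.Bridge × ℝ × ℝ => slSol i (T.profC z.1) z.2.1)
      (𝓝 (f, lam, lam)) (𝓝 (slSol i (T.profC f) lam)) :=
    tendsto_slSol i ha h₀ ((continuous_fst.comp continuous_snd).tendsto (f, lam, lam))
  have h₂ : Tendsto (fun z : T.Bridge × ℝ × ℝ => slSol i (T.profC z.1) z.2.2)
      (𝓝 (f, lam, lam)) (𝓝 (slSol i (T.profC f) lam)) :=
    tendsto_slSol i ha h₀ ((continuous_snd.comp continuous_snd).tendsto (f, lam, lam))
  have hc : Tendsto (fun z : T.Bridge × ℝ × ℝ => integ (T.profC z.1 *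
      ((slSol i (T.profC z.1) z.2.1).1 * (slSol i (T.profC z.1) z.2.2).1))) (𝓝 (f, lam, lam))
      (𝓝 (integ (T.profC f * ((slSol i (T.profC f) lam).1 * (slSol i (T.profC f) lam).1)))) :=
    tendsto_integ (h₀.mul (h₁.fst_nhds.mul h₂.fst_nhds))
  have hev := hc.eventually_ne (integ_sq_pos i ha lam).ne'
  rw [nhds_prod_eq, Filter.eventually_prod_iff] at hev
  obtain ⟨pa, hpa, pb, hpb, h⟩ := hev
  rw [nhds_prod_eq, Filter.eventually_prod_iff] at hpb
  obtain ⟨pc, hpc, pd, hpd, h'⟩ := hpb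
  obtain ⟨r, hr, hball⟩ := Metric.nhds_basis_closedBall.eventually_iff.1 (hpc.and hpd)
  exact ⟨r, hr, hpa.mono fun g hg x hx y hy =>
    h hg (y := (x, y)) (h' (hball hx).1 (hball hy).2)⟩

/-- If common eigenvalues persist on an open set, then some common eigenvalue depends continuously
on the bridge function on a smaller open set. -/
theorem exists_continuous_common_eigenvalue {K : Set ℝ} (hK : IsCompact K) {O : Set T.Bridge}
    (hO : IsOpen O) (hne : O.Nonempty) (hadm : O ⊆ T.adm) (hbad : ∀ f ∈ O, f ∉ goodOn T i j K) :
    ∃ O' : Set T.Bridge, IsOpen O' ∧ O'.Nonempty ∧ O' ⊆ T.adm ∧ ∃ ℓ : T.Bridge → ℝ,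
      ContinuousOn ℓ O' ∧
      ∀ f ∈ O', endVal i (T.profC f) (ℓ f) = 0 ∧ endVal j (T.profC f) (ℓ f) = 0 := by
  obtain ⟨f₀, hf₀⟩ := hne
  choose r hr hN using fun lam : ℝ => eventually_integ_mul_ne_zero i (hadm hf₀) lam
  obtain ⟨s, -, hs⟩ := hK.elim_nhds_subcover (fun lam => Metric.closedBall lam (r lam))
    fun lam _ => Metric.closedBall_mem_nhds lam (hr lam)
  obtain ⟨O₁, hO₁s, hO₁, hfO₁⟩ := mem_nhds_iff.1
    ((eventually_all_finset s).2 fun lam _ => hN lam)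
  -- Finitely many balls of local uniqueness cover `K`; on a smaller open set one fixed ball always
  -- contains a common eigenvalue.
  obtain ⟨lam₀, hlam₀, O', hO', hO'o, hO'ne, hO'bad⟩ := exists_isOpen_disjoint_of_finset
    (G := fun lam => goodOn T i j (Metric.closedBall lam (r lam)))
    (fun lam => isOpen_goodOn i j (isCompact_closedBall _ _)) s (hO.inter hO₁) ⟨f₀, hf₀, hfO₁⟩
    (fun f hf => by
      have hb := hbad f hf.1
      obtain ⟨lam, hlam, hz⟩ : ∃ lam ∈ K,
          endVal i (T.profC f) lam = 0 ∧ endVal j (T.profC f) lam = 0 := by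
        by_contra! h
        exact hb ⟨hadm hf.1, fun lam hlam hz => h lam hlam hz.1 hz.2⟩
      obtain ⟨x, hx, hxlam⟩ := mem_iUnion₂.1 (hs hlam)
      exact ⟨x, hx, fun hgood => hgood.2 lam hxlam hz⟩)
  have hO'adm : O' ⊆ T.adm := fun f hf => hadm (hO' hf).1
  have hex : ∀ f : T.Bridge, ∃ lam, f ∈ O' → lam ∈ Metric.closedBall lam₀ (r lam₀) ∧
      endVal i (T.profC f) lam = 0 ∧ endVal j (T.profC f) lam = 0 := by
    intro f
    by_contra! h
    -- The value `0` is arbitrary: any instance of the negated implication yields `f ∈ O'`.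
    refine hO'bad f (h 0).1 ⟨hO'adm (h 0).1, fun lam hlam hz => (h lam).2 hlam hz.1 hz.2⟩
  choose ℓ hℓ using hex
  have huniq : ∀ f ∈ O', ∀ x ∈ Metric.closedBall lam₀ (r lam₀),
      endVal i (T.profC f) x = 0 → x = ℓ f := fun f hf x hx hz =>
    eq_of_integ_mul_ne_zero (mem_adm_iff.1 (hO'adm hf)) (hℓ f hf).2.1 hz
      (hO₁s (hO' hf).2 lam₀ hlam₀ _ (hℓ f hf).1 _ hx)
  refine ⟨O', hO'o, hO'ne, hO'adm, ℓ, fun f hf => ContinuousAt.continuousWithinAt ?_,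
    fun f hf => (hℓ f hf).2⟩
  refine tendsto_nhds.2 fun V hV hfV => ?_
  -- The ball without the open set `V` is compact and free of common eigenvalues for `f`; by
  -- openness it stays so for nearby `g`, which forces `ℓ g` into `V`.
  have hgood : f ∈ goodOn T i j (Metric.closedBall lam₀ (r lam₀) \ V) :=
    ⟨hO'adm hf, fun x hx hz => hx.2 (huniq f hf x hx.1 hz.1 ▸ hfV)⟩
  filter_upwards [hO'o.mem_nhds hf,
    (isOpen_goodOn i j ((isCompact_closedBall _ _).diff hV)).mem_nhds hgood] with g hg hg'
  by_contra hgV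
  exact hg'.2 (ℓ g) ⟨(hℓ g hg).1, hgV⟩ (hℓ g hg).2

end TorusFamily

/-! ### First variation of a persisting common eigenvalue -/

namespace TorusFamily

variable {T : TorusFamily} {i j : ℕ × Bool}

theorem Ioo_subset (T : TorusFamily) : Ioo T.ε (2 * T.ε) ⊆ Ioo 0 1 := fun _ hx =>
  ⟨T.pos.trans hx.1, by linarith [hx.2, T.lt]⟩

/-- This is the fundamental lemma of the calculus of variations: test functions supported in `W`
restrict to bridge functions, and the weight can be divided out. -/
theorem eq_zero_of_integ_dirC {W : Set ℝ} (hW : IsOpen W) (hWs : W ⊆ Ioo T.ε (2 * T.ε))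
    (hw : ∀ t ∈ W, T.weight t ≠ 0) (D : C(I, ℝ))
    (h : ∀ h : T.Bridge, (∀ x ∉ W, h.ext x = 0) → integ (dirC h * D) = 0) :
    ∀ t ∈ W, iext D t = 0 := by
  have hc : Continuous fun x => T.weight x * iext D x :=
    T.contDiff_weight.continuous.mul (continuous_iext D)
  have hae := hW.ae_eq_zero_of_integral_contDiff_smul_eq_zero (μ := volume)
    (f := fun x => T.weight x * iext D x) (hc.locallyIntegrable.locallyIntegrableOn _) ?_
  · have heq := Measure.eqOn_open_of_ae_eq (μ := volume)
      (g := fun _ : ℝ => (0 : ℝ)) ((ae_restrict_iff' hW.measurableSet).2 hae) hW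
      hc.continuousOn continuousOn_const
    intro t ht
    exact (mul_eq_zero.1 (heq ht)).resolve_left (hw t ht)
  · intro g hg hgc hgW
    have hg0 : ∀ x ∉ W, g x = 0 := fun x hx => image_eq_zero_of_notMem_tsupport fun h => hx (hgW h)
    set b : T.Bridge := SmoothIcc.ofFun g hg.contDiffOn with hb
    have hbg : ∀ x, b.ext x = g x := by
      intro x
      by_cases hx : x ∈ Icc T.ε (2 * T.ε)
      · exact SmoothIcc.ext_ofFun _ _ hx
      · rw [SmoothIcc.ext_of_notMem _ hx, hg0 x fun hxW => hx (Ioo_subset_Icc_self (hWs hxW))]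
    have h₁ := h b fun x hx => by rw [hbg, hg0 x hx]
    rw [integ_apply] at h₁
    have h₂ : ∫ s in (0 : ℝ)..1, iext (dirC b * D) s =
        ∫ s in (0 : ℝ)..1, g s • (T.weight s * iext D s) := by
      refine intervalIntegral.integral_congr fun s hs => ?_
      rw [uIcc_of_le zero_le_one] at hs
      simp only [iext_mul, smul_eq_mul]
      rw [iext_of_mem (dirC b) hs, dirC_apply, hbg]
      ring
    rw [h₂, intervalIntegral.integral_eq_integral_of_support_subset] at h₁
    · exact h₁
    · intro x hx
      have hxW : x ∈ W := by
        by_contra hxW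
        exact hx (by simp [hg0 x hxW])
      have := T.Ioo_subset (hWs hxW)
      exact ⟨this.1, this.2.le⟩

theorem slSol_isEigenpairOn (i : ℕ × Bool) {f : T.Bridge} (hf : f ∈ T.adm) (lam : ℝ) :
    IsEigenpairOn (Ioo 0 1) (T.prof f) (iext (slSol i (T.profC f) lam).1)
      (iext (slSol i (T.profC f) lam).2) ((i.1 : ℝ) ^ 2) lam := by
  have ha := mem_adm_iff.1 hf
  refine ⟨fun t ht => ?_, fun t ht => ?_⟩
  · rw [← iext_profC f (Ioo_subset_Icc_self ht)]
    exact hasDerivAt_slSol_fst i ha lam ht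
  · rw [← iext_profC f (Ioo_subset_Icc_self ht)]
    exact hasDerivAt_slSol_snd i ha lam ht

theorem exists_slSol_ne_zero (i : ℕ × Bool) {f : T.Bridge} (hf : f ∈ T.adm) (lam : ℝ)
    {W : Set ℝ} (hW : IsOpen W) (hWs : W ⊆ Ioo 0 1) (hne : W.Nonempty) :
    ∃ t ∈ W, iext (slSol i (T.profC f) lam).1 t ≠ 0 := by
  obtain ⟨t, ht⟩ := hne
  by_contra! h
  refine not_eventually_slSol_eq_zero i (mem_adm_iff.1 hf) lam (hWs ht) ?_
  filter_upwards [hW.mem_nhds ht] with x hx using h x hx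

/-- `ℓ f` is a common eigenvalue of types `i` and `j` for all `f` in the open set `O`. -/
structure IsCommonEigenvalue (T : TorusFamily) (i j : ℕ × Bool) (O : Set T.Bridge)
    (ℓ : T.Bridge → ℝ) : Prop where
  ne : i ≠ j
  isOpen : IsOpen O
  adm : O ⊆ T.adm
  cont : ContinuousOn ℓ O
  fst : ∀ f ∈ O, endVal i (T.profC f) (ℓ f) = 0
  snd : ∀ f ∈ O, endVal j (T.profC f) (ℓ f) = 0

namespace IsCommonEigenvalue

variable {O : Set T.Bridge} {ℓ : T.Bridge → ℝ} {f : T.Bridge}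

theorem symm (hO : IsCommonEigenvalue T i j O ℓ) : IsCommonEigenvalue T j i O ℓ :=
  ⟨hO.ne.symm, hO.isOpen, hO.adm, hO.cont, hO.snd, hO.fst⟩

theorem lam_ne_zero (hO : IsCommonEigenvalue T i j O ℓ) (hf : f ∈ O) : ℓ f ≠ 0 :=
  TorusOfRevolution.lam_ne_zero hO.ne (mem_adm_iff.1 (hO.adm hf)) (hO.fst f hf) (hO.snd f hf)

theorem pos (hO : IsCommonEigenvalue T i j O ℓ) (hf : f ∈ O) (t : I) : 0 < T.profC f t :=
  mem_adm_iff.1 (hO.adm hf) t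

theorem normSqC_pos (hO : IsCommonEigenvalue T i j O ℓ) (hf : f ∈ O) :
    0 < normSqC i (T.profC f) (ℓ f) :=
  integ_sq_pos i (hO.pos hf) _

theorem eventually_combo_mem (hO : IsCommonEigenvalue T i j O ℓ) (hf : f ∈ O) (h : T.Bridge) :
    ∀ᶠ s : ℝ in 𝓝 0, SmoothIcc.combo 1 f s h ∈ O := by
  have hc : Continuous fun s : ℝ => SmoothIcc.combo 1 f s h :=
    (SmoothIcc.continuous_combo f h).comp (f := fun s : ℝ => ((1 : ℝ), s)) (by fun_prop)
  refine hc.continuousAt.eventually_mem (hO.isOpen.mem_nhds ?_)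
  rwa [SmoothIcc.combo_one_zero]

theorem exists_first_variation (hO : IsCommonEigenvalue T i j O ℓ) (hf : f ∈ O) (h : T.Bridge) :
    ∃ N Q : ℝ → ℝ, Tendsto N (𝓝[≠] 0) (𝓝 (normSqC i (T.profC f) (ℓ f))) ∧
      Tendsto Q (𝓝[≠] 0) (𝓝 (integ (dirC h * densityC i (T.profC f) (ℓ f)))) ∧
      ∀ᶠ s in 𝓝[≠] (0 : ℝ), (ℓ (SmoothIcc.combo 1 f s h) - ℓ f) * N s = s * Q s := by
  have hc : Continuous fun s : ℝ => SmoothIcc.combo 1 f s h :=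
    (SmoothIcc.continuous_combo f h).comp (f := fun s : ℝ => ((1 : ℝ), s)) (by fun_prop)
  have hℓ : ContinuousAt (fun s : ℝ => ℓ (SmoothIcc.combo 1 f s h)) 0 := by
    refine ContinuousAt.comp (g := ℓ) ?_ hc.continuousAt
    rw [SmoothIcc.combo_one_zero]
    exact hO.cont.continuousAt (hO.isOpen.mem_nhds hf)
  have hev := hO.eventually_combo_mem hf h
  have key := TorusOfRevolution.exists_first_variation i (k := dirC h) (hO.pos hf) hℓ
    (hev.mono fun s hs => by
      rw [← profC_combo]
      exact hO.fst _ hs)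
    (hev.mono fun s hs => by
      rw [← profC_combo]
      exact hO.pos hs)
  simpa only [SmoothIcc.combo_one_zero] using key

/-- The increment of `ℓ` is the same for both types; it is eliminated between the two variation
formulas, which are then divided by `s`. -/
theorem integ_dirC_eq (hO : IsCommonEigenvalue T i j O ℓ) (hf : f ∈ O) (h : T.Bridge) :
    normSqC j (T.profC f) (ℓ f) * integ (dirC h * densityC i (T.profC f) (ℓ f)) =
      normSqC i (T.profC f) (ℓ f) * integ (dirC h * densityC j (T.profC f) (ℓ f)) := by
  obtain ⟨N₁, Q₁, hN₁, hQ₁, h₁⟩ := hO.exists_first_variation hf h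
  obtain ⟨N₂, Q₂, hN₂, hQ₂, h₂⟩ := hO.symm.exists_first_variation hf h
  rw [← sub_eq_zero]
  refine eq_zero_of_tendsto_punctured ((hN₂.mul hQ₁).sub (hN₁.mul hQ₂)) ?_
  filter_upwards [h₁, h₂, self_mem_nhdsWithin] with s hs₁ hs₂ hs
  refine (mul_eq_zero.1 ?_).resolve_left hs
  linear_combination N₁ s * hs₂ - N₂ s * hs₁

theorem integ_dirC_eq_zero (hO : IsCommonEigenvalue T i j O ℓ) (hf : f ∈ O) (h : T.Bridge)
    (hℓ : ∀ᶠ s : ℝ in 𝓝 0, ℓ (SmoothIcc.combo 1 f s h) = ℓ f) :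
    integ (dirC h * densityC i (T.profC f) (ℓ f)) = 0 := by
  obtain ⟨N, Q, -, hQ, h₁⟩ := hO.exists_first_variation hf h
  refine eq_zero_of_tendsto_punctured hQ ?_
  filter_upwards [h₁, hℓ.filter_mono nhdsWithin_le_nhds, self_mem_nhdsWithin] with s hs hs' hs₀
  rw [hs', sub_self, zero_mul] at hs
  exact (mul_eq_zero.1 hs.symm).resolve_left hs₀

/-- The first variations of a persisting common eigenvalue agree pointwise. -/
theorem variationDensity_eq (hO : IsCommonEigenvalue T i j O ℓ) (hf : f ∈ O) {W : Set ℝ}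
    (hW : IsOpen W) (hWs : W ⊆ Ioo T.ε (2 * T.ε)) (hw : ∀ t ∈ W, T.weight t ≠ 0) :
    ∀ t ∈ W, normSqC j (T.profC f) (ℓ f) * variationDensity (T.prof f)
        (iext (slSol i (T.profC f) (ℓ f)).1) (iext (slSol i (T.profC f) (ℓ f)).2)
        ((i.1 : ℝ) ^ 2) (ℓ f) t =
      normSqC i (T.profC f) (ℓ f) * variationDensity (T.prof f)
        (iext (slSol j (T.profC f) (ℓ f)).1) (iext (slSol j (T.profC f) (ℓ f)).2)
        ((j.1 : ℝ) ^ 2) (ℓ f) t := by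
  intro t ht
  have key := eq_zero_of_integ_dirC hW hWs hw
    (normSqC j (T.profC f) (ℓ f) • densityC i (T.profC f) (ℓ f)
      - normSqC i (T.profC f) (ℓ f) • densityC j (T.profC f) (ℓ f)) (fun h _ => by
        rw [mul_sub, mul_smul_comm, mul_smul_comm, map_sub, map_smul, map_smul, smul_eq_mul,
          smul_eq_mul, hO.integ_dirC_eq hf h, sub_self]) t ht
  have e : iext (normSqC j (T.profC f) (ℓ f) • densityC i (T.profC f) (ℓ f)
      - normSqC i (T.profC f) (ℓ f) • densityC j (T.profC f) (ℓ f)) t =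
      normSqC j (T.profC f) (ℓ f) * iext (densityC i (T.profC f) (ℓ f)) t
      - normSqC i (T.profC f) (ℓ f) * iext (densityC j (T.profC f) (ℓ f)) t := rfl
  rw [e, iext_densityC i (hO.pos hf), iext_densityC j (hO.pos hf), sub_eq_zero] at key
  have hprof := iext_profC f (Ioo_subset_Icc_self (T.Ioo_subset (hWs ht)))
  simpa only [variationDensity, hprof] using key

end IsCommonEigenvalue

end TorusFamily

/-! ### Common eigenvalues cannot persist -/

namespace TorusFamily

variable {T : TorusFamily} {i j : ℕ × Bool}

theorem hasDerivAt_prof (f : T.Bridge) {t : ℝ} (ht : t ∈ Ioo T.ε (2 * T.ε)) :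
    HasDerivAt (T.prof f) (deriv (T.prof f) t) t :=
  ((contDiffAt_prof f ht).differentiableAt (by simp)).hasDerivAt

theorem hasDerivAt_deriv_prof (f : T.Bridge) {t : ℝ} (ht : t ∈ Ioo T.ε (2 * T.ε)) :
    HasDerivAt (deriv (T.prof f)) (deriv (deriv (T.prof f)) t) t := by
  have h : ContDiffAt ℝ ∞ (deriv (T.prof f)) t :=
    ((contDiffAt_prof f ht).fderiv_right (m := ∞) (by simp)).clm_apply
      (contDiffAt_const (c := (1 : ℝ)))
  exact (h.differentiableAt (by simp)).hasDerivAt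

/-- An interval in the bridge where the weight does not vanish. -/
structure IsBridgeInterval (T : TorusFamily) (α β : ℝ) : Prop where
  lt : α < β
  subset : Ioo α β ⊆ Ioo T.ε (2 * T.ε)
  weight_ne : ∀ t ∈ Ioo α β, T.weight t ≠ 0

/-- The weight is nonzero somewhere on the bridge by the cut-off condition and vanishes at both
ends, so the point is interior and continuity supplies an interval. -/
theorem exists_isBridgeInterval (T : TorusFamily) : ∃ α β, IsBridgeInterval T α β := by
  obtain ⟨x, hx, hne⟩ := T.cutoff.bridge
  have h0 := T.pos
  have h1 := T.lt
  have hw : T.weight x ≠ 0 := fun h => hne (by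
    simp only [weight, bridgeWeight] at h
    linarith)
  have hx' : x ∈ Ioo T.ε (2 * T.ε) := by
    refine ⟨lt_of_le_of_ne hx.1 ?_, lt_of_le_of_ne hx.2 ?_⟩
    · rintro rfl
      exact hw (T.cutoff.bridgeWeight_of_le (abs_of_pos h0).le)
    · rintro rfl
      have habs : |2 * T.ε| = 2 * T.ε := abs_of_pos (by linarith)
      exact hw (T.cutoff.bridgeWeight_of_ge habs.ge (by linarith))
  have hmem : Ioo T.ε (2 * T.ε) ∩ {y | T.weight y ≠ 0} ∈ 𝓝 x :=
    inter_mem (Ioo_mem_nhds hx'.1 hx'.2)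
      ((isOpen_ne_fun T.contDiff_weight.continuous continuous_const).mem_nhds hw)
  obtain ⟨α, β, hαβ, hsub⟩ := mem_nhds_iff_exists_Ioo_subset.1 hmem
  exact ⟨α, β, hαβ.1.trans hαβ.2, fun y hy => (hsub hy).1, fun y hy => (hsub hy).2⟩

namespace IsCommonEigenvalue

variable {O : Set T.Bridge} {ℓ : T.Bridge → ℝ} {f : T.Bridge} {α β : ℝ}

theorem first_order (hO : IsCommonEigenvalue T i j O ℓ) (hf : f ∈ O)
    (hI : IsBridgeInterval T α β) {t : ℝ} (ht : t ∈ Ioo α β) :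
    2 * (normSqC j (T.profC f) (ℓ f) *
        (iext (slSol i (T.profC f) (ℓ f)).1 t * iext (slSol i (T.profC f) (ℓ f)).2 t)
      - normSqC i (T.profC f) (ℓ f) *
        (iext (slSol j (T.profC f) (ℓ f)).1 t * iext (slSol j (T.profC f) (ℓ f)).2 t))
      + deriv (T.prof f) t *
        (normSqC j (T.profC f) (ℓ f) * iext (slSol i (T.profC f) (ℓ f)).1 t ^ 2
        - normSqC i (T.profC f) (ℓ f) * iext (slSol j (T.profC f) (ℓ f)).1 t ^ 2) = 0 :=
  variation_first_order isOpen_Ioo (fun t _ => hO.adm hf t)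
    (fun _ ht => hasDerivAt_prof f (hI.subset ht))
    ((slSol_isEigenpairOn i (hO.adm hf) _).mono (hI.subset.trans T.Ioo_subset))
    ((slSol_isEigenpairOn j (hO.adm hf) _).mono (hI.subset.trans T.Ioo_subset))
    (hO.lam_ne_zero hf) (hO.variationDensity_eq hf isOpen_Ioo hI.subset hI.weight_ne) ht

theorem second_order (hO : IsCommonEigenvalue T i j O ℓ) (hf : f ∈ O)
    (hI : IsBridgeInterval T α β) {t : ℝ} (ht : t ∈ Ioo α β) :
    4 * (normSqC j (T.profC f) (ℓ f) *
        ((i.1 : ℝ) ^ 2 * iext (slSol i (T.profC f) (ℓ f)).1 t ^ 2)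
      - normSqC i (T.profC f) (ℓ f) *
        ((j.1 : ℝ) ^ 2 * iext (slSol j (T.profC f) (ℓ f)).1 t ^ 2)) =
      (normSqC j (T.profC f) (ℓ f) * iext (slSol i (T.profC f) (ℓ f)).1 t ^ 2
        - normSqC i (T.profC f) (ℓ f) * iext (slSol j (T.profC f) (ℓ f)).1 t ^ 2) *
      (deriv (T.prof f) t ^ 2 - T.prof f t * deriv (deriv (T.prof f)) t) :=
  variation_second_order isOpen_Ioo (fun t _ => hO.adm hf t)
    (fun _ ht => hasDerivAt_prof f (hI.subset ht))
    (fun _ ht => hasDerivAt_deriv_prof f (hI.subset ht))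
    ((slSol_isEigenpairOn i (hO.adm hf) _).mono (hI.subset.trans T.Ioo_subset))
    ((slSol_isEigenpairOn j (hO.adm hf) _).mono (hI.subset.trans T.Ioo_subset))
    (hO.lam_ne_zero hf) (hO.variationDensity_eq hf isOpen_Ioo hI.subset hI.weight_ne) ht

/-- The weighted difference of the squares of the eigenfunctions is a nonzero multiple
of `1 / a`. -/
theorem exists_constant (hO : IsCommonEigenvalue T i j O ℓ) (hf : f ∈ O)
    (hI : IsBridgeInterval T α β) : ∃ C, C ≠ 0 ∧ ∀ t ∈ Ioo α β, T.prof f t *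
      (normSqC j (T.profC f) (ℓ f) * iext (slSol i (T.profC f) (ℓ f)).1 t ^ 2
        - normSqC i (T.profC f) (ℓ f) * iext (slSol j (T.profC f) (ℓ f)).1 t ^ 2) = C := by
  obtain ⟨C, hC⟩ := variation_constant isOpen_Ioo isPreconnected_Ioo (fun t _ => hO.adm hf t)
    (fun _ ht => hasDerivAt_prof f (hI.subset ht))
    ((slSol_isEigenpairOn i (hO.adm hf) _).mono (hI.subset.trans T.Ioo_subset))
    ((slSol_isEigenpairOn j (hO.adm hf) _).mono (hI.subset.trans T.Ioo_subset))
    (hO.lam_ne_zero hf) (hO.variationDensity_eq hf isOpen_Ioo hI.subset hI.weight_ne)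
  refine ⟨C, ?_, hC⟩
  rintro rfl
  have hw : ∀ t ∈ Ioo α β,
      normSqC j (T.profC f) (ℓ f) * iext (slSol i (T.profC f) (ℓ f)).1 t ^ 2
        - normSqC i (T.profC f) (ℓ f) * iext (slSol j (T.profC f) (ℓ f)).1 t ^ 2 = 0 :=
    fun t ht => (mul_eq_zero.1 (hC t ht)).resolve_left (hO.adm hf t).ne'
  have hc := hO.symm.normSqC_pos hf
  have hd := hO.normSqC_pos hf
  obtain ⟨t, ht, hne⟩ := exists_slSol_ne_zero j (hO.adm hf) (ℓ f) (isOpen_Ioo (a := α) (b := β))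
    (hI.subset.trans T.Ioo_subset) (nonempty_Ioo.2 hI.lt)
  have h₀ := hw t ht
  have h₁ := hO.first_order hf hI ht
  have h₂ := hO.second_order hf hI ht
  rw [h₀, mul_zero, add_zero] at h₁
  rw [h₀, zero_mul] at h₂
  have htI : t ∈ Icc (0 : ℝ) 1 := Ioo_subset_Icc_self (T.Ioo_subset (hI.subset ht))
  -- With `C = 0` the squares are proportional. For equal weights the first-order relation makes the
  -- Wronskian vanish; for distinct weights the second-order relation makes the eigenfunction of
  -- type `j` vanish at `t`.
  by_cases hν : i.1 = j.1
  · have hwr := wronskian_ne_zero hO.ne hν (T.profC f) (ℓ f) ⟨t, htI⟩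
    rw [← iext_coe, ← iext_coe, ← iext_coe, ← iext_coe] at hwr
    refine hwr ?_
    apply mul_left_cancel₀ (mul_ne_zero hd.ne' hne)
    linear_combination iext (slSol i (T.profC f) (ℓ f)).2 t * h₀
      - (1 / 2) * iext (slSol i (T.profC f) (ℓ f)).1 t * h₁
  · have hμ : ((i.1 : ℝ) ^ 2 - (j.1 : ℝ) ^ 2) ≠ 0 := by
      rw [sub_ne_zero]
      intro h
      exact hν (by exact_mod_cast (pow_left_inj₀ (Nat.cast_nonneg _) (Nat.cast_nonneg _)
        two_ne_zero).1 h)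
    refine mul_ne_zero hμ (mul_ne_zero hd.ne' (pow_ne_zero 2 hne)) ?_
    linear_combination (1 / 4) * h₂ - (i.1 : ℝ) ^ 2 * h₀

theorem weight_ne_weight (hO : IsCommonEigenvalue T i j O ℓ) (hf : f ∈ O) : i.1 ≠ j.1 := by
  intro hν
  obtain ⟨α, β, hI⟩ := T.exists_isBridgeInterval
  have key : ∀ g ∈ O, ∀ t ∈ Ioo α β,
      deriv (T.prof g) t ^ 2 - T.prof g t * deriv (deriv (T.prof g)) t = 4 * (j.1 : ℝ) ^ 2 := by
    intro g hg t ht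
    obtain ⟨C, hC0, hC⟩ := hO.exists_constant hg hI
    have h₂ := hO.second_order hg hI ht
    have hne := right_ne_zero_of_mul ((hC t ht).trans_ne hC0)
    rw [hν] at h₂
    apply mul_left_cancel₀ hne
    linear_combination -h₂
  obtain ⟨x, hx⟩ := nonempty_Ioo.2 hI.lt
  -- This perturbation keeps the profile and its slope at `x` and shifts the second derivative by `2
  -- s` times the weight, so the equation in `key` cannot hold for both profiles.
  set h : T.Bridge := SmoothIcc.ofFun (fun y => (y - x) ^ 2) (by fun_prop) with hh
  obtain ⟨s, hsO, hs⟩ := ((hO.eventually_combo_mem hf h).filter_mono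
    nhdsWithin_le_nhds |>.and (self_mem_nhdsWithin (s := {0}ᶜ))).exists
  set g := SmoothIcc.combo 1 f s h with hg
  have hgf : ∀ t ∈ Ioo α β, T.prof g t = T.prof f t + s * ((t - x) ^ 2 * T.weight t) := by
    intro t ht
    have htb := hI.subset ht
    have htI : t ∈ Icc (0 : ℝ) 1 := Ioo_subset_Icc_self (T.Ioo_subset htb)
    have e : T.profC g ⟨t, htI⟩ = (T.profC f + s • dirC h) ⟨t, htI⟩ := by rw [← profC_combo]
    rw [ContinuousMap.add_apply, ContinuousMap.smul_apply, dirC_apply,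
      SmoothIcc.ext_ofFun _ _ (Ioo_subset_Icc_self htb)] at e
    exact e
  have hwd : Differentiable ℝ T.weight := T.contDiff_weight.differentiable (by simp)
  have hg₁ : ∀ t ∈ Ioo α β, deriv (T.prof g) t =
      deriv (T.prof f) t + s * (2 * (t - x) * T.weight t + (t - x) ^ 2 * deriv T.weight t) := by
    intro t ht
    have d := (hasDerivAt_prof f (hI.subset ht)).add
      ((((((hasDerivAt_id t).sub_const x).pow 2).mul (hwd t).hasDerivAt)).const_mul s)
    rw [Filter.EventuallyEq.deriv_eq (eventually_of_mem (isOpen_Ioo.mem_nhds ht) hgf)]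
    refine (d.congr_deriv ?_).deriv
    simp
  have hg₂ : deriv (deriv (T.prof g)) x = deriv (deriv (T.prof f)) x + s * (2 * T.weight x) := by
    have hwd' : DifferentiableAt ℝ (deriv T.weight) x :=
      ((contDiff_infty_iff_deriv.1 T.contDiff_weight).2.differentiable (by simp)) x
    have d := (hasDerivAt_deriv_prof f (hI.subset hx)).add
      ((((((hasDerivAt_id x).sub_const x).const_mul 2).mul (hwd x).hasDerivAt).add
      ((((hasDerivAt_id x).sub_const x).pow 2).mul hwd'.hasDerivAt)).const_mul s)
    rw [Filter.EventuallyEq.deriv_eq (eventually_of_mem (isOpen_Ioo.mem_nhds hx) hg₁)]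
    refine (d.congr_deriv ?_).deriv
    simp
  have k₁ := key f hf x hx
  have k₂ := key g hsO x hx
  rw [hg₁ x hx, hg₂, hgf x hx, sub_self] at k₂
  refine mul_ne_zero (mul_ne_zero hs (hI.weight_ne x hx)) (hO.adm hf x).ne' ?_
  linear_combination (1 / 2) * k₁ - (1 / 2) * k₂

/-- The square of the eigenfunction is determined up to a factor by the profile. -/
theorem sq_eq (hO : IsCommonEigenvalue T i j O ℓ) (hf : f ∈ O) (hI : IsBridgeInterval T α β) :
    ∃ C, C ≠ 0 ∧ ∀ t ∈ Ioo α β,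
      4 * ((i.1 : ℝ) ^ 2 - (j.1 : ℝ) ^ 2) * (T.prof f t * (normSqC j (T.profC f) (ℓ f) *
        iext (slSol i (T.profC f) (ℓ f)).1 t ^ 2)) =
      C * (deriv (T.prof f) t ^ 2 - T.prof f t * deriv (deriv (T.prof f)) t
        - 4 * (j.1 : ℝ) ^ 2) := by
  obtain ⟨C, hC0, hC⟩ := hO.exists_constant hf hI
  refine ⟨C, hC0, fun t ht => ?_⟩
  have h₁ := hC t ht
  have h₂ := hO.second_order hf hI ht
  linear_combination T.prof f t * h₂ + (deriv (T.prof f) t ^ 2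
    - T.prof f t * deriv (deriv (T.prof f)) t - 4 * (j.1 : ℝ) ^ 2) * h₁

/-- A persisting common eigenvalue is determined by the profile on any interval of the bridge. -/
theorem eq_of_eqOn (hO : IsCommonEigenvalue T i j O ℓ) {g : T.Bridge} (hf : f ∈ O) (hg : g ∈ O)
    (hI : IsBridgeInterval T α β) (h : EqOn (T.prof g) (T.prof f) (Ioo α β)) : ℓ g = ℓ f := by
  have hμ : 4 * ((i.1 : ℝ) ^ 2 - (j.1 : ℝ) ^ 2) ≠ 0 := by
    refine mul_ne_zero (by norm_num) ?_
    rw [sub_ne_zero]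
    intro h
    exact hO.weight_ne_weight hf (by exact_mod_cast (pow_left_inj₀ (Nat.cast_nonneg _)
      (Nat.cast_nonneg _) two_ne_zero).1 h)
  obtain ⟨C, hC0, hC⟩ := hO.sq_eq hf hI
  obtain ⟨D, hD0, hD⟩ := hO.sq_eq hg hI
  have hc := (hO.symm.normSqC_pos hf).ne'
  have hd := (hO.symm.normSqC_pos hg).ne'
  obtain ⟨t, ht, hne⟩ := exists_slSol_ne_zero i (hO.adm hg) (ℓ g) (isOpen_Ioo (a := α) (b := β))
    (hI.subset.trans T.Ioo_subset) (nonempty_Ioo.2 hI.lt)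
  have hev : ∀ t ∈ Ioo α β, T.prof g =ᶠ[𝓝 t] T.prof f := fun t ht =>
    eventually_of_mem (isOpen_Ioo.mem_nhds ht) h
  have hgp : IsEigenpairOn (Ioo α β) (T.prof f) (iext (slSol i (T.profC g) (ℓ g)).1)
      (iext (slSol i (T.profC g) (ℓ g)).2) ((i.1 : ℝ) ^ 2) (ℓ g) := by
    have := (slSol_isEigenpairOn i (hO.adm hg) (ℓ g)).mono (hI.subset.trans T.Ioo_subset)
    refine ⟨fun t ht => ?_, fun t ht => ?_⟩
    · rw [← h ht]
      exact this.fst t ht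
    · rw [← h ht]
      exact this.snd t ht
  -- Both squares are multiples of the same function of the common profile by `sq_eq`; this constant
  -- is the quotient of the two factors.
  refine IsEigenpairOn.eigenvalue_eq (c := D * normSqC j (T.profC f) (ℓ f) /
    (C * normSqC j (T.profC g) (ℓ g))) isOpen_Ioo (fun t _ => hO.adm hf t)
    ((slSol_isEigenpairOn i (hO.adm hf) (ℓ f)).mono (hI.subset.trans T.Ioo_subset)) hgp
    (fun t ht => ?_) ht hne
  have h₁ := hC t ht
  have h₂ := hD t ht
  rw [(hev t ht).deriv.deriv_eq, (hev t ht).deriv_eq, h ht] at h₂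
  have hpos : T.prof f t ≠ 0 := (hO.adm hf t).ne'
  have hCd := mul_ne_zero hC0 hd
  rw [div_mul_eq_mul_div, eq_div_iff hCd]
  apply mul_left_cancel₀ (mul_ne_zero hμ hpos)
  linear_combination C * h₂ - D * h₁

/-- A persisting common eigenvalue has vanishing first variation on the bridge. -/
theorem densityC_eq_zero (hO : IsCommonEigenvalue T i j O ℓ) (hf : f ∈ O) {γ : ℝ}
    (hI : IsBridgeInterval T α γ) (hI' : IsBridgeInterval T γ β) :
    ∀ t ∈ Ioo γ β, variationDensity (T.prof f) (iext (slSol i (T.profC f) (ℓ f)).1)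
      (iext (slSol i (T.profC f) (ℓ f)).2) ((i.1 : ℝ) ^ 2) (ℓ f) t = 0 := by
  intro t ht
  have key := eq_zero_of_integ_dirC isOpen_Ioo hI'.subset hI'.weight_ne
    (densityC i (T.profC f) (ℓ f)) (fun h hh => hO.integ_dirC_eq_zero hf h ?_) t ht
  · rw [iext_densityC i (hO.pos hf)] at key
    have hprof := iext_profC f (Ioo_subset_Icc_self (T.Ioo_subset (hI'.subset ht)))
    simpa only [variationDensity, hprof] using key
  -- A perturbation supported in `(γ, β)` leaves the profile on `(α, γ)` unchanged, and the latter
  -- already determines the eigenvalue.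
  · filter_upwards [hO.eventually_combo_mem hf h] with s hs
    refine hO.eq_of_eqOn hf hs hI fun x hx => ?_
    have hxI : x ∈ Icc (0 : ℝ) 1 := Ioo_subset_Icc_self (T.Ioo_subset (hI.subset hx))
    have e : T.profC (SmoothIcc.combo 1 f s h) ⟨x, hxI⟩ = (T.profC f + s • dirC h) ⟨x, hxI⟩ := by
      rw [← profC_combo]
    rw [ContinuousMap.add_apply, ContinuousMap.smul_apply, dirC_apply,
      hh x fun hx' => lt_asymm hx.2 hx'.1, zero_mul, smul_zero, add_zero] at e
    exact e

/-- At a point where neither eigenfunction vanishes, the first-order equation for the profile holds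
with both weights. The left half of the interval serves to determine the eigenvalue, the right half
to vary the profile. -/
theorem false_of_mem (hO : IsCommonEigenvalue T i j O ℓ) (hf : f ∈ O) : False := by
  obtain ⟨α, β, hI⟩ := T.exists_isBridgeInterval
  have hlt := hI.lt
  have hI₁ : IsBridgeInterval T α ((α + β) / 2) :=
    have hs : Ioo α ((α + β) / 2) ⊆ Ioo α β := Ioo_subset_Ioo_right (by linarith)
    ⟨by linarith, hs.trans hI.subset, fun t ht => hI.weight_ne t (hs ht)⟩
  have hI₂ : IsBridgeInterval T ((α + β) / 2) β :=
    have hs : Ioo ((α + β) / 2) β ⊆ Ioo α β := Ioo_subset_Ioo_left (by linarith)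
    ⟨by linarith, hs.trans hI.subset, fun t ht => hI.weight_ne t (hs ht)⟩
  have hsub := hI₂.subset.trans T.Ioo_subset
  obtain ⟨t, ht, hne⟩ := exists_slSol_ne_zero i (hO.adm hf) (ℓ f)
    (isOpen_Ioo (a := (α + β) / 2) (b := β)) hsub (nonempty_Ioo.2 hI₂.lt)
  have hopen : IsOpen (Ioo ((α + β) / 2) β ∩ {x | iext (slSol i (T.profC f) (ℓ f)).1 x ≠ 0}) :=
    isOpen_Ioo.inter (isOpen_ne_fun (continuous_iext _) continuous_const)
  obtain ⟨x, hx, hne'⟩ := exists_slSol_ne_zero j (hO.adm hf) (ℓ f) hopen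
    (inter_subset_left.trans hsub) ⟨t, ht, hne⟩
  have e₁ := IsEigenpairOn.sq_deriv_eq isOpen_Ioo (fun t _ => hO.adm hf t)
    (fun _ ht => hasDerivAt_prof f (hI₂.subset ht))
    ((slSol_isEigenpairOn i (hO.adm hf) (ℓ f)).mono hsub) (hO.lam_ne_zero hf)
    (hO.densityC_eq_zero hf hI₁ hI₂) hx.1 hx.2
  have e₂ := IsEigenpairOn.sq_deriv_eq isOpen_Ioo (fun t _ => hO.adm hf t)
    (fun _ ht => hasDerivAt_prof f (hI₂.subset ht))
    ((slSol_isEigenpairOn j (hO.adm hf) (ℓ f)).mono hsub) (hO.lam_ne_zero hf)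
    (hO.symm.densityC_eq_zero hf hI₁ hI₂) hx.1 hne'
  have e : (i.1 : ℝ) ^ 2 = (j.1 : ℝ) ^ 2 := by linarith
  exact hO.weight_ne_weight hf (by exact_mod_cast (pow_left_inj₀ (Nat.cast_nonneg _)
    (Nat.cast_nonneg _) two_ne_zero).1 e)

end IsCommonEigenvalue

theorem subset_closure_goodOn (hij : i ≠ j) {K : Set ℝ} (hK : IsCompact K) :
    T.adm ⊆ closure (goodOn T i j K) := by
  intro f hf
  by_contra hcl
  obtain ⟨O, hO, ⟨g, hg⟩, hadm, ℓ, hℓ, hz⟩ := exists_continuous_common_eigenvalue (i := i) (j := j)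
    hK (isOpen_adm.inter (isClosed_closure (s := goodOn T i j K)).isOpen_compl) ⟨f, hf, hcl⟩
    inter_subset_left fun g hg hg' => hg.2 (subset_closure hg')
  exact IsCommonEigenvalue.false_of_mem
    ⟨hij, hO, hadm, hℓ, fun f hf => (hz f hf).1, fun f hf => (hz f hf).2⟩ hg

end TorusFamily

/-! ### Separation of variables -/

section

variable {F : Type*} [NormedAddCommGroup F] [NormedSpace ℝ F]

theorem hasDerivAt_slice_zero {u : (Fin 2 → ℝ) → F} (hu : Differentiable ℝ u) (x θ : ℝ) :
    HasDerivAt (fun y => u ![y, θ]) (pderiv 0 u ![x, θ]) x := by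
  have h : HasDerivAt (fun y : ℝ => ![y, θ]) (Pi.single 0 1) x := by
    rw [hasDerivAt_pi]
    intro i
    fin_cases i
    · exact hasDerivAt_id x
    · exact hasDerivAt_const x θ
  exact (hu ![x, θ]).hasFDerivAt.comp_hasDerivAt x h

theorem hasDerivAt_slice_one {u : (Fin 2 → ℝ) → F} (hu : Differentiable ℝ u) (x θ : ℝ) :
    HasDerivAt (fun y => u ![x, y]) (pderiv 1 u ![x, θ]) θ := by
  have h : HasDerivAt (fun y : ℝ => ![x, y]) (Pi.single 1 1) θ := by
    rw [hasDerivAt_pi]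
    intro i
    fin_cases i
    · exact hasDerivAt_const θ x
    · exact hasDerivAt_id θ
  exact (hu ![x, θ]).hasFDerivAt.comp_hasDerivAt θ h

theorem continuous_pair : Continuous fun z : ℝ × ℝ => (![z.1, z.2] : Fin 2 → ℝ) := by
  refine continuous_pi fun i => ?_
  fin_cases i
  · exact continuous_fst
  · exact continuous_snd

theorem pair_eta (p : Fin 2 → ℝ) : ![p 0, p 1] = p := by
  ext i
  fin_cases i <;> rfl

theorem pderiv_const (c : ℝ) (i : Fin 2) (p : Fin 2 → ℝ) : pderiv i (fun _ => c) p = 0 := by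
  simp [pderiv]

theorem pderiv_sq_comp {a : ℝ → ℝ} (hd : Differentiable ℝ a) (i : Fin 2) (p : Fin 2 → ℝ) :
    pderiv i (fun q => a (q 0) ^ 2) p =
      2 * a (p 0) * deriv a (p 0) * (Pi.single i 1 : Fin 2 → ℝ) 0 := by
  have h : HasFDerivAt (fun q : Fin 2 → ℝ => a (q 0))
      (deriv a (p 0) • ContinuousLinearMap.proj (R := ℝ) (φ := fun _ : Fin 2 => ℝ) 0) p :=
    (hd (p 0)).hasDerivAt.comp_hasFDerivAt p
      (ContinuousLinearMap.proj (R := ℝ) (φ := fun _ : Fin 2 => ℝ) 0).hasFDerivAt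
  have h2 := h.pow 2
  rw [pderiv, h2.fderiv]
  simp
  ring

/-- The Laplacian of `dx² + a(x)² dθ²`. -/
theorem laplaceBeltrami_revolutionMetric {a : ℝ → ℝ} (ha : ∀ x, 0 < a x)
    (hd : Differentiable ℝ a) (u : (Fin 2 → ℝ) → F) (p : Fin 2 → ℝ) :
    laplaceBeltrami (revolutionMetric a) u p = pderiv 0 (pderiv 0 u) p
      + (deriv a (p 0) / a (p 0)) • pderiv 0 u p
      + (a (p 0) ^ 2)⁻¹ • pderiv 1 (pderiv 1 u) p := by
  have hne := (ha (p 0)).ne'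
  have hinv : (revolutionMetric a p)⁻¹ = !![1, 0; 0, (a (p 0) ^ 2)⁻¹] := by
    refine Matrix.inv_eq_right_inv ?_
    ext i j
    fin_cases i <;> fin_cases j <;> simp [revolutionMetric, Matrix.mul_apply, hne]
  have hg : ∀ l : Fin 2, pderiv l (fun q => revolutionMetric a q 0 0) p = 0 ∧
      pderiv l (fun q => revolutionMetric a q 0 1) p = 0 ∧
      pderiv l (fun q => revolutionMetric a q 1 0) p = 0 ∧
      pderiv l (fun q => revolutionMetric a q 1 1) p =
        2 * a (p 0) * deriv a (p 0) * (Pi.single l 1 : Fin 2 → ℝ) 0 := fun l =>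
    ⟨pderiv_const 1 l p, pderiv_const 0 l p, pderiv_const 0 l p, pderiv_sq_comp hd l p⟩
  have hΓ : ∀ k i j, christoffel (revolutionMetric a) k i j p =
      if k = 0 ∧ i = 1 ∧ j = 1 then -(a (p 0) * deriv a (p 0))
      else if k = 1 ∧ i ≠ j then deriv a (p 0) / a (p 0) else 0 := by
    intro k i j
    obtain ⟨h00, h01, h10, h11⟩ := hg 0
    obtain ⟨k00, k01, k10, k11⟩ := hg 1
    simp only [christoffel, hinv, Fin.sum_univ_two]
    fin_cases k <;> fin_cases i <;> fin_cases j <;>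
      simp [h00, h01, h10, h11, k00, k01, k10, k11] <;> field_simp
  simp only [laplaceBeltrami, hinv, hΓ, Fin.sum_univ_two]
  simp
  have e : deriv a (p 0) / a (p 0) = (a (p 0) ^ 2)⁻¹ * (a (p 0) * deriv a (p 0)) := by
    field_simp
  rw [e]
  module

theorem mem_eigenspace_iff {a : ℝ → ℝ} (ha : ∀ x, 0 < a x) (hd : Differentiable ℝ a) {lam : ℝ}
    {u : Torus → F} : u ∈ eigenspace F a lam ↔ ContDiff ℝ ∞ (lift u) ∧ ∀ p,
      pderiv 0 (pderiv 0 (lift u)) p + (deriv a (p 0) / a (p 0)) • pderiv 0 (lift u) p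
        + (a (p 0) ^ 2)⁻¹ • pderiv 1 (pderiv 1 (lift u)) p = -(lam • lift u p) := by
  refine and_congr_right fun _ => forall_congr' fun p => ?_
  rw [laplaceBeltrami_revolutionMetric ha hd, neg_eq_iff_eq_neg]

omit [NormedAddCommGroup F] [NormedSpace ℝ F] in
theorem lift_pair (u : Torus → F) (x θ : ℝ) :
    lift u ![x, θ] = u ((x : AddCircle (2 : ℝ)), Circle.exp θ) := rfl

omit [NormedAddCommGroup F] [NormedSpace ℝ F] in
theorem lift_pair_add_two (u : Torus → F) (x θ : ℝ) : lift u ![x + 2, θ] = lift u ![x, θ] := by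
  rw [lift_pair, lift_pair, AddCircle.coe_add_period]

omit [NormedAddCommGroup F] [NormedSpace ℝ F] in
theorem lift_add_single_two_pi (u : Torus → F) (p : Fin 2 → ℝ) :
    lift u (p + Pi.single 1 (2 * Real.pi)) = lift u p := by
  simp [lift, Circle.exp_add]

end

/-! ### Fourier coefficients in the fibre variable -/

/-- The character `θ ↦ e^{-ikθ}`. -/
def fiberChar (k : ℤ) (θ : ℝ) : ℂ := Complex.exp (-(k * Complex.I * θ))

theorem hasDerivAt_fiberChar (k : ℤ) (θ : ℝ) :
    HasDerivAt (fiberChar k) (-(k * Complex.I) * fiberChar k θ) θ := by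
  have h : HasDerivAt (fun θ : ℝ => -((k : ℂ) * Complex.I * θ)) (-(k * Complex.I)) θ := by
    have := ((hasDerivAt_id θ).ofReal_comp.const_mul ((k : ℂ) * Complex.I)).neg
    rwa [Complex.ofReal_one, mul_one] at this
  refine h.cexp.congr_deriv ?_
  rw [fiberChar, mul_comm]

theorem continuous_fiberChar (k : ℤ) : Continuous (fiberChar k) :=
  continuous_iff_continuousAt.2 fun θ => (hasDerivAt_fiberChar k θ).continuousAt

theorem fiberChar_two_pi (k : ℤ) : fiberChar k (2 * Real.pi) = 1 := by
  rw [fiberChar, Complex.exp_eq_one_iff]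
  refine ⟨-k, ?_⟩
  push_cast
  ring

theorem fiberChar_zero (k : ℤ) : fiberChar k 0 = 1 := by simp [fiberChar]

/-- `∫₀^{2π} e^{-ikθ} G(x, θ) dθ`. -/
def fiberCoeff (k : ℤ) (G : (Fin 2 → ℝ) → ℝ) (x : ℝ) : ℂ :=
  ∫ θ in (0 : ℝ)..2 * Real.pi, fiberChar k θ * (G ![x, θ] : ℂ)

theorem continuous_fiberIntegrand (k : ℤ) {G : (Fin 2 → ℝ) → ℝ} (hG : Continuous G) :
    Continuous fun z : ℝ × ℝ => fiberChar k z.2 * (G ![z.1, z.2] : ℂ) :=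
  ((continuous_fiberChar k).comp continuous_snd).mul
    (Complex.continuous_ofReal.comp (hG.comp continuous_pair))

theorem intervalIntegrable_fiberIntegrand (k : ℤ) {G : (Fin 2 → ℝ) → ℝ} (hG : Continuous G)
    (x c d : ℝ) :
    IntervalIntegrable (fun θ => fiberChar k θ * (G ![x, θ] : ℂ)) volume c d :=
  ((continuous_fiberIntegrand k hG).comp (Continuous.prodMk_right x)).intervalIntegrable _ _

theorem hasDerivAt_fiberCoeff (k : ℤ) {G : (Fin 2 → ℝ) → ℝ} (hG : ContDiff ℝ ∞ G) (x : ℝ) :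
    HasDerivAt (fiberCoeff k G) (fiberCoeff k (pderiv 0 G) x) x := by
  have hc := continuous_fiberIntegrand k (contDiff_pderiv hG 0).continuous
  obtain ⟨M, hM⟩ := ((isCompact_closedBall x 1).prod
    (isCompact_uIcc (a := 0) (b := 2 * Real.pi))).exists_bound_of_continuousOn hc.continuousOn
  refine (intervalIntegral.hasDerivAt_integral_of_dominated_loc_of_deriv_le
    (F := fun y θ => fiberChar k θ * (G ![y, θ] : ℂ))
    (F' := fun y θ => fiberChar k θ * ((pderiv 0 G ![y, θ] : ℝ) : ℂ))
    (Metric.closedBall_mem_nhds x one_pos) (bound := fun _ => M) ?_ ?_ ?_ ?_ ?_ ?_).2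
  · exact Eventually.of_forall fun y => ((continuous_fiberIntegrand k hG.continuous).comp
      (Continuous.prodMk_right y)).aestronglyMeasurable
  · exact intervalIntegrable_fiberIntegrand k hG.continuous x _ _
  · exact (hc.comp (Continuous.prodMk_right x)).aestronglyMeasurable
  · exact Eventually.of_forall fun θ hθ y hy => hM (y, θ) ⟨hy, uIoc_subset_uIcc hθ⟩
  · exact intervalIntegrable_const
  · exact Eventually.of_forall fun θ _ y _ =>
      ((hasDerivAt_slice_zero (hG.differentiable (by simp)) y θ).ofReal_comp).const_mul _

/-- Integration by parts; the boundary terms cancel by periodicity. -/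
theorem fiberCoeff_pderiv_one (k : ℤ) {G : (Fin 2 → ℝ) → ℝ} (hG : ContDiff ℝ ∞ G)
    (hper : ∀ p, G (p + Pi.single 1 (2 * Real.pi)) = G p) (x : ℝ) :
    fiberCoeff k (pderiv 1 G) x = k * Complex.I * fiberCoeff k G x := by
  have h := intervalIntegral.integral_mul_deriv_eq_deriv_mul (a := 0) (b := 2 * Real.pi)
    (u := fiberChar k) (v := fun θ => (G ![x, θ] : ℂ))
    (fun θ _ => hasDerivAt_fiberChar k θ)
    (fun θ _ => (hasDerivAt_slice_one (hG.differentiable (by simp)) x θ).ofReal_comp)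
    ((continuous_const.mul (continuous_fiberChar k)).intervalIntegrable _ _)
    ((Complex.continuous_ofReal.comp ((contDiff_pderiv hG 1).continuous.comp
      (continuous_pair.comp (Continuous.prodMk_right x)))).intervalIntegrable _ _)
  have hp : G ![x, 2 * Real.pi] = G ![x, 0] := by
    rw [← hper ![x, 0]]
    congr 1
    ext i
    fin_cases i <;> simp
  rw [fiberCoeff, h, hp, fiberChar_two_pi, fiberChar_zero, sub_self, zero_sub, fiberCoeff,
    ← intervalIntegral.integral_neg, ← intervalIntegral.integral_const_mul]
  exact intervalIntegral.integral_congr fun θ _ => by ring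

theorem fiberCoeff_add_smul (k : ℤ) {G H : (Fin 2 → ℝ) → ℝ} (hG : Continuous G)
    (hH : Continuous H) (c : ℝ) {x : ℝ} {K : (Fin 2 → ℝ) → ℝ}
    (h : ∀ θ, K ![x, θ] = G ![x, θ] + c * H ![x, θ]) :
    fiberCoeff k K x = fiberCoeff k G x + c * fiberCoeff k H x := by
  rw [fiberCoeff, fiberCoeff, fiberCoeff, ← intervalIntegral.integral_const_mul,
    ← intervalIntegral.integral_add (intervalIntegrable_fiberIntegrand k hG x _ _)
    ((intervalIntegrable_fiberIntegrand k hH x _ _).const_mul _)]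
  refine intervalIntegral.integral_congr fun θ _ => ?_
  simp only [h]
  push_cast
  ring

/-- The Fourier coefficients of an eigenfunction solve the reduced equation. -/
theorem fiberCoeff_equation {a : ℝ → ℝ} (ha : ∀ x, 0 < a x) (hd : Differentiable ℝ a) {lam : ℝ}
    {u : Torus → ℝ} (hu : u ∈ eigenspace ℝ a lam) (k : ℤ) (x : ℝ) :
    HasDerivAt (fun y => (a y : ℂ) * fiberCoeff k (pderiv 0 (lift u)) y)
      (((k : ℂ) ^ 2 / a x - lam * a x) * fiberCoeff k (lift u) x) x := by
  obtain ⟨hs, heq⟩ := (mem_eigenspace_iff ha hd).1 hu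
  have h0 := contDiff_pderiv hs 0
  have h1 := contDiff_pderiv hs 1
  have h00 := contDiff_pderiv h0 0
  have h11 := contDiff_pderiv h1 1
  have hper : ∀ p, pderiv 1 (lift u) (p + Pi.single 1 (2 * Real.pi)) = pderiv 1 (lift u) p := by
    intro p
    have h := congrFun (pderiv_comp_add (lift u) (Pi.single 1 (2 * Real.pi)) 1) p
    rw [← h]
    simp only [lift_add_single_two_pi]
  have e₁ : fiberCoeff k (fun p => pderiv 0 (pderiv 0 (lift u)) p
      + deriv a x / a x * pderiv 0 (lift u) p) x = fiberCoeff k (pderiv 0 (pderiv 0 (lift u))) x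
      + (deriv a x / a x : ℝ) * fiberCoeff k (pderiv 0 (lift u)) x :=
    fiberCoeff_add_smul k h00.continuous h0.continuous _ fun θ => rfl
  have e₂ : fiberCoeff k (fun p => -(lam * lift u p)) x = fiberCoeff k (fun p =>
      pderiv 0 (pderiv 0 (lift u)) p + deriv a x / a x * pderiv 0 (lift u) p) x
      + ((a x ^ 2)⁻¹ : ℝ) * fiberCoeff k (pderiv 1 (pderiv 1 (lift u))) x :=
    fiberCoeff_add_smul k (h00.continuous.add (continuous_const.mul h0.continuous))
      h11.continuous _ fun θ => (heq ![x, θ]).symm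
  -- Homogeneity is obtained from additivity by writing `-lam u = u + (-lam - 1) u`.
  have e₃ : fiberCoeff k (fun p => -(lam * lift u p)) x = fiberCoeff k (lift u) x
      + ((-lam - 1 : ℝ) : ℂ) * fiberCoeff k (lift u) x :=
    fiberCoeff_add_smul k hs.continuous hs.continuous _ fun θ => by ring
  rw [e₃, e₁, fiberCoeff_pderiv_one k h1 hper,
    fiberCoeff_pderiv_one k hs (lift_add_single_two_pi u)] at e₂
  refine ((hd x).hasDerivAt.ofReal_comp.mul (hasDerivAt_fiberCoeff k h0 x)).congr_deriv ?_
  have hne : (a x : ℂ) ≠ 0 := by exact_mod_cast (ha x).ne'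
  push_cast at e₂
  field_simp at e₂ ⊢
  linear_combination -e₂ - (k : ℂ) ^ 2 * fiberCoeff k (lift u) x * Complex.I_sq

instance fact_two_pi_pos : Fact (0 < 2 * Real.pi) := ⟨Real.two_pi_pos⟩

/-- The restriction of a function to a fibre circle. -/
def fiberFun {u : Torus → ℝ} (hu : Continuous (lift u)) (x : ℝ) :
    C(AddCircle (2 * Real.pi), ℂ) where
  toFun y := (u ((x : AddCircle (2 : ℝ)), AddCircle.homeomorphCircle' y) : ℂ)
  continuous_toFun := continuous_coinduced_dom.mpr
    (Complex.continuous_ofReal.comp (hu.comp (continuous_pair.comp (Continuous.prodMk_right x))))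

theorem fiberFun_coe {u : Torus → ℝ} (hu : Continuous (lift u)) (x θ : ℝ) :
    fiberFun hu x (θ : AddCircle (2 * Real.pi)) = ((lift u ![x, θ] : ℝ) : ℂ) := rfl

theorem fourier_two_pi (k : ℤ) (θ : ℝ) :
    fourier k (θ : AddCircle (2 * Real.pi)) = Complex.exp (k * Complex.I * θ) := by
  rw [fourier_coe_apply]
  congr 1
  have : (Real.pi : ℂ) ≠ 0 := by exact_mod_cast Real.pi_ne_zero
  push_cast
  field_simp

theorem fourierCoeff_fiberFun {u : Torus → ℝ} (hu : Continuous (lift u)) (x : ℝ) (k : ℤ) :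
    fourierCoeff (fiberFun hu x) k = ((1 / (2 * Real.pi) : ℝ) : ℂ) * fiberCoeff k (lift u) x := by
  rw [fourierCoeff_eq_intervalIntegral _ k 0, zero_add, Complex.real_smul, fiberCoeff]
  congr 1
  refine intervalIntegral.integral_congr fun θ _ => ?_
  simp only [fiberFun_coe, fourier_two_pi, smul_eq_mul, fiberChar]
  congr 2
  push_cast
  ring

/-- A function on the torus with finitely many fibre Fourier coefficients is their sum. -/
theorem lift_eq_sum_fiberCoeff {u : Torus → ℝ} (hu : Continuous (lift u)) {x : ℝ} (s : Finset ℤ)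
    (hs : ∀ k ∉ s, fiberCoeff k (lift u) x = 0) (θ : ℝ) :
    ((lift u ![x, θ] : ℝ) : ℂ) = ∑ k ∈ s, ((1 / (2 * Real.pi) : ℝ) : ℂ) * fiberCoeff k (lift u) x *
      Complex.exp (k * Complex.I * θ) := by
  have h0 : ∀ k ∉ s, fourierCoeff (fiberFun hu x) k = 0 := fun k hk => by
    rw [fourierCoeff_fiberFun, hs k hk, mul_zero]
  have h₁ := has_pointwise_sum_fourier_series_of_summable (summable_of_ne_finset_zero h0)
    (θ : AddCircle (2 * Real.pi))
  have h₂ := hasSum_sum_of_ne_finset_zero (L := .unconditional ℤ)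
    (f := fun k => fourierCoeff (fiberFun hu x) k •
    fourier k (θ : AddCircle (2 * Real.pi))) (s := s) (fun k hk => by simp [h0 k hk])
  rw [← fiberFun_coe hu, h₁.unique h₂]
  refine Finset.sum_congr rfl fun k _ => ?_
  rw [fourierCoeff_fiberFun, fourier_two_pi, smul_eq_mul]

/-- The even or odd `2`-periodic extension of a solution on `[0, 1]`. -/
def slExt (i : ℕ × Bool) (a : C(I, ℝ)) (lam x : ℝ) : ℝ :=
  (if i.2 ∨ 0 ≤ baseCoord x then 1 else -1) * iext (slSol i a lam).1 |baseCoord x|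

theorem abs_baseCoord_mem (x : ℝ) : |baseCoord x| ∈ Icc (0 : ℝ) 1 :=
  ⟨abs_nonneg _, abs_le.2 ⟨(baseCoord_mem x).1, (baseCoord_mem x).2.le⟩⟩

theorem periodic_eq_baseCoord {g : ℝ → ℝ} (hg : Function.Periodic g 2) (x : ℝ) :
    g x = g (baseCoord x) := by
  obtain ⟨k, hk⟩ := exists_eq_baseCoord_add x
  nth_rw 1 [hk]
  exact hg.int_mul k _

/-! ### Eigenfunctions in terms of the reduced problems -/

namespace TorusFamily

variable {T : TorusFamily}

theorem solves_on_unitInterval {f : T.Bridge} (hf : f ∈ T.adm) {n : ℕ} {lam : ℝ} {g q : ℝ → ℝ}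
    (hg : ∀ x, HasDerivAt g (q x / T.prof f x) x)
    (hq : ∀ x, HasDerivAt q (((n : ℝ) ^ 2 / T.prof f x - lam * T.prof f x) * g x) x) (t : I) :
    g t = g 0 * (slSol (n, true) (T.profC f) lam).1 t
        + q 0 * (slSol (n, false) (T.profC f) lam).1 t ∧
      q t = g 0 * (slSol (n, true) (T.profC f) lam).2 t
        + q 0 * (slSol (n, false) (T.profC f) lam).2 t := by
  have ha := mem_adm_iff.1 hf
  have h := eq_planarSol_of_hasDerivAt (c := coeffs (T.profC f) n lam)
    (continuous_iff_continuousAt.2 fun x => (hg x).continuousAt)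
    (continuous_iff_continuousAt.2 fun x => (hq x).continuousAt)
    (fun x hx => (hg x).congr_deriv (by
      rw [coeffs, iext_inverse ha, iext_profC f hx, div_eq_inv_mul]))
    (fun x hx => (hq x).congr_deriv (by
      have e : iext (coeffs (T.profC f) n lam).2 x =
        (n : ℝ) ^ 2 * iext (Ring.inverse (T.profC f)) x - lam * iext (T.profC f) x := rfl
      rw [e, iext_inverse ha, iext_profC f hx, div_eq_mul_inv])) t
  rw [planarSol_coeffs] at h
  exact h

/-- Solutions of the reduced equation on the base circle are combinations of an even and an odd
one. -/
theorem periodic_solution {f : T.Bridge} (hf : f ∈ T.adm) {n : ℕ} {lam : ℝ} {g q : ℝ → ℝ}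
    (hgp : Function.Periodic g 2) (hqp : Function.Periodic q 2)
    (hg : ∀ x, HasDerivAt g (q x / T.prof f x) x)
    (hq : ∀ x, HasDerivAt q (((n : ℝ) ^ 2 / T.prof f x - lam * T.prof f x) * g x) x) :
    g 0 * endVal (n, true) (T.profC f) lam = 0 ∧ q 0 * endVal (n, false) (T.profC f) lam = 0 ∧
      ∀ x, g x = g 0 * slExt (n, true) (T.profC f) lam x
        + q 0 * slExt (n, false) (T.profC f) lam x := by
  have hneg : ∀ x, T.prof f (-x) = T.prof f x := T.cutoff.profile_neg f
  -- The profile is even, so `(g(-x), -q(-x))` solves the same system. Comparing it with `(g, q)` at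
  -- `1`, where periodicity identifies `1` and `-1`, gives the boundary conditions.
  have hg' : ∀ x, HasDerivAt (fun y => g (-y)) (-q (-x) / T.prof f x) x := fun x => by
    have := (hg (-x)).scomp x (hasDerivAt_neg x)
    refine this.congr_deriv ?_
    rw [hneg, smul_eq_mul]
    ring
  have hq' : ∀ x, HasDerivAt (fun y => -q (-y))
      (((n : ℝ) ^ 2 / T.prof f x - lam * T.prof f x) * g (-x)) x := fun x => by
    have := ((hq (-x)).scomp x (hasDerivAt_neg x)).neg
    refine this.congr_deriv ?_
    rw [hneg, smul_eq_mul]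
    ring
  have h₁ := solves_on_unitInterval hf hg hq
  have h₂ := solves_on_unitInterval hf hg' hq'
  rw [neg_zero] at h₂
  have hg1 : g (-1) = g 1 := by
    have := hgp (-1)
    norm_num at this
    exact this.symm
  have hq1 : q (-1) = q 1 := by
    have := hqp (-1)
    norm_num at this
    exact this.symm
  have e₁ := h₁ 1
  have e₂ := h₂ 1
  simp only [Set.Icc.coe_one] at e₁ e₂
  rw [hg1, hq1] at e₂
  refine ⟨?_, ?_, fun x => ?_⟩
  · change g 0 * (slSol (n, true) (T.profC f) lam).2 1 = 0
    linarith [e₁.2, e₂.2]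
  · change q 0 * (slSol (n, false) (T.profC f) lam).1 1 = 0
    linarith [e₁.1, e₂.1]
  · have hm := abs_baseCoord_mem x
    rw [periodic_eq_baseCoord hgp x]
    simp only [slExt, iext_of_mem _ hm, Bool.false_eq_true, false_or, true_or, if_true]
    rcases le_or_gt 0 (baseCoord x) with h | h
    · have := (h₁ ⟨_, hm⟩).1
      rw [if_pos h]
      simp only [abs_of_nonneg h] at this ⊢
      linarith
    · have := (h₂ ⟨_, hm⟩).1
      rw [if_neg (not_le.2 h)]
      simp only [abs_of_neg h, neg_neg] at this ⊢
      linarith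

/-- The fibre Fourier coefficients of an eigenfunction. -/
theorem fiberCoeff_eq {f : T.Bridge} (hf : f ∈ T.adm) {lam : ℝ} {u : Torus → ℝ}
    (hu : u ∈ eigenspace ℝ (T.prof f) lam) (k : ℤ) :
    ∃ A : Bool → ℂ, (∀ b, A b * endVal (k.natAbs, b) (T.profC f) lam = 0) ∧
      ∀ x, fiberCoeff k (lift u) x = A true * slExt (k.natAbs, true) (T.profC f) lam x
        + A false * slExt (k.natAbs, false) (T.profC f) lam x := by
  have hd := T.cutoff.differentiable_profile T.pos T.lt f
  have hs := ((mem_eigenspace_iff hf hd).1 hu).1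
  set c := fiberCoeff k (lift u) with hc
  set q : ℝ → ℂ := fun y => (T.prof f y : ℂ) * fiberCoeff k (pderiv 0 (lift u)) y with hqdef
  have hcp : ∀ x, c (x + 2) = c x := fun x => by
    simp only [hc, fiberCoeff, lift_pair_add_two]
  have hqp : ∀ x, q (x + 2) = q x := fun x => by
    have hp : ∀ θ, pderiv 0 (lift u) ![x + 2, θ] = pderiv 0 (lift u) ![x, θ] := by
      intro θ
      have h := congrFun (pderiv_comp_add (lift u) ![2, 0] 0) ![x, θ]
      have e : (fun p => lift u (p + ![2, 0])) = lift u := by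
        funext p
        rw [← pair_eta p]
        simpa using lift_pair_add_two u (p 0) (p 1)
      rw [e] at h
      simpa using h.symm
    simp only [hqdef, fiberCoeff, hp]
    rw [show T.prof f (x + 2) = T.prof f x from profile_periodic f x]
  have hcd : ∀ x, HasDerivAt c (((T.prof f x)⁻¹ : ℝ) * q x) x := fun x => by
    refine (hasDerivAt_fiberCoeff k hs x).congr_deriv ?_
    have : (T.prof f x : ℂ) ≠ 0 := by exact_mod_cast (hf x).ne'
    simp only [hqdef]
    push_cast
    rw [inv_mul_cancel_left₀ this]
  have hqd : ∀ x, HasDerivAt q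
      (((k.natAbs : ℝ) ^ 2 / T.prof f x - lam * T.prof f x : ℝ) * c x) x := fun x => by
    refine (fiberCoeff_equation hf hd hu k x).congr_deriv ?_
    have hk : ((k.natAbs : ℝ) : ℂ) ^ 2 = (k : ℂ) ^ 2 := by
      rw [Nat.cast_natAbs, Int.cast_abs, ← Complex.ofReal_pow, sq_abs]
      push_cast
      rfl
    rw [← hk]
    push_cast
    rfl
  -- The reduced equation is real, so the real and imaginary parts are solutions separately.
  have key : ∀ L : ℂ →L[ℝ] ℝ, (∀ (r : ℝ) (z : ℂ), L (r * z) = r * L z) →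
      L (c 0) * endVal (k.natAbs, true) (T.profC f) lam = 0 ∧
      L (q 0) * endVal (k.natAbs, false) (T.profC f) lam = 0 ∧
      ∀ x, L (c x) = L (c 0) * slExt (k.natAbs, true) (T.profC f) lam x
        + L (q 0) * slExt (k.natAbs, false) (T.profC f) lam x := by
    intro L hL
    refine periodic_solution hf (g := fun x => L (c x)) (q := fun x => L (q x))
      (fun x => congrArg L (hcp x)) (fun x => congrArg L (hqp x)) (fun x => ?_) (fun x => ?_)
    · refine (L.hasFDerivAt.comp_hasDerivAt x (hcd x)).congr_deriv ?_
      rw [hL, div_eq_inv_mul]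
    · refine (L.hasFDerivAt.comp_hasDerivAt x (hqd x)).congr_deriv ?_
      rw [hL]
  obtain ⟨r₁, r₂, r₃⟩ := key Complex.reCLM fun r z => Complex.re_ofReal_mul r z
  obtain ⟨i₁, i₂, i₃⟩ := key Complex.imCLM fun r z => Complex.im_ofReal_mul r z
  simp only [Complex.reCLM_apply, Complex.imCLM_apply] at r₁ r₂ r₃ i₁ i₂ i₃
  refine ⟨fun b => if b then c 0 else q 0, fun b => ?_, fun x => ?_⟩
  · cases b
    · apply Complex.ext
      · simpa using r₂
      · simpa using i₂
    · apply Complex.ext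
      · simpa using r₁
      · simpa using i₁
  · apply Complex.ext
    · simpa using r₃ x
    · simpa using i₃ x

/-- If no two eigenvalue problems share the eigenvalue `lam`, then all eigenfunctions are rotations
of multiples of one. -/
theorem exists_normal_form {f : T.Bridge} (hf : f ∈ T.adm) {lam : ℝ}
    (hgood : ∀ i j : ℕ × Bool, i ≠ j →
      ¬(endVal i (T.profC f) lam = 0 ∧ endVal j (T.profC f) lam = 0)) :
    ∃ i : ℕ × Bool, ∀ u ∈ eigenspace ℝ (T.prof f) lam, ∃ γ : ℂ, ∀ x θ : ℝ,
      lift u ![x, θ] = slExt i (T.profC f) lam x * (γ * Complex.exp (i.1 * Complex.I * θ)).re := by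
  have hd := T.cutoff.differentiable_profile T.pos T.lt f
  obtain ⟨⟨n, b⟩, hi⟩ : ∃ i : ℕ × Bool, ∀ j, j ≠ i → endVal j (T.profC f) lam ≠ 0 := by
    by_cases h : ∃ i, endVal i (T.profC f) lam = 0
    · obtain ⟨i, hi⟩ := h
      exact ⟨i, fun j hj hj' => hgood i j hj.symm ⟨hi, hj'⟩⟩
    · push Not at h
      -- If `lam` is an eigenvalue of no type, any index will do.
      exact ⟨(0, true), fun j _ => h j⟩
  refine ⟨(n, b), fun u hu => ?_⟩
  have hs := ((mem_eigenspace_iff hf hd).1 hu).1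
  choose A hA hAx using fun k => fiberCoeff_eq hf hu k
  have hA0 : ∀ k d, (k.natAbs, d) ≠ (n, b) → A k d = 0 := fun k d h =>
    (mul_eq_zero.1 (hA k d)).resolve_right (by exact_mod_cast hi _ h)
  have hout : ∀ x, ∀ k ∉ ({(n : ℤ), -(n : ℤ)} : Finset ℤ), fiberCoeff k (lift u) x = 0 := by
    intro x k hk
    have hkn : k.natAbs ≠ n := by
      intro h
      apply hk
      rw [← h]
      simp only [Finset.mem_insert, Finset.mem_singleton]
      omega
    rw [hAx, hA0 k true (by simp [hkn]), hA0 k false (by simp [hkn])]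
    simp
  have hin : ∀ x, ∀ k ∈ ({(n : ℤ), -(n : ℤ)} : Finset ℤ), fiberCoeff k (lift u) x =
      A k b * slExt (n, b) (T.profC f) lam x := by
    intro x k hk
    have hkn : k.natAbs = n := by
      simp only [Finset.mem_insert, Finset.mem_singleton] at hk
      omega
    rw [hAx, hkn]
    cases b
    · rw [hA0 k true (by simp)]
      simp
    · rw [hA0 k false (by simp)]
      simp
  -- The term of weight `-n` is rewritten by `Re (D e^{-inθ}) = Re (conj D e^{inθ})`. For `n = 0`
  -- the index set is a singleton, so nothing is counted twice.
  refine ⟨∑ k ∈ ({(n : ℤ), -(n : ℤ)} : Finset ℤ), if k = n then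
    ((1 / (2 * Real.pi) : ℝ) : ℂ) * A k b else
    (starRingEnd ℂ) (((1 / (2 * Real.pi) : ℝ) : ℂ) * A k b), fun x θ => ?_⟩
  have h := congrArg Complex.re (lift_eq_sum_fiberCoeff hs.continuous _ (hout x) θ)
  rw [Complex.ofReal_re, Complex.re_sum] at h
  rw [h, Finset.sum_mul, Complex.re_sum, Finset.mul_sum]
  refine Finset.sum_congr rfl fun k hk => ?_
  rw [hin x k hk]
  set D := ((1 / (2 * Real.pi) : ℝ) : ℂ) * A k b with hD
  have e : ((1 / (2 * Real.pi) : ℝ) : ℂ) * (A k b * slExt (n, b) (T.profC f) lam x) *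
      Complex.exp (k * Complex.I * θ) =
      (slExt (n, b) (T.profC f) lam x : ℝ) * (D * Complex.exp (k * Complex.I * θ)) := by
    rw [hD]
    ring
  rw [e, Complex.re_ofReal_mul]
  congr 1
  split_ifs with hkn
  · rw [hkn]
    simp
  · have hkn' : k = -(n : ℤ) := by
      simp only [Finset.mem_insert, Finset.mem_singleton] at hk
      exact hk.resolve_left hkn
    rw [← Complex.conj_re, map_mul, ← Complex.exp_conj, hkn']
    simp

end TorusFamily

/-! ### Irreducibility from the normal form -/

/-- A representation in which every nonzero vector spans, up to the action, is irreducible. -/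
theorem isIrreducible_of_exists_smul {K G V : Type*} [Monoid G] [Field K] [AddCommGroup V]
    [Module K V] (ρ : Representation K G V) (hne : ∃ v : V, v ≠ 0)
    (h : ∀ v w : V, v ≠ 0 → ∃ (c : K) (g : G), w = c • ρ g v) : ρ.IsIrreducible := by
  obtain ⟨v₀, hv₀⟩ := hne
  refine { exists_pair_ne := ⟨⊥, ⊤, fun e => hv₀ ?_⟩, eq_bot_or_eq_top := fun τ => ?_ }
  · have hm : v₀ ∈ (⊤ : Subrepresentation ρ).toSubmodule := Submodule.mem_top
    rw [← e] at hm
    exact (Submodule.mem_bot K).1 hm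
  · by_cases hτ : ∃ v ∈ τ.toSubmodule, v ≠ 0
    · right
      obtain ⟨v, hv, hv0⟩ := hτ
      refine Subrepresentation.toSubmodule_injective (eq_top_iff.2 fun w _ => ?_)
      obtain ⟨c, g, rfl⟩ := h v w hv0
      exact τ.toSubmodule.smul_mem c (τ.apply_mem_toSubmodule g hv)
    · left
      push Not at hτ
      exact Subrepresentation.toSubmodule_injective
        (eq_bot_iff.2 fun w hw => (Submodule.mem_bot K).2 (hτ w hw))

theorem torus_ext {F : Type*} {u v : Torus → F} (h : ∀ x θ : ℝ, lift u ![x, θ] = lift v ![x, θ]) :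
    u = v := by
  funext s
  obtain ⟨x, hx⟩ := QuotientAddGroup.mk_surjective s.1
  have := h x (Complex.arg s.2)
  rw [lift_pair, lift_pair, Circle.exp_arg] at this
  rw [show s = (s.1, s.2) from rfl, ← hx]
  exact this

theorem lift_rotation (φ : ℝ) (u : Torus → ℝ) (x θ : ℝ) :
    lift (rotation (Circle.exp φ) u) ![x, θ] = lift u ![x, θ - φ] := by
  rw [lift_pair, lift_pair, Circle.exp_sub, div_eq_mul_inv, mul_comm]
  rfl

/-- Any two nonzero multiples of `Re e^{inθ}` differ by a rotation and a scaling. -/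
theorem exists_rotation_re (n : ℕ) (γ δ : ℂ) (hγ : ∃ θ : ℝ,
    (γ * Complex.exp (n * Complex.I * θ)).re ≠ 0) : ∃ c φ : ℝ, ∀ θ : ℝ,
    (δ * Complex.exp (n * Complex.I * θ)).re =
      c * (γ * Complex.exp (n * Complex.I * ((θ - φ : ℝ) : ℂ))).re := by
  rcases Nat.eq_zero_or_pos n with rfl | hn
  · obtain ⟨θ, hθ⟩ := hγ
    simp only [Nat.cast_zero, zero_mul, Complex.exp_zero, mul_one] at hθ ⊢
    exact ⟨δ.re / γ.re, 0, fun _ => (div_mul_cancel₀ _ hθ).symm⟩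
  · have hγ0 : γ ≠ 0 := by
      rintro rfl
      simp at hγ
    have hn' : (n : ℂ) ≠ 0 := by exact_mod_cast hn.ne'
    refine ⟨‖δ / γ‖, -(Complex.arg (δ / γ) / n), fun θ => ?_⟩
    rw [← Complex.re_ofReal_mul]
    congr 1
    have e : (n * Complex.I * ((θ - -(Complex.arg (δ / γ) / n) : ℝ) : ℂ)) =
        n * Complex.I * θ + Complex.arg (δ / γ) * Complex.I := by
      push_cast
      field_simp
      ring
    rw [e, Complex.exp_add]
    have h := Complex.norm_mul_exp_arg_mul_I (δ / γ)
    calc δ * Complex.exp (n * Complex.I * θ)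
        = (δ / γ) * γ * Complex.exp (n * Complex.I * θ) := by rw [div_mul_cancel₀ _ hγ0]
      _ = _ := by
        nth_rw 1 [← h]
        ring

theorem TorusFamily.mem_irreducibleSet {T : TorusFamily} {f : T.Bridge} (hf : f ∈ T.adm)
    (hgood : ∀ lam : ℝ, ∀ i j : ℕ × Bool, i ≠ j →
      ¬(endVal i (T.profC f) lam = 0 ∧ endVal j (T.profC f) lam = 0)) :
    f ∈ irreducibleSet T.ε T.χ₁ T.χ₂ := by
  refine ⟨hf, fun lam hlam => ?_⟩
  obtain ⟨i, hi⟩ := TorusFamily.exists_normal_form hf (hgood lam)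
  refine isIrreducible_of_exists_smul _ ?_ ?_
  · obtain ⟨u, hu, hu0⟩ := (Submodule.ne_bot_iff _).1 hlam
    exact ⟨⟨u, hu⟩, fun h => hu0 (congrArg Subtype.val h)⟩
  · rintro ⟨u, hu⟩ ⟨v, hv⟩ hne
    obtain ⟨γ, hγ⟩ := hi u hu
    obtain ⟨δ, hδ⟩ := hi v hv
    obtain ⟨c, φ, hc⟩ := exists_rotation_re i.1 γ δ (by
      by_contra! h
      refine hne (Subtype.ext (torus_ext fun x θ => ?_))
      change lift u ![x, θ] = 0
      rw [hγ, h, mul_zero])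
    refine ⟨c, Circle.exp φ, Subtype.ext (torus_ext fun x θ => ?_)⟩
    change lift v ![x, θ] = c * lift (rotation (Circle.exp φ) u) ![x, θ]
    rw [lift_rotation, hγ, hδ, hc]
    ring

/-! ### Equivariant eigenfunctions of equal modulus -/

section

variable {E : Type*} [NormedAddCommGroup E] [InnerProductSpace ℝ E]

/-- A solution of `φ'' + b φ' = q φ` with derivative `φ'`. -/
structure IsSolutionPair (b q : ℝ → ℝ) (φ dφ : ℝ → E) : Prop where
  hasDerivAt : ∀ x, HasDerivAt φ (dφ x) x
  hasDerivAt_deriv : ∀ x, HasDerivAt dφ (-(b x • dφ x) + q x • φ x) x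

namespace IsSolutionPair

variable {b q : ℝ → ℝ} {φ dφ : ℝ → E}

theorem hasDerivAt_norm_sq (h : IsSolutionPair b q φ dφ) (x : ℝ) :
    HasDerivAt (fun y => ‖φ y‖ ^ 2) (2 * inner ℝ (φ x) (dφ x)) x :=
  (h.hasDerivAt x).norm_sq

theorem hasDerivAt_inner (h : IsSolutionPair b q φ dφ) (x : ℝ) :
    HasDerivAt (fun y => inner ℝ (φ y) (dφ y))
      (‖dφ x‖ ^ 2 - b x * inner ℝ (φ x) (dφ x) + q x * ‖φ x‖ ^ 2) x := by
  refine ((h.hasDerivAt x).inner ℝ (h.hasDerivAt_deriv x)).congr_deriv ?_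
  rw [inner_add_right, inner_neg_right, inner_smul_right, inner_smul_right,
    real_inner_self_eq_norm_sq, real_inner_self_eq_norm_sq]
  ring

theorem hasDerivAt_norm_deriv_sq (h : IsSolutionPair b q φ dφ) (x : ℝ) :
    HasDerivAt (fun y => ‖dφ y‖ ^ 2)
      (-(2 * b x * ‖dφ x‖ ^ 2) + 2 * q x * inner ℝ (φ x) (dφ x)) x := by
  refine (h.hasDerivAt_deriv x).norm_sq.congr_deriv ?_
  rw [inner_add_right, inner_neg_right, inner_smul_right, inner_smul_right,
    real_inner_self_eq_norm_sq, real_inner_comm]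
  ring

end IsSolutionPair

/-- If solutions of the reduced equation for two distinct weights have the same modulus, then the
profile is constant. -/
theorem deriv_eq_zero_of_norm_eq {a : ℝ → ℝ} (ha : ∀ x, 0 < a x) (hd : Differentiable ℝ a)
    {n m lam : ℝ} (hnm : n ^ 2 ≠ m ^ 2) {φ dφ ψ dψ : ℝ → E}
    (h₁ : IsSolutionPair (fun x => deriv a x / a x) (fun x => n ^ 2 / a x ^ 2 - lam) φ dφ)
    (h₂ : IsSolutionPair (fun x => deriv a x / a x) (fun x => m ^ 2 / a x ^ 2 - lam) ψ dψ)
    (hφ : ∃ x, φ x ≠ 0) (h : ∀ x, ‖φ x‖ = ‖ψ x‖) (x : ℝ) : deriv a x = 0 := by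
  have hnm' : m ^ 2 - n ^ 2 ≠ 0 := sub_ne_zero.2 hnm.symm
  have hC : ∀ y, inner ℝ (φ y) (dφ y) = inner ℝ (ψ y) (dψ y) := fun y => by
    have e := h₂.hasDerivAt_norm_sq y
    simp only [← h] at e
    linarith [(h₁.hasDerivAt_norm_sq y).unique e]
  have hP : ∀ y, ‖dφ y‖ ^ 2 - ‖dψ y‖ ^ 2 = (m ^ 2 - n ^ 2) * (‖φ y‖ ^ 2 / a y ^ 2) := fun y => by
    have e := h₂.hasDerivAt_inner y
    simp only [← h, ← hC] at e
    have := (h₁.hasDerivAt_inner y).unique e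
    linear_combination this
  have hsq : ∀ y, HasDerivAt (fun y => a y ^ 2) (2 * a y * deriv a y) y := fun y => by
    exact ((hd y).hasDerivAt.pow 2).congr_deriv (by simp)
  -- Differentiating `hP` gives the same multiple of the inner product with opposite signs on the
  -- two sides, while the terms in `deriv a` cancel.
  have hC0 : ∀ y, inner ℝ (φ y) (dφ y) = 0 := fun y => by
    have e₁ := (h₁.hasDerivAt_norm_deriv_sq y).sub (h₂.hasDerivAt_norm_deriv_sq y)
    have e₂ := ((h₁.hasDerivAt_norm_sq y).div (hsq y) (pow_pos (ha y) 2).ne').const_mul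
      (m ^ 2 - n ^ 2)
    have e := (e₁.congr_of_eventuallyEq (Eventually.of_forall fun z => (hP z).symm)).unique e₂
    have hy := (ha y).ne'
    have hPy := hP y
    rw [← hC] at e
    field_simp at e hPy
    have : a y * ((m ^ 2 - n ^ 2) * inner ℝ (φ y) (dφ y)) = 0 := by
      linear_combination -(1 / 2) * e - (1 / 2) * deriv a y * hPy
    simpa [hnm', hy] using this
  have hconst : ∀ y, ‖φ y‖ ^ 2 = ‖φ x‖ ^ 2 := fun y =>
    is_const_of_deriv_eq_zero (fun z => (h₁.hasDerivAt_norm_sq z).differentiableAt)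
      (fun z => by rw [(h₁.hasDerivAt_norm_sq z).deriv, hC0, mul_zero]) y x
  have hS : 0 < ‖φ x‖ ^ 2 := by
    obtain ⟨z, hz⟩ := hφ
    rw [← hconst z]
    positivity
  have hzero : ∀ {k : ℝ} {χ dχ : ℝ → E},
      IsSolutionPair (fun x => deriv a x / a x) (fun x => k ^ 2 / a x ^ 2 - lam) χ dχ →
      (∀ y, inner ℝ (χ y) (dχ y) = 0) → ∀ y, ‖dχ y‖ ^ 2 = (lam - k ^ 2 / a y ^ 2) * ‖χ y‖ ^ 2 := by
    intro k χ dχ hχ h0 y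
    have e := hχ.hasDerivAt_inner y
    simp only [h0] at e
    linarith [e.unique (hasDerivAt_const y (0 : ℝ))]
  have hP₁ := hzero h₁ hC0
  have hP₂ := hzero h₂ fun y => (hC y).symm.trans (hC0 y)
  have hx := (ha x).ne'
  -- The modulus is now constant, so `‖dφ‖² = (lam - n² / a²) ‖φ‖²` can be differentiated explicitly
  -- and compared with the equation.
  have key : deriv a x * lam = 0 := by
    have e₁ := h₁.hasDerivAt_norm_deriv_sq x
    have e₂ := ((((hsq x).inv (pow_pos (ha x) 2).ne').const_mul (n ^ 2)).const_sub lam).mul_const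
      (‖φ x‖ ^ 2)
    have e := (e₁.congr_of_eventuallyEq (Eventually.of_forall fun z => by
      change (lam - n ^ 2 * (a z ^ 2)⁻¹) * ‖φ x‖ ^ 2 = ‖dφ z‖ ^ 2
      rw [hP₁, hconst z, ← div_eq_mul_inv])).unique e₂
    rw [hC0, hP₁] at e
    field_simp at e
    have : deriv a x * lam * (a x ^ 2 * ‖φ x‖ ^ 2) = 0 := by linear_combination -e
    exact (mul_eq_zero.1 this).resolve_right (mul_pos (pow_pos (ha x) 2) hS).ne'
  rcases mul_eq_zero.1 key with h0 | h0
  · exact h0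
  -- For `lam = 0` the squared norms of the derivatives would be nonpositive, so both weights would
  -- vanish, contrary to `hnm`.
  · exfalso
    have hk : ∀ k t : ℝ, 0 ≤ t → t = (0 - k ^ 2 / a x ^ 2) * ‖φ x‖ ^ 2 → k ^ 2 = 0 := by
      intro k t ht e
      have h3 : 0 ≤ k ^ 2 / a x ^ 2 := by positivity
      have h4 : k ^ 2 / a x ^ 2 = 0 := by nlinarith
      simpa [hx] using h4
    subst h0
    refine hnm ((hk n (‖dφ x‖ ^ 2) (sq_nonneg _) (hP₁ x)).trans
      (hk m (‖dψ x‖ ^ 2) (sq_nonneg _) ?_).symm)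
    rw [h x]
    exact hP₂ x

end

theorem lift_of_isEquivariant {n : ℤ} {Φ : Torus → ℂ} (h : IsEquivariant n Φ) (x θ : ℝ) :
    lift Φ ![x, θ] = Complex.exp (n * Complex.I * θ) * lift Φ ![x, 0] := by
  rw [lift_pair, lift_pair, Circle.exp_zero]
  have e := h ((x : AddCircle (2 : ℝ)), 1) (Circle.exp θ)
  rw [mul_one] at e
  rw [e, Circle.coe_exp, ← Complex.exp_int_mul]
  congr 2
  ring

theorem pderiv_one_of_isEquivariant {n : ℤ} {G : (Fin 2 → ℝ) → ℂ} (hG : ContDiff ℝ ∞ G)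
    (h : ∀ x θ : ℝ, G ![x, θ] = Complex.exp (n * Complex.I * θ) * G ![x, 0]) :
    pderiv 1 G = ((n : ℂ) * Complex.I) • G := by
  funext p
  rw [← pair_eta p]
  have e₁ := hasDerivAt_slice_one (hG.differentiable (by simp)) (p 0) (p 1)
  have e₂ : HasDerivAt (fun θ : ℝ => (n : ℂ) * Complex.I * θ) (n * Complex.I) (p 1) := by
    have := (hasDerivAt_id (p 1)).ofReal_comp.const_mul ((n : ℂ) * Complex.I)
    rwa [Complex.ofReal_one, mul_one] at this
  rw [e₁.unique ((e₂.cexp.mul_const (G ![p 0, 0])).congr_of_eventuallyEq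
    (Eventually.of_forall fun θ => h (p 0) θ)), Pi.smul_apply, h (p 0) (p 1), smul_eq_mul]
  ring

/-- Equivariance turns `∂_θ²` into multiplication by `-n²`, so the restriction to `θ = 0` solves an
ordinary equation. -/
theorem isSolutionPair_of_isEquivariant {a : ℝ → ℝ} (ha : ∀ x, 0 < a x) (hd : Differentiable ℝ a)
    {n : ℤ} {lam : ℝ} {Φ : Torus → ℂ} (hΦ : Φ ∈ eigenspace ℂ a lam) (h : IsEquivariant n Φ) :
    IsSolutionPair (fun x => deriv a x / a x) (fun x => (n : ℝ) ^ 2 / a x ^ 2 - lam)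
      (fun x => lift Φ ![x, 0]) (fun x => pderiv 0 (lift Φ) ![x, 0]) := by
  obtain ⟨hs, heq⟩ := (mem_eigenspace_iff ha hd).1 hΦ
  refine ⟨fun x => hasDerivAt_slice_zero (hs.differentiable (by simp)) x 0, fun x => ?_⟩
  refine (hasDerivAt_slice_zero ((contDiff_pderiv hs 0).differentiable (by simp)) x
    0).congr_deriv ?_
  have e₁ := pderiv_one_of_isEquivariant hs (lift_of_isEquivariant h)
  have e₂ : pderiv 1 (((n : ℂ) * Complex.I) • lift Φ) ![x, 0] =
      ((n : ℂ) * Complex.I) * pderiv 1 (lift Φ) ![x, 0] := by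
    simp only [pderiv]
    rw [fderiv_const_smul_field]
    rfl
  have e := heq ![x, 0]
  rw [e₁, e₂, e₁] at e
  simp only [Pi.smul_apply, Complex.real_smul, smul_eq_mul, Matrix.cons_val_zero] at e ⊢
  push_cast at e ⊢
  linear_combination e - (n : ℂ) ^ 2 * lift Φ ![x, 0] / (a x : ℂ) ^ 2 * Complex.I_sq

/-- Equivariant eigenfunctions of different weight but equal eigenvalue and modulus force a flat
metric. -/
theorem exists_eq_const_of_norm_eq {a : ℝ → ℝ} (hd : Differentiable ℝ a) (ha : ∀ x, 0 < a x)
    {n m : ℤ} {lam : ℝ} {Φ Ψ : Torus → ℂ} (hnm : |n| ≠ |m|) (hΦ0 : Φ ≠ 0)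
    (hΦ : Φ ∈ eigenspace ℂ a lam) (hΨ : Ψ ∈ eigenspace ℂ a lam) (hn : IsEquivariant n Φ)
    (hm : IsEquivariant m Ψ) (h : ∀ s, ‖Φ s‖ = ‖Ψ s‖) : ∃ c : ℝ, ∀ x, a x = c := by
  have hnm' : ((n : ℝ)) ^ 2 ≠ (m : ℝ) ^ 2 := fun e => hnm (sq_eq_sq_iff_abs_eq_abs _ _ |>.1
    (by exact_mod_cast e))
  refine ⟨a 0, fun x => is_const_of_deriv_eq_zero hd (deriv_eq_zero_of_norm_eq ha hd hnm'
    (isSolutionPair_of_isEquivariant ha hd hΦ hn) (isSolutionPair_of_isEquivariant ha hd hΨ hm)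
    ?_ fun y => h _) x 0⟩
  by_contra! h0
  refine hΦ0 (torus_ext fun y θ => ?_)
  rw [lift_of_isEquivariant hn, h0, mul_zero]
  rfl

/-- The set of good bridge functions is residual in every set of admissible functions that lies in
the closure of its interior. -/
theorem TorusFamily.isResidualIn_irreducibleSet (T : TorusFamily) {Y : Set T.Bridge}
    (hYA : Y ⊆ T.adm) (hY : Y ⊆ closure (interior Y)) :
    IsResidualIn (irreducibleSet T.ε T.χ₁ T.χ₂) Y := by
  refine isResidualIn_of_iInter
    (ι := {p : (ℕ × Bool) × (ℕ × Bool) // p.1 ≠ p.2} × ℕ) (A := T.adm)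
    (G := fun z => goodOn T z.1.1.1 z.1.1.2 (Icc (-(z.2 : ℝ)) z.2))
    (fun z => isOpen_goodOn _ _ isCompact_Icc)
    (fun z => subset_closure_goodOn z.1.2 isCompact_Icc) ?_ hYA hY
  rintro f ⟨hf, hG⟩
  refine TorusFamily.mem_irreducibleSet hf fun lam i j hij => ?_
  -- The windows `[-R, R]` with `R` natural exhaust the line and keep the index set countable.
  obtain ⟨R, hR⟩ := exists_nat_ge |lam|
  exact (mem_iInter.1 hG (⟨(i, j), hij⟩, R)).2 lam (abs_le.1 hR)

end TorusOfRevolution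

end

theorem lemma7p8 (ε : ℝ) (hε : 0 < ε) (hε' : ε < 1 / 2) (χ₁ χ₂ : ℝ → ℝ)
    (hχ : TorusOfRevolution.IsCutoffPair ε χ₁ χ₂) :
    -- the set of admissible bridge functions is open, and `M_irr` is residual in it
    (IsOpen (TorusOfRevolution.admissible ε χ₁ χ₂) ∧
      TorusOfRevolution.IsResidualIn (TorusOfRevolution.irreducibleSet ε χ₁ χ₂)
        (TorusOfRevolution.admissible ε χ₁ χ₂)) ∧
    -- `M_irr` is residual in closed balls, for the Fréchet distance and for the `C^k` distances
    (∀ (f₀ : TorusOfRevolution.SmoothIcc ε (2 * ε)) (δ : ℝ), 0 < δ →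
      TorusOfRevolution.IsResidualIn (TorusOfRevolution.irreducibleSet ε χ₁ χ₂)
        (TorusOfRevolution.admissible ε χ₁ χ₂ ∩
          {f | TorusOfRevolution.SmoothIcc.distFrechet f f₀ ≤ δ}) ∧
      ∀ k : ℕ, TorusOfRevolution.IsResidualIn (TorusOfRevolution.irreducibleSet ε χ₁ χ₂)
        (TorusOfRevolution.admissible ε χ₁ χ₂ ∩
          {f | TorusOfRevolution.SmoothIcc.distC k f f₀ ≤ δ})) ∧
    -- equivariant eigenfunctions of equal modulus with a common eigenvalue force a flat metric
    (∀ a : ℝ → ℝ, ContDiff ℝ ∞ a → Function.Periodic a 2 → (∀ x, 0 < a x) →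
      ∀ (n m : ℤ) (lam : ℝ) (Φ Ψ : TorusOfRevolution.Torus → ℂ), |n| ≠ |m| → Φ ≠ 0 →
        Φ ∈ TorusOfRevolution.eigenspace ℂ a lam → Ψ ∈ TorusOfRevolution.eigenspace ℂ a lam →
        TorusOfRevolution.IsEquivariant n Φ → TorusOfRevolution.IsEquivariant m Ψ →
        (∀ s, ‖Φ s‖ = ‖Ψ s‖) → ∃ c : ℝ, ∀ x, a x = c) := by
  let T : TorusOfRevolution.TorusFamily := ⟨ε, χ₁, χ₂, hε, hε', hχ⟩
  have : Fact (ε < 2 * ε) := ⟨by linarith⟩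
  have hopen : IsOpen T.adm := T.isOpen_adm
  refine ⟨⟨hopen, T.isResidualIn_irreducibleSet subset_rfl ?_⟩, fun f₀ δ hδ => ?_, ?_⟩
  · rw [hopen.interior_eq]
    exact subset_closure
  · have h := TorusOfRevolution.SmoothIcc.ball_subset_closure_interior hopen f₀ hδ
    exact ⟨T.isResidualIn_irreducibleSet Set.inter_subset_left h.1,
      fun k => T.isResidualIn_irreducibleSet Set.inter_subset_left (h.2 k)⟩
  · intro a hs _ hpos n m lam Φ Ψ hnm hΦ0 hΦ hΨ hn hm h
    exact TorusOfRevolution.exists_eq_const_of_norm_eq (hs.differentiable (by simp)) hpos hnm hΦ0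
      hΦ hΨ hn hm h
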